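/- **Setting.** Let $f_\oplus$ be a probability density on $\mathbb R$ with finite second moment whose support $D_\oplus$ is an interval; write $\mu_\oplus(du)=f_\oplus(u)\,du$, and $F_\oplus$, $Q_\oplus$ for its cdf and quantile function. Let $\mathcal T_{f_\oplus}\subset L^2(\mu_\oplus)$ be the tangent space, i.e. the $L^2(\mu_\oplus)$-closure of all $\lambda(T-\mathrm{id})$ with $\lambda>0$ and $T$ the optimal transport map from $\mu_\oplus$ to some probability measure with finite second moment. Let $\{\epsilon_t\}_{t\in\mathbb Z}$ be processes that lie a.s. in $\mathcal T_{f_\oplus}$, let $\beta_1,\dots,\beta_p\in\mathbb R$, and let $\{V_t\}_{t\in\mathbb Z}$ be a (second-order) stationary solution in $\mathcal T_{f_\oplus}$ of $V_t=\sum_{j=1}^p\beta_jV_{t-j}+\epsilon_t$. Put $\mu_t=(V_t+\mathrm{id})_\#\mu_\oplus$, let $Q_t$ be the quantile function of $\mu_t$, and $T_t=Q_t\circ F_\oplus$. Assume: * (A1') $\phi(z)=1-\beta_1z-\dots-\beta_pz^p$ has no root in $\{z\in\mathbb C:|z|\le1\}$; write $1/\phi(z)=\sum_{i\ge0}\psi_iz^i$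 and $\psi_i=0$ for $i<0$. * (A2) The $\epsilon_t$ are iid random elements of $\mathcal T_{f_\oplus}$ with mean zero, and $\int C_\epsilon(u,u)f_\oplus(u)\,du<\infty$, where $C_\epsilon(u,v)=\operatorname{Cov}(\epsilon_t(u),\epsilon_t(v))$. * (A3) Almost surely, $V_t$ is differentiable with $V_t'(u)>-1$ on (the interior of) $D_\oplus$. * (A4) $\int\mathbb E[\epsilon_t^4(u)]f_\oplus(u)\,du<\infty$. Let $\eta_k(u)=\operatorname{Cov}(T_t(u)-u,\,T_{t+k}(u)-u)$, assume $\int\eta_0f_\oplus>0$, and let $\rho_k=\int\eta_kf_\oplus\big/\int\eta_0f_\oplus$ be the lag-$k$ Wasserstein autocorrelation. Given $Q_1,\dots,Q_n$, put $\widehat F_\oplus=\big(\tfrac1n\sum_{t=1}^nQ_t\big)^{-1}$, $\hat f_\oplus=\widehat F_\oplus'$, $\widehat T_t=Q_t\circ\widehat F_\oplus$, $$\hat\eta_k(u)=\frac1n\sum_{t=1}^{n-k}\{\widehat T_t(u)-u\}\{\widehat T_{t+k}(u)-u\},\qquad \hat\rho_k=\frac{\int\hat\eta_k(u)\hat f_\oplus(u)\,du}{\int\hat\eta_0(u)\hat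 f_\oplus(u)\,du}.$$ **Theorem.** For every fixed $h$, with $\hat{\boldsymbol\varrho}_h=(\hat\rho_1,\dots,\hat\rho_h)^\top$ and $\boldsymbol\varrho_h=(\rho_1,\dots,\rho_h)^\top$, $$n^{1/2}(\hat{\boldsymbol\varrho}_h-\boldsymbol\varrho_h)\overset{D}{\to}\mathbf N(0,\mathbf D\mathbf V\mathbf D^\top).$$ Here $\mathbf D$ is the $h\times(h+1)$ matrix whose $k$-th row is $\big(\int\eta_0f_\oplus\big)^{-1}(-\rho_k,0,\dots,0,1,0,\dots,0)$ with the $1$ in the column of lag $k$ (columns are indexed by the lags $0,\dots,h$), and $\mathbf V=(v_{ij})_{0\le i,j\le h}$ is the positive semidefinite matrix $$v_{ij}=\lim_{n\to\infty}n\operatorname{Cov}\Big[\int_0^1\lambda_i^*(s)\,ds,\int_0^1\lambda_j^*(s)\,ds\Big]=\sum_{r=-\infty}^{\infty}\big(S_1(r)K_2+S_2(r)K_1+S_3(r)K_1\big),$$ where $\lambda_k^*(s)=\frac1n\sum_{t=1}^n[Q_t(s)-Q_\oplus(s)][Q_{t+k}(s)-Q_\oplus(s)]$ and $$S_1(r)=\sum_{k\in\mathbb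 Z}\psi_k\psi_{k+i}\psi_{k+r}\psi_{k+r+j},\quad S_2(r)=\sum_{k\in\mathbb Z}\psi_k\psi_{k+r}\sum_{l\in\mathbb Z}\psi_l\psi_{l+r+j-i},\quad S_3(r)=\sum_{k\in\mathbb Z}\psi_k\psi_{k+r+j}\sum_{l\in\mathbb Z}\psi_l\psi_{l+r-i},$$ $$K_1=\int_{\mathbb R^2}C_\epsilon^2(u,v)f_\oplus(u)f_\oplus(v)\,du\,dv,\quad K_2=\int_{\mathbb R^2}\big\{\mathbb E[\epsilon_t^2(u)\epsilon_t^2(v)]-2C_\epsilon^2(u,v)-C_\epsilon(u,u)C_\epsilon(v,v)\big\}f_\oplus(u)f_\oplus(v)\,du\,dv.$$ The limits $v_{ij}$ exist, and these sums and integrals converge absolutely. -/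

import Mathlib

open MeasureTheory ProbabilityTheory Filter Topology

noncomputable section

namespace WAR

/-! ### Densities, cdfs, quantile functions -/

/-- `f` is the density of a probability measure on `ℝ` with finite second moment. -/
structure IsDensity (f : ℝ → ℝ) : Prop where
  measurable : Measurable f
  nonneg : ∀ u, 0 ≤ f u
  mass : ∫⁻ u, ENNReal.ofReal (f u) = 1
  secondMoment : ∫⁻ u, ENNReal.ofReal (u ^ 2 * f u) < ⊤

/-- The measure `f(u) du` on `ℝ`. -/
def densityMeasure (f : ℝ → ℝ) : Measure ℝ :=
  volume.withDensity fun u => ENNReal.ofReal (f u)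

/-- The cumulative distribution function of `ν`. -/
def cdfFun (ν : Measure ℝ) (x : ℝ) : ℝ := ν.real (Set.Iic x)

/-- The quantile function of `ν`, of interest on `(0, 1)`. -/
def quantile (ν : Measure ℝ) (s : ℝ) : ℝ := sInf {x : ℝ | s ≤ cdfFun ν x}

/-- The cdf that belongs to a quantile function `q` on `(0, 1)`: its generalized inverse
`u ↦ sup {s ∈ (0, 1) : q s ≤ u}`, with value `0` if no such `s` exists. -/
def quantileInv (q : ℝ → ℝ) (u : ℝ) : ℝ := sSup {s : ℝ | s ∈ Set.Ioo (0 : ℝ) 1 ∧ q s ≤ u}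

/-! ### Tangent space, logarithmic and exponential map -/

/-- `T` is the optimal transport map from `μ` to `ν` for the quadratic cost. -/
structure IsOptimalTransport (μ ν : Measure ℝ) (T : ℝ → ℝ) : Prop where
  measurable : Measurable T
  map_eq : μ.map T = ν
  optimal : ∀ K : ℝ → ℝ, Measurable K → μ.map K = ν →
    ∫⁻ u, ‖T u - u‖ₑ ^ 2 ∂μ ≤ ∫⁻ u, ‖K u - u‖ₑ ^ 2 ∂μ

/-- The tangent space at `μ`: the `L²(μ)`-closure of the functions `c (T - id)` where `c > 0` and
`T` is the optimal transport from `μ` to some probability measure with finite second moment. -/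
def tangentSpace (μ : Measure ℝ) : Set (Lp ℝ 2 μ) :=
  closure {g | ∃ (c : ℝ) (ν : Measure ℝ) (T : ℝ → ℝ), 0 < c ∧ IsProbabilityMeasure ν ∧
    MemLp id 2 ν ∧ IsOptimalTransport μ ν T ∧ g =ᵐ[μ] fun u => c * (T u - u)}

/-- `Exp_f (v)`, the push-forward of `f(u) du` under `v + id`. -/
def expMap (f : ℝ → ℝ) (v : ℝ → ℝ) : Measure ℝ := (densityMeasure f).map fun u => v u + u

/-- `Log_f (ν) = G⁻¹ ∘ F - id`, where `F` is the cdf of `f` and `G⁻¹` the quantile function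
of `ν`. -/
def logMap (f : ℝ → ℝ) (ν : Measure ℝ) (u : ℝ) : ℝ :=
  quantile ν (cdfFun (densityMeasure f) u) - u

/-! ### Random elements of the tangent space -/

/-- The `L²(μ)`-class of a function (and `0` if the function is not square integrable). -/
def toL2 (μ : Measure ℝ) (g : ℝ → ℝ) : Lp ℝ 2 μ :=
  open Classical in if hg : MemLp g 2 μ then hg.toLp g else 0

/-- `L²(μ)` carries its Borel σ-algebra. -/
instance instMeasurableSpaceL2 (μ : Measure ℝ) : MeasurableSpace (Lp ℝ 2 μ) := borel _

instance instBorelSpaceL2 (μ : Measure ℝ) : BorelSpace (Lp ℝ 2 μ) := ⟨rfl⟩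

variable {Ω : Type*} [MeasurableSpace Ω]

/-- A (jointly measurable) stochastic process that is almost surely in the tangent space at `μ`. -/
structure IsTangentProcess (P : Measure Ω) (μ : Measure ℝ) (X : Ω → ℝ → ℝ) : Prop where
  measurable : Measurable (Function.uncurry X)
  mem : ∀ᵐ ω ∂P, MemLp (X ω) 2 μ ∧ toL2 μ (X ω) ∈ tangentSpace μ

/-- (Second order) stationarity of a sequence of random elements of a Hilbert space: finite second
moments, constant mean, and autocovariance operators which do not depend on the time. -/
structure IsStationary {H : Type*} [NormedAddCommGroup H] [InnerProductSpace ℝ H]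
    (P : Measure Ω) (X : ℤ → Ω → H) : Prop where
  memLp : ∀ t, MemLp (X t) 2 P
  mean : ∀ t, ∫ ω, X t ω ∂P = ∫ ω, X 0 ω ∂P
  autocov : ∀ (t k : ℤ) (x : H),
    ∫ ω, inner ℝ (X t ω - ∫ ω', X 0 ω' ∂P) x • (X (t + k) ω - ∫ ω', X 0 ω' ∂P) ∂P =
      ∫ ω, inner ℝ (X 0 ω - ∫ ω', X 0 ω' ∂P) x • (X k ω - ∫ ω', X 0 ω' ∂P) ∂P

/-! ### The WAR(p) model and its assumptions

`β j`, for `j : Fin p`, is the coefficient of lag `j + 1`. -/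

/-- The autoregressive polynomial has no root in the closed unit disk. -/
def AutoregressiveCondition {p : ℕ} (β : Fin p → ℝ) : Prop :=
  ∀ z : ℂ, ‖z‖ ≤ 1 → 1 - ∑ j : Fin p, (β j : ℂ) * z ^ ((j : ℕ) + 1) ≠ 0

/-- The innovations are iid elements of the tangent space at `f(u) du`, have mean zero, and
`∫ C_ε(u, u) f(u) du < ∞`. -/
structure InnovationCondition (P : Measure Ω) (f : ℝ → ℝ) (ε : ℤ → Ω → ℝ → ℝ) : Prop where
  tangent : ∀ t, IsTangentProcess P (densityMeasure f) (ε t)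
  indep : iIndepFun (fun t ω => toL2 (densityMeasure f) (ε t ω)) P
  identDistrib : ∀ t, IdentDistrib (fun ω => toL2 (densityMeasure f) (ε t ω))
    (fun ω => toL2 (densityMeasure f) (ε 0 ω)) P P
  mean_zero : ∀ t, ∀ᵐ u ∂densityMeasure f, ∫ ω, ε t ω u ∂P = 0
  variance : ∀ t, ∫⁻ u, evariance (fun ω => ε t ω u) P ∂densityMeasure f < ⊤

/-- `V` is a stationary solution, in the tangent space at `f(u) du`, of
`V_t = ∑_j β_j V_{t-j} + ε_t`. -/
structure IsStationarySolution (P : Measure Ω) (f : ℝ → ℝ) {p : ℕ} (β : Fin p → ℝ)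
    (ε V : ℤ → Ω → ℝ → ℝ) : Prop where
  tangent : ∀ t, IsTangentProcess P (densityMeasure f) (V t)
  stationary : IsStationary P fun t ω => toL2 (densityMeasure f) (V t ω)
  equation : ∀ t, ∀ᵐ ω ∂P, V t ω =ᵐ[densityMeasure f]
    fun u => ∑ j : Fin p, β j * V (t - ((j : ℕ) + 1)) ω u + ε t ω u

/-- Almost surely, `V_t` is differentiable with `V_t' > -1` at the (interior) points of the
support of `f`. -/
def MonotonicityCondition (P : Measure Ω) (f : ℝ → ℝ) (V : ℤ → Ω → ℝ → ℝ) : Prop :=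
  ∀ t, ∀ᵐ ω ∂P, ∀ u ∈ interior (densityMeasure f).support,
    DifferentiableAt ℝ (V t ω) u ∧ -1 < deriv (V t ω) u

/-- `∫ E[ε_t(u)⁴] f(u) du < ∞`. -/
def FourthMomentCondition (P : Measure Ω) (f : ℝ → ℝ) (ε : ℤ → Ω → ℝ → ℝ) : Prop :=
  ∀ t, ∫⁻ u, ∫⁻ ω, ENNReal.ofReal (ε t ω u ^ 4) ∂P ∂densityMeasure f < ⊤

/-! ### Population quantities -/

/-- The Wasserstein autocovariance kernel `γ_k(u, v) = Cov(Log_f(μ_0)(u), Log_f(μ_k)(v))` of the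
random measures `μ_t = Exp_f(V_t)`. -/
def acovKernel (P : Measure Ω) (f : ℝ → ℝ) (V : ℤ → Ω → ℝ → ℝ) (k : ℤ) (u v : ℝ) : ℝ :=
  cov[fun ω => logMap f (expMap f (V 0 ω)) u, fun ω => logMap f (expMap f (V k ω)) v; P]

/-- The integrated autocovariance `∫ η_k(u) f(u) du` with `η_k(u) = γ_k(u, u)`. -/
def intAcov (P : Measure Ω) (f : ℝ → ℝ) (V : ℤ → Ω → ℝ → ℝ) (k : ℤ) : ℝ :=
  ∫ u, acovKernel P f V k u u ∂densityMeasure f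

/-- The lag-`k` Wasserstein autocorrelation. -/
def acorr (P : Measure Ω) (f : ℝ → ℝ) (V : ℤ → Ω → ℝ → ℝ) (k : ℤ) : ℝ :=
  intAcov P f V k / intAcov P f V 0

/-! ### Estimators

They are functions of the quantile functions `Q_1, …, Q_n`. -/

/-- The mean `n⁻¹ ∑_{t=1}^n Q_t` of the quantile functions. -/
def meanQuantile (Q : ℤ → ℝ → ℝ) (n : ℕ) (s : ℝ) : ℝ :=
  (∑ t ∈ Finset.Icc 1 n, Q t s) / n

/-- The estimated Wasserstein mean cdf. -/
def cdfHat (Q : ℤ → ℝ → ℝ) (n : ℕ) : ℝ → ℝ := quantileInv (meanQuantile Q n)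

/-- The estimated Wasserstein mean density. -/
def densityHat (Q : ℤ → ℝ → ℝ) (n : ℕ) : ℝ → ℝ := deriv (cdfHat Q n)

/-- `η̂_k(u) = n⁻¹ ∑_{t=1}^{n-k} (T̂_t(u) - u) (T̂_{t+k}(u) - u)` with `T̂_t = Q_t ∘ F̂`. -/
def etaHat (Q : ℤ → ℝ → ℝ) (n k : ℕ) (u : ℝ) : ℝ :=
  (∑ t ∈ Finset.Icc 1 (n - k),
    (Q t (cdfHat Q n u) - u) * (Q (t + k) (cdfHat Q n u) - u)) / n

/-- The estimated lag-`k` Wasserstein autocorrelation. -/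
def acorrHat (Q : ℤ → ℝ → ℝ) (n k : ℕ) : ℝ :=
  (∫ u, etaHat Q n k u * densityHat Q n u) / ∫ u, etaHat Q n 0 u * densityHat Q n u

/-- The integrated approximate sample autocovariance
`∫₀¹ n⁻¹ ∑_{t=1}^n (Q_t(s) - Q_⊕(s)) (Q_{t+k}(s) - Q_⊕(s)) ds`. -/
def intSampleAcov (Q : ℤ → ℝ → ℝ) (Qmean : ℝ → ℝ) (n k : ℕ) : ℝ :=
  ∫ s in (0 : ℝ)..1, (∑ t ∈ Finset.Icc 1 n, (Q t s - Qmean s) * (Q (t + k) s - Qmean s)) / n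

/-! ### The asymptotic covariance -/

/-- `1 / φ(z) = ∑_{i ≥ 0} ψ_i z^i`, with `ψ_i = 0` for `i < 0`. -/
def psi {p : ℕ} (β : Fin p → ℝ) (i : ℤ) : ℝ :=
  if 0 ≤ i then
    PowerSeries.coeff i.toNat
      (1 - ∑ j : Fin p, PowerSeries.C (β j) * PowerSeries.X ^ ((j : ℕ) + 1) : PowerSeries ℝ)⁻¹
  else 0

/-- The innovation covariance kernel. -/
def innovCov (P : Measure Ω) (ε : ℤ → Ω → ℝ → ℝ) (u v : ℝ) : ℝ :=
  cov[fun ω => ε 0 ω u, fun ω => ε 0 ω v; P]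

/-- The fourth moment kernel `E[ε²(u) ε²(v)] - 2 C_ε(u, v)² - C_ε(u, u) C_ε(v, v)`. -/
def fourthKernel (P : Measure Ω) (ε : ℤ → Ω → ℝ → ℝ) (u v : ℝ) : ℝ :=
  ∫ ω, ε 0 ω u ^ 2 * ε 0 ω v ^ 2 ∂P - 2 * innovCov P ε u v ^ 2
    - innovCov P ε u u * innovCov P ε v v

/-- `K₁ = ∫∫ C_ε(u, v)² f(u) f(v) du dv`. -/
def K1 (P : Measure Ω) (f : ℝ → ℝ) (ε : ℤ → Ω → ℝ → ℝ) : ℝ :=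
  ∫ z : ℝ × ℝ, innovCov P ε z.1 z.2 ^ 2 ∂(densityMeasure f).prod (densityMeasure f)

/-- `K₂`, the integral of the fourth moment kernel against `f(u) f(v) du dv`. -/
def K2 (P : Measure Ω) (f : ℝ → ℝ) (ε : ℤ → Ω → ℝ → ℝ) : ℝ :=
  ∫ z : ℝ × ℝ, fourthKernel P ε z.1 z.2 ∂(densityMeasure f).prod (densityMeasure f)

def S1 {p : ℕ} (β : Fin p → ℝ) (i j r : ℤ) : ℝ :=
  ∑' k : ℤ, psi β k * psi β (k + i) * psi β (k + r) * psi β (k + r + j)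

def S2 {p : ℕ} (β : Fin p → ℝ) (i j r : ℤ) : ℝ :=
  (∑' k : ℤ, psi β k * psi β (k + r)) * ∑' l : ℤ, psi β l * psi β (l + r + j - i)

def S3 {p : ℕ} (β : Fin p → ℝ) (i j r : ℤ) : ℝ :=
  (∑' k : ℤ, psi β k * psi β (k + r + j)) * ∑' l : ℤ, psi β l * psi β (l + r - i)

/-- The `r`-th summand of the series for the long-run covariance `v_{ij}`. -/
def longRunTerm (P : Measure Ω) (f : ℝ → ℝ) {p : ℕ} (β : Fin p → ℝ) (ε : ℤ → Ω → ℝ → ℝ)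
    (i j r : ℤ) : ℝ :=
  S1 β i j r * K2 P f ε + S2 β i j r * K1 P f ε + S3 β i j r * K1 P f ε

/-- The matrix `V`, with rows and columns indexed by the lags `0, …, h`. -/
def longRunCov (P : Measure Ω) (f : ℝ → ℝ) {p : ℕ} (β : Fin p → ℝ) (ε : ℤ → Ω → ℝ → ℝ)
    (h : ℕ) : Matrix (Fin (h + 1)) (Fin (h + 1)) ℝ :=
  Matrix.of fun i j => ∑' r : ℤ, longRunTerm P f β ε (i : ℕ) (j : ℕ) r

/-- The `h × (h + 1)` matrix `D`, whose row for lag `k` is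
`(∫ η_0 f)⁻¹ (-ρ_k, 0, …, 0, 1, 0, …, 0)`, with the `1` in the column for lag `k`. -/
def jacobian (P : Measure Ω) (f : ℝ → ℝ) (V : ℤ → Ω → ℝ → ℝ) (h : ℕ) :
    Matrix (Fin h) (Fin (h + 1)) ℝ :=
  (intAcov P f V 0)⁻¹ • Matrix.of fun (i : Fin h) (j : Fin (h + 1)) =>
    if j = 0 then -acorr P f V ((i : ℕ) + 1) else if j = i.succ then 1 else 0

end WAR

end

/-!
The quantile function of `μ_t` composed with the cdf of `μ_⊕` is `V_t + id`, since by the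
monotonicity condition `V_t + id` is increasing inside the support. Hence every integral over
`(0, 1)` or against the estimated density becomes an inner product in `L²(μ_⊕)`: with
`x_t ∈ L²(μ_⊕)` the class of `V_t`, the sample autocovariances are those of a sequence in a separable
Hilbert space, either about zero (`intSampleAcov_eq`) or about the sample mean
(`integral_etaHat_mul_densityHat`), and transport plays no further role.

The causality condition makes the coefficients `ψ_i` of `1 / φ` absolutely summable, and iterating
the autoregressive equation identifies the stationary solution with the linear process
`x_t = ∑_i ψ_i e_{t-i}`, `e_t` being the class of the innovation
(`IsNoise.ae_eq_linearLp`). Therefore `⟨x_t, x_{t+k}⟩ - γ_k` is a moving average, with absolutely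
summable coefficients `ψ_i ψ_{l+k}`, of the centred products `⟨e_s, e_t⟩ - E⟨e_s, e_t⟩`. These are
real random variables, which are orthogonal in `L²(P)` unless the unordered pairs of times agree
(`IsNoise.isProductArray`); their second moments are the two constants `K₁` and `K₂ + 2 K₁`. This
yields the long-run covariances (`IsProductArray.tendsto_inner_sum_div`), together with the bound
`‖∑_{t ≤ n} (⟨x_t, x_{t+k}⟩ - γ_k)‖ ≤ C √n` in `L²(P)`.

For the central limit theorem (`IsNoise.tendsto_charFun_bilinearAverage`) time is cut into
consecutive blocks of length `L`, and from each summand are dropped the products that involve noise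
outside the block of that summand. By absolute summability this costs, after normalization, an
`L²(P)` error that is small when `L` is large, uniformly in `n` (`tendsto_blockError`); what is left
is a sum of iid square integrable variables, one for each block, to which the classical theorem
applies. Since only second moments of the quadratic forms enter, fourth moments of the innovations
suffice. All approximations are controlled on characteristic functions, whose distance is at most a
multiple of the `L²(P)` distance of the variables (`tendsto_charFun_of_forall_approx`).

Centring at the sample mean changes the sample autocovariances by `O(1/n)` in `L¹(P)`, which does
not matter at the scale `n^{-1/2}`, and the quotient of two autocovariances is handled by
Slutsky's theorem and the Cramér–Wold device (`IsNoise.tendstoInDistribution_acorr`). Finally the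
constants are rewritten as integrals of the kernels of the innovations by Fubini's theorem.
-/

set_option linter.unusedSectionVars false

namespace WAR

/-! ### The distribution function of the mean density -/

lemma isProbabilityMeasure_densityMeasure {f : ℝ → ℝ} (hf : IsDensity f) :
    IsProbabilityMeasure (densityMeasure f) :=
  ⟨by rw [densityMeasure, withDensity_apply _ MeasurableSet.univ, setLIntegral_univ, hf.mass]⟩

lemma densityMeasure_absolutelyContinuous (f : ℝ → ℝ) : densityMeasure f ≪ volume :=
  withDensity_absolutelyContinuous _ _

lemma nullSingletonClass_densityMeasure (f : ℝ → ℝ) : NullSingletonClass (densityMeasure f) :=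
  ⟨fun x => densityMeasure_absolutelyContinuous f (by simp)⟩

lemma IsDensity.integrable {f : ℝ → ℝ} (hf : IsDensity f) : Integrable f := by
  refine ⟨hf.measurable.aestronglyMeasurable, ?_⟩
  rw [hasFiniteIntegral_iff_ofReal (ae_of_all _ hf.nonneg), hf.mass]
  exact ENNReal.one_lt_top

lemma integral_densityMeasure {f : ℝ → ℝ} (hf : IsDensity f) (g : ℝ → ℝ) :
    ∫ u, g u ∂densityMeasure f = ∫ u, f u * g u := by
  rw [densityMeasure, integral_withDensity_eq_integral_toReal_smul
    hf.measurable.ennreal_ofReal (by simp)]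
  simp [ENNReal.toReal_ofReal (hf.nonneg _)]

/-- Up to a null set, the support of an interval-supported density is open. -/
lemma ae_mem_interior_support {f : ℝ → ℝ} (hsupp : (densityMeasure f).support.OrdConnected) :
    ∀ᵐ u ∂densityMeasure f, u ∈ interior (densityMeasure f).support := by
  have h1 : ∀ᵐ u ∂densityMeasure f, u ∈ (densityMeasure f).support := Measure.support_mem_ae
  have h2 : ∀ᵐ u ∂densityMeasure f, u ∉ frontier (densityMeasure f).support :=
    densityMeasure_absolutelyContinuous f
      (by simpa [ae_iff, Set.compl_def] using Convex.addHaar_frontier volume hsupp.convex)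
  filter_upwards [h1, h2] with u h1 h2
  by_contra h
  exact h2 ⟨subset_closure h1, h⟩

lemma ordConnected_interior_support {f : ℝ → ℝ}
    (hsupp : (densityMeasure f).support.OrdConnected) :
    (interior (densityMeasure f).support).OrdConnected :=
  hsupp.interior

lemma cdfFun_eq_add_integral {f : ℝ → ℝ} (hf : IsDensity f) (x : ℝ) :
    cdfFun (densityMeasure f) x = cdfFun (densityMeasure f) 0 + ∫ u in (0 : ℝ)..x, f u := by
  have key : ∀ y, cdfFun (densityMeasure f) y = ∫ u in Set.Iic y, f u := by
    intro y
    rw [cdfFun, measureReal_def, densityMeasure, withDensity_apply _ measurableSet_Iic,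
      integral_eq_lintegral_of_nonneg_ae (ae_of_all _ hf.nonneg)
        hf.measurable.aestronglyMeasurable]
  rw [key, key, ← intervalIntegral.integral_Iic_sub_Iic hf.integrable.integrableOn
    hf.integrable.integrableOn]
  ring

lemma continuous_cdfFun {f : ℝ → ℝ} (hf : IsDensity f) :
    Continuous (cdfFun (densityMeasure f)) := by
  have : cdfFun (densityMeasure f) = fun x =>
      cdfFun (densityMeasure f) 0 + ∫ u in (0 : ℝ)..x, f u :=
    funext (cdfFun_eq_add_integral hf)
  rw [this]
  exact continuous_const.add (intervalIntegral.continuous_primitive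
    (fun a b => hf.integrable.intervalIntegrable) 0)

lemma ae_hasDerivAt_cdfFun {f : ℝ → ℝ} (hf : IsDensity f) :
    ∀ᵐ x, HasDerivAt (cdfFun (densityMeasure f)) (f x) x := by
  have : cdfFun (densityMeasure f) = fun x =>
      cdfFun (densityMeasure f) 0 + ∫ u in (0 : ℝ)..x, f u :=
    funext (cdfFun_eq_add_integral hf)
  rw [this]
  filter_upwards [LocallyIntegrable.ae_hasDerivAt_integral hf.integrable.locallyIntegrable]
    with x hx
  exact (hx 0).const_add _

lemma monotone_cdfFun {f : ℝ → ℝ} (hf : IsDensity f) : Monotone (cdfFun (densityMeasure f)) := by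
  have := isProbabilityMeasure_densityMeasure hf
  exact fun x y h => measureReal_mono (Set.Iic_subset_Iic.2 h)

lemma strictMonoOn_cdfFun {f : ℝ → ℝ} (hf : IsDensity f)
    (hsupp : (densityMeasure f).support.OrdConnected) :
    StrictMonoOn (cdfFun (densityMeasure f)) (interior (densityMeasure f).support) := by
  have := isProbabilityMeasure_densityMeasure hf
  intro u hu v hv huv
  have hm : (u + v) / 2 ∈ (densityMeasure f).support :=
    hsupp.out (interior_subset hu) (interior_subset hv) ⟨by linarith, by linarith⟩
  have hpos : 0 < densityMeasure f (Set.Ioo u v) :=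
    (Measure.mem_support_iff_forall _).1 hm _ (Ioo_mem_nhds (by linarith) (by linarith))
  have h1 : (densityMeasure f).real (Set.Iic u) + (densityMeasure f).real (Set.Ioo u v) ≤
      (densityMeasure f).real (Set.Iic v) := by
    rw [← measureReal_union _ measurableSet_Ioo]
    · exact measureReal_mono (by
        rintro x (hx | hx)
        · exact le_trans hx huv.le
        · exact hx.2.le)
    · exact Set.disjoint_left.2 fun x hx hx' => absurd hx'.1 (not_lt.2 hx)
  have h2 : 0 < (densityMeasure f).real (Set.Ioo u v) :=
    ENNReal.toReal_pos hpos.ne' (measure_ne_top _ _)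
  simp only [cdfFun]
  linarith

lemma cdfFun_mem_Ioo {f : ℝ → ℝ} (hf : IsDensity f)
    (hsupp : (densityMeasure f).support.OrdConnected) {u : ℝ}
    (hu : u ∈ interior (densityMeasure f).support) :
    cdfFun (densityMeasure f) u ∈ Set.Ioo (0 : ℝ) 1 := by
  have := isProbabilityMeasure_densityMeasure hf
  obtain ⟨a, b, ⟨hau, hub⟩, hab⟩ := (mem_nhds_iff_exists_Ioo_subset).1 (isOpen_interior.mem_nhds hu)
  have hmono := strictMonoOn_cdfFun hf hsupp
  have ha : (a + u) / 2 ∈ Set.Ioo a b := ⟨by linarith, by linarith⟩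
  have hb : (u + b) / 2 ∈ Set.Ioo a b := ⟨by linarith, by linarith⟩
  have h1 := hmono (hab ha) hu (by linarith)
  have h2 := hmono hu (hab hb) (by linarith)
  exact ⟨lt_of_le_of_lt measureReal_nonneg h1, lt_of_lt_of_le h2 measureReal_le_one⟩

lemma exists_cdfFun_eq {f : ℝ → ℝ} (hf : IsDensity f)
    (hsupp : (densityMeasure f).support.OrdConnected) {s : ℝ} (hs : s ∈ Set.Ioo (0 : ℝ) 1) :
    ∃ u ∈ interior (densityMeasure f).support, cdfFun (densityMeasure f) u = s := by
  have := isProbabilityMeasure_densityMeasure hf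
  have hcdf : (⇑(cdf (densityMeasure f)) : ℝ → ℝ) = cdfFun (densityMeasure f) :=
    funext fun x => cdf_eq_real _ x
  have hbot := tendsto_cdf_atBot (densityMeasure f)
  have htop := tendsto_cdf_atTop (densityMeasure f)
  rw [hcdf] at hbot htop
  obtain ⟨x, hx⟩ : ∃ x, cdfFun (densityMeasure f) x = s := by
    obtain ⟨a, ha⟩ := (hbot.eventually_lt_const hs.1).exists
    obtain ⟨b, hb⟩ := (htop.eventually_const_lt hs.2).exists
    exact mem_range_of_exists_le_of_exists_ge (continuous_cdfFun hf) ⟨a, ha.le⟩ ⟨b, hb.le⟩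
  refine ⟨x, ?_, hx⟩
  have hnull : densityMeasure f {u | u ∉ interior (densityMeasure f).support} = 0 :=
    ae_iff.1 (ae_mem_interior_support hsupp)
  by_contra hxD
  have hside : (∀ d ∈ interior (densityMeasure f).support, d ≤ x) ∨
      (∀ d ∈ interior (densityMeasure f).support, x ≤ d) := by
    by_contra! h
    obtain ⟨⟨d, hd, h1⟩, ⟨d', hd', h2⟩⟩ := h
    exact hxD ((ordConnected_interior_support hsupp).out hd' hd ⟨h2.le, h1.le⟩)
  rcases hside with h | h
  · have : (densityMeasure f).real (Set.Iic x) = 1 := by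
      rw [measureReal_def, (prob_compl_eq_zero_iff measurableSet_Iic).1, ENNReal.toReal_one]
      exact measure_mono_null (fun y hy hy' => hy (h y hy')) hnull
    rw [← hx] at hs
    exact absurd this hs.2.ne
  · have hIio : (densityMeasure f) (Set.Iio x) = 0 :=
      by
      refine measure_mono_null ?_ hnull
      exact fun y hy hy' => absurd (h y hy') (not_le.2 hy)
    have := nullSingletonClass_densityMeasure f
    have : (densityMeasure f).real (Set.Iic x) = 0 := by
      rw [measureReal_def, ← measure_congr Iio_ae_eq_Iic, hIio, ENNReal.toReal_zero]
    rw [← hx] at hs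
    exact absurd this hs.1.ne'

/-! ### Increasing transport maps -/

/-- If `T` is increasing and continuous on the interior of the support of `μ`, then `T` is the
quantile function of its push-forward composed with the distribution function of `μ`. -/
lemma quantile_map_cdfFun {f : ℝ → ℝ} (hf : IsDensity f)
    (hsupp : (densityMeasure f).support.OrdConnected) {T : ℝ → ℝ} (hT : Measurable T)
    (hmono : StrictMonoOn T (interior (densityMeasure f).support))
    (hcont : ContinuousOn T (interior (densityMeasure f).support)) {u : ℝ}
    (hu : u ∈ interior (densityMeasure f).support) :
    quantile ((densityMeasure f).map T) (cdfFun (densityMeasure f) u) = T u := by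
  have := isProbabilityMeasure_densityMeasure hf
  have hae := ae_mem_interior_support hsupp
  have hcdf : ∀ x, cdfFun ((densityMeasure f).map T) x = (densityMeasure f).real {v | T v ≤ x} := by
    intro x
    rw [cdfFun, map_measureReal_apply hT measurableSet_Iic]
    rfl
  refine IsLeast.csInf_eq ⟨?_, ?_⟩
  · rw [Set.mem_ofPred_eq, hcdf]
    refine le_of_eq (measureReal_congr (Filter.eventuallyEq_set.2 ?_))
    filter_upwards [hae] with v hv
    exact (hmono.le_iff_le hv hu).symm
  · intro x hx
    rw [Set.mem_ofPred_eq, hcdf] at hx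
    by_contra! hlt
    have hev : ∀ᶠ v in 𝓝[<] u, v ∈ interior (densityMeasure f).support ∧ x < T v ∧ v < u := by
      have h1 : ∀ᶠ v in 𝓝 u, v ∈ interior (densityMeasure f).support :=
        isOpen_interior.mem_nhds hu
      have h2 : ∀ᶠ v in 𝓝 u, x < T v :=
        (hcont.continuousAt (isOpen_interior.mem_nhds hu)).eventually (lt_mem_nhds hlt)
      filter_upwards [nhdsWithin_le_nhds h1, nhdsWithin_le_nhds h2, self_mem_nhdsWithin]
        with v h1 h2 h3 using ⟨h1, h2, h3⟩
    obtain ⟨v, hvD, hxv, hvu⟩ := hev.exists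
    have h1 : (densityMeasure f).real {v | T v ≤ x} ≤ cdfFun (densityMeasure f) v := by
      refine ENNReal.toReal_mono (measure_ne_top _ _) (measure_mono_ae ?_)
      filter_upwards [hae] with w hw (hwx : T w ≤ x)
      refine not_lt.1 fun hvw : v < w => ?_
      linarith [hmono hvD hw hvw]
    linarith [strictMonoOn_cdfFun hf hsupp hvD hu hvu]

lemma quantile_cdfFun {f : ℝ → ℝ} (hf : IsDensity f)
    (hsupp : (densityMeasure f).support.OrdConnected) {u : ℝ}
    (hu : u ∈ interior (densityMeasure f).support) :
    quantile (densityMeasure f) (cdfFun (densityMeasure f) u) = u := by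
  have := quantile_map_cdfFun hf hsupp measurable_id (strictMono_id.strictMonoOn _)
    continuousOn_id hu
  simpa using this

/-- The probability integral transform. -/
lemma map_cdfFun {f : ℝ → ℝ} (hf : IsDensity f)
    (hsupp : (densityMeasure f).support.OrdConnected) :
    (densityMeasure f).map (cdfFun (densityMeasure f)) =
      volume.restrict (Set.Ioc (0 : ℝ) 1) := by
  have := isProbabilityMeasure_densityMeasure hf
  have hm := (continuous_cdfFun hf).measurable
  have := Measure.isProbabilityMeasure_map (μ := densityMeasure f) hm.aemeasurable
  have hae := ae_mem_interior_support hsupp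
  have hnull : densityMeasure f {u | u ∉ interior (densityMeasure f).support} = 0 :=
    ae_iff.1 hae
  refine Measure.ext_of_Iic _ _ fun s => ?_
  rw [Measure.map_apply hm measurableSet_Iic, Measure.restrict_apply measurableSet_Iic]
  rcases le_or_gt s 0 with h0 | h0
  · rw [show Set.Iic s ∩ Set.Ioc (0 : ℝ) 1 = ∅ by ext x; simp only [Set.mem_inter_iff, Set.mem_Iic,
      Set.mem_Ioc, Set.mem_empty_iff_false, iff_false]; rintro ⟨h1, h2, h3⟩; linarith]
    rw [measure_empty]
    refine measure_mono_null ?_ hnull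
    intro y hy hy'
    have h1 := (cdfFun_mem_Ioo hf hsupp hy').1
    have h2 : cdfFun (densityMeasure f) y ≤ s := hy
    linarith
  · rcases lt_or_ge s 1 with h1 | h1
    · obtain ⟨u, hu, hus⟩ := exists_cdfFun_eq hf hsupp ⟨h0, h1⟩
      rw [show Set.Iic s ∩ Set.Ioc (0 : ℝ) 1 = Set.Ioc 0 s by
        ext x; simp only [Set.mem_inter_iff, Set.mem_Iic, Set.mem_Ioc]; constructor
        · rintro ⟨h2, h3, h4⟩; exact ⟨h3, h2⟩
        · rintro ⟨h2, h3⟩; exact ⟨h3, h2, by linarith⟩]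
      have h2 : ENNReal.ofReal s = densityMeasure f (Set.Iic u) := by
        rw [← hus, cdfFun, ofReal_measureReal]
      rw [Real.volume_Ioc, sub_zero, h2]
      refine measure_congr (Filter.eventuallyEq_set.2 ?_)
      filter_upwards [hae] with v hv
      rw [← hus]
      exact (strictMonoOn_cdfFun hf hsupp).le_iff_le hv hu
    · rw [show Set.Iic s ∩ Set.Ioc (0 : ℝ) 1 = Set.Ioc 0 1 by
        ext x; simp only [Set.mem_inter_iff, Set.mem_Iic, Set.mem_Ioc]; constructor
        · rintro ⟨h2, h3⟩; exact h3
        · rintro h3; exact ⟨by linarith [h3.2], h3⟩]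
      rw [Real.volume_Ioc, sub_zero, ENNReal.ofReal_one]
      refine prob_compl_eq_zero_iff (hm measurableSet_Iic) |>.1 ?_
      refine measure_mono_null (fun y hy (hy' : y ∈ interior _) => hy ?_) hnull
      exact le_trans (cdfFun_mem_Ioo hf hsupp hy').2.le h1

/-! ### Inverting a mean quantile function -/

section QuantileInverse

variable {f : ℝ → ℝ} (hf : IsDensity f) (hsupp : (densityMeasure f).support.OrdConnected)
  {T T' q : ℝ → ℝ}
  (hT : ∀ u ∈ interior (densityMeasure f).support, HasDerivAt T (T' u) u ∧ 0 < T' u)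
  (hq : ∀ u ∈ interior (densityMeasure f).support, q (cdfFun (densityMeasure f) u) = T u)

include hsupp hT in
lemma strictMonoOn_of_hasDerivAt_pos :
    StrictMonoOn T (interior (densityMeasure f).support) := by
  refine strictMonoOn_of_deriv_pos (ordConnected_interior_support hsupp).convex
    (fun u hu => (hT u hu).1.continuousAt.continuousWithinAt) fun u hu => ?_
  rw [interior_interior] at hu
  rw [(hT u hu).1.deriv]
  exact (hT u hu).2

include hf hsupp hT hq in
lemma quantileInv_apply {u : ℝ} (hu : u ∈ interior (densityMeasure f).support) :
    quantileInv q (T u) = cdfFun (densityMeasure f) u := by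
  have hF := strictMonoOn_cdfFun hf hsupp
  have hTm := strictMonoOn_of_hasDerivAt_pos hsupp hT
  have : {s : ℝ | s ∈ Set.Ioo (0 : ℝ) 1 ∧ q s ≤ T u} =
      Set.Ioc 0 (cdfFun (densityMeasure f) u) := by
    ext s
    constructor
    · rintro ⟨hs, hqs⟩
      obtain ⟨w, hw, rfl⟩ := exists_cdfFun_eq hf hsupp hs
      rw [hq w hw, hTm.le_iff_le hw hu] at hqs
      exact ⟨hs.1, monotone_cdfFun hf hqs⟩
    · rintro ⟨h0, h1⟩
      have hs : s ∈ Set.Ioo (0 : ℝ) 1 := ⟨h0, lt_of_le_of_lt h1 (cdfFun_mem_Ioo hf hsupp hu).2⟩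
      refine ⟨hs, ?_⟩
      obtain ⟨w, hw, rfl⟩ := exists_cdfFun_eq hf hsupp hs
      rw [hq w hw, hTm.le_iff_le hw hu]
      exact (hF.le_iff_le hw hu).1 h1
  rw [quantileInv, this]
  exact csSup_Ioc (cdfFun_mem_Ioo hf hsupp hu).1

include hf hsupp hT hq in
lemma hasDerivAt_quantileInv {u : ℝ} (hu : u ∈ interior (densityMeasure f).support)
    (hFu : HasDerivAt (cdfFun (densityMeasure f)) (f u) u) :
    HasDerivAt (quantileInv q) (f u * (T' u)⁻¹) (T u) := by
  set D := interior (densityMeasure f).support with hD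
  have hTm := strictMonoOn_of_hasDerivAt_pos hsupp hT
  have hJ : T '' D ∈ 𝓝 (T u) := by
    obtain ⟨a, b, ⟨hau, hub⟩, hab⟩ :=
      (mem_nhds_iff_exists_Ioo_subset).1 (isOpen_interior.mem_nhds hu)
    have ha : (a + u) / 2 ∈ D := hab ⟨by linarith, by linarith⟩
    have hb : (u + b) / 2 ∈ D := hab ⟨by linarith, by linarith⟩
    have hconn : (T '' D).OrdConnected :=
      ((ordConnected_interior_support hsupp).isPreconnected.image T
        (fun u hu => (hT u hu).1.continuousAt.continuousWithinAt)).ordConnected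
    exact mem_of_superset (Icc_mem_nhds (hTm ha hu (by linarith)) (hTm hu hb (by linarith)))
      (hconn.out ⟨_, ha, rfl⟩ ⟨_, hb, rfl⟩)
  have hinj := hTm.injOn
  set S := Function.invFunOn T D with hS
  have hST : ∀ w ∈ D, S (T w) = w := fun w hw => hinj.leftInvOn_invFunOn hw
  have hTS : ∀ x ∈ T '' D, T (S x) = x := fun x hx => Function.invFunOn_eq hx
  have hSD : ∀ x ∈ T '' D, S x ∈ D := fun x hx => Function.invFunOn_mem hx
  have hSm : StrictMonoOn S (T '' D) := by
    rintro _ ⟨v, hv, rfl⟩ _ ⟨w, hw, rfl⟩ h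
    rw [hST v hv, hST w hw]
    exact (hTm.lt_iff_lt hv hw).1 h
  have hScont : ContinuousAt S (T u) := by
    refine hSm.continuousAt_of_image_mem_nhds hJ ?_
    rw [hST u hu]
    refine mem_of_superset (isOpen_interior.mem_nhds hu) fun w hw => ?_
    exact ⟨T w, ⟨w, hw, rfl⟩, hST w hw⟩
  have hSd : HasDerivAt S (T' u)⁻¹ (T u) := by
    refine HasDerivAt.of_local_left_inverse hScont (f := T) ?_ (hT u hu).2.ne' ?_
    · rw [hST u hu]; exact (hT u hu).1
    · filter_upwards [hJ] with x hx using hTS x hx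
  have hcomp : HasDerivAt (cdfFun (densityMeasure f) ∘ S) (f u * (T' u)⁻¹) (T u) := by
    refine HasDerivAt.comp (T u) ?_ hSd
    rw [hST u hu]; exact hFu
  refine hcomp.congr_of_eventuallyEq ?_
  filter_upwards [hJ] with x hx
  obtain ⟨w, hw, rfl⟩ := hx
  rw [quantileInv_apply hf hsupp hT hq hw, Function.comp_apply, hST w hw]

include hf hsupp hT hq in
lemma ae_deriv_quantileInv_eq_zero :
    ∀ᵐ x, x ∉ T '' interior (densityMeasure f).support → deriv (quantileInv q) x = 0 := by
  have := isProbabilityMeasure_densityMeasure hf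
  set D := interior (densityMeasure f).support with hD
  have hconn : (T '' D).OrdConnected :=
    ((ordConnected_interior_support hsupp).isPreconnected.image T
      (fun u hu => (hT u hu).1.continuousAt.continuousWithinAt)).ordConnected
  obtain ⟨d, hd⟩ : D.Nonempty := (ae_mem_interior_support hsupp).exists
  have hfr : ∀ᵐ x, x ∉ frontier (T '' D) := by
    simpa [ae_iff] using Convex.addHaar_frontier volume hconn.convex
  have hlow : ∀ x, (∀ w ∈ D, x < T w) → quantileInv q x = 0 := by
    intro x hx
    have : {s : ℝ | s ∈ Set.Ioo (0 : ℝ) 1 ∧ q s ≤ x} = ∅ := by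
      ext s
      simp only [Set.mem_ofPred_eq, Set.mem_empty_iff_false, iff_false, not_and, not_le]
      intro hs
      obtain ⟨w, hw, rfl⟩ := exists_cdfFun_eq hf hsupp hs
      rw [hq w hw]
      exact hx w hw
    rw [quantileInv, this, Real.sSup_empty]
  have hhigh : ∀ x, (∀ w ∈ D, T w < x) → quantileInv q x = 1 := by
    intro x hx
    have : {s : ℝ | s ∈ Set.Ioo (0 : ℝ) 1 ∧ q s ≤ x} = Set.Ioo 0 1 := by
      ext s
      refine ⟨fun h => h.1, fun hs => ⟨hs, ?_⟩⟩
      obtain ⟨w, hw, rfl⟩ := exists_cdfFun_eq hf hsupp hs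
      rw [hq w hw]
      exact (hx w hw).le
    rw [quantileInv, this, csSup_Ioo one_pos]
  filter_upwards [hfr] with x hx hxJ
  have hxc : x ∈ (closure (T '' D))ᶜ := fun hc => by
    rw [closure_eq_self_union_frontier] at hc
    exact hc.elim hxJ hx
  have hnear : ∀ᶠ y in 𝓝 x, y ∈ (closure (T '' D))ᶜ := isClosed_closure.isOpen_compl.mem_nhds hxc
  have hside : ∀ y ∈ (closure (T '' D))ᶜ, (y < T d → ∀ w ∈ D, y < T w) ∧
      (T d < y → ∀ w ∈ D, T w < y) := by
    intro y hy
    have hyJ : y ∉ T '' D := fun h => hy (subset_closure h)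
    constructor
    · intro h w hw
      by_contra! hle
      exact hyJ (hconn.out ⟨w, hw, rfl⟩ ⟨d, hd, rfl⟩ ⟨hle, h.le⟩)
    · intro h w hw
      by_contra! hle
      exact hyJ (hconn.out ⟨d, hd, rfl⟩ ⟨w, hw, rfl⟩ ⟨h.le, hle⟩)
  rcases lt_trichotomy x (T d) with h | h | h
  · have : quantileInv q =ᶠ[𝓝 x] fun _ => 0 := by
      filter_upwards [hnear, gt_mem_nhds h] with y hy hyd using hlow y ((hside y hy).1 hyd)
    rw [this.deriv_eq, deriv_const]
  · exact absurd ⟨d, hd, h.symm⟩ hxJ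
  · have : quantileInv q =ᶠ[𝓝 x] fun _ => 1 := by
      filter_upwards [hnear, lt_mem_nhds h] with y hy hyd using hhigh y ((hside y hy).2 hyd)
    rw [this.deriv_eq, deriv_const]

include hf hsupp hT hq in
/-- Integration against the derivative of the inverse of the quantile function `q = T ∘ F⁻¹` is
integration along `T`. The inverse has no singular part although `T` need not be `C¹`: a function
that is differentiable everywhere maps null sets to null sets. -/
lemma integral_mul_deriv_quantileInv (g : ℝ → ℝ) :
    ∫ x, g x * deriv (quantileInv q) x = ∫ u, g (T u) ∂densityMeasure f := by
  set D := interior (densityMeasure f).support with hD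
  have hinj := (strictMonoOn_of_hasDerivAt_pos hsupp hT).injOn
  have hDm : MeasurableSet D := isOpen_interior.measurableSet
  have hJm : MeasurableSet (T '' D) :=
    (((ordConnected_interior_support hsupp).isPreconnected.image T
      (fun u hu => (hT u hu).1.continuousAt.continuousWithinAt)).ordConnected).measurableSet
  have h1 : ∫ x, g x * deriv (quantileInv q) x =
      ∫ x in T '' D, g x * deriv (quantileInv q) x := by
    rw [← integral_indicator hJm]
    refine integral_congr_ae ?_
    filter_upwards [ae_deriv_quantileInv_eq_zero hf hsupp hT hq] with x hx
    by_cases hxJ : x ∈ T '' D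
    · rw [Set.indicator_of_mem hxJ]
    · rw [Set.indicator_of_notMem hxJ, hx hxJ, mul_zero]
  rw [h1, integral_image_eq_integral_abs_deriv_smul hDm
    (fun u hu => (hT u hu).1.hasDerivWithinAt) hinj]
  have h2 : ∫ u, g (T u) ∂densityMeasure f = ∫ u in D, f u * g (T u) := by
    rw [← integral_indicator hDm, ← setIntegral_univ, ← setIntegral_univ (μ := volume)]
    have h3 : ∫ u in Set.univ, g (T u) ∂densityMeasure f =
        ∫ u, D.indicator (fun u => g (T u)) u ∂densityMeasure f := by
      rw [setIntegral_univ]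
      refine integral_congr_ae ?_
      filter_upwards [ae_mem_interior_support hsupp] with u hu
      rw [Set.indicator_of_mem hu]
    rw [h3, integral_densityMeasure hf, setIntegral_univ]
    refine integral_congr_ae (ae_of_all _ fun u => ?_)
    by_cases hu : u ∈ D <;> simp [hu]
  rw [h2]
  refine setIntegral_congr_ae hDm ?_
  filter_upwards [ae_hasDerivAt_cdfFun hf] with u hFu hu
  rw [(hasDerivAt_quantileInv hf hsupp hT hq hu hFu).deriv, abs_of_pos (hT u hu).2, smul_eq_mul]
  have := (hT u hu).2.ne'
  field_simp

end QuantileInverse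

/-! ### Sample paths: estimators as inner products -/

/-- The regularity that almost every path of the process `V_t` has: square integrable, and
`v + id` is differentiable with positive derivative inside the support of the mean density. -/
structure IsRegularPath (f : ℝ → ℝ) (v : ℝ → ℝ) : Prop where
  measurable : Measurable v
  memLp : MemLp v 2 (densityMeasure f)
  deriv : ∀ u ∈ interior (densityMeasure f).support, DifferentiableAt ℝ v u ∧ -1 < deriv v u

lemma toL2_of_memLp {μ : Measure ℝ} {g : ℝ → ℝ} (hg : MemLp g 2 μ) : toL2 μ g = hg.toLp g := by
  rw [toL2, dif_pos hg]

lemma coeFn_toL2 {μ : Measure ℝ} {g : ℝ → ℝ} (hg : MemLp g 2 μ) : toL2 μ g =ᵐ[μ] g := by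
  rw [toL2_of_memLp hg]; exact hg.coeFn_toLp

lemma inner_toL2 {μ : Measure ℝ} {g k : ℝ → ℝ} (hg : MemLp g 2 μ) (hk : MemLp k 2 μ) :
    inner ℝ (toL2 μ g) (toL2 μ k) = ∫ u, g u * k u ∂μ := by
  rw [L2.inner_def]
  refine integral_congr_ae ?_
  filter_upwards [coeFn_toL2 hg, coeFn_toL2 hk] with u h1 h2
  rw [h1, h2]
  simp [mul_comm]

lemma toL2_congr {μ : Measure ℝ} {g k : ℝ → ℝ} (h : g =ᵐ[μ] k) : toL2 μ g = toL2 μ k := by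
  by_cases hg : MemLp g 2 μ
  · have hk := hg.ae_eq h
    rw [toL2_of_memLp hg, toL2_of_memLp hk]
    exact (MemLp.toLp_eq_toLp_iff hg hk).2 h
  · have hk : ¬ MemLp k 2 μ := fun hk => hg (hk.ae_eq h.symm)
    rw [toL2, toL2, dif_neg hg, dif_neg hk]

lemma toL2_add {μ : Measure ℝ} {g k : ℝ → ℝ} (hg : MemLp g 2 μ) (hk : MemLp k 2 μ) :
    toL2 μ (fun u => g u + k u) = toL2 μ g + toL2 μ k := by
  rw [toL2_of_memLp hg, toL2_of_memLp hk, toL2_of_memLp (g := fun u => g u + k u) (hg.add hk)]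
  exact MemLp.toLp_add hg hk

lemma toL2_sub {μ : Measure ℝ} {g k : ℝ → ℝ} (hg : MemLp g 2 μ) (hk : MemLp k 2 μ) :
    toL2 μ (fun u => g u - k u) = toL2 μ g - toL2 μ k := by
  rw [toL2_of_memLp hg, toL2_of_memLp hk, toL2_of_memLp (g := fun u => g u - k u) (hg.sub hk)]
  exact MemLp.toLp_sub hg hk

lemma toL2_const_mul {μ : Measure ℝ} {g : ℝ → ℝ} (c : ℝ) (hg : MemLp g 2 μ) :
    toL2 μ (fun u => c * g u) = c • toL2 μ g := by
  rw [toL2_of_memLp hg, toL2_of_memLp (g := fun u => c * g u) (hg.const_mul c)]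
  exact MemLp.toLp_const_smul c hg

lemma toL2_sum {μ : Measure ℝ} {ι : Type*} (s : Finset ι) {g : ι → ℝ → ℝ}
    (hg : ∀ i ∈ s, MemLp (g i) 2 μ) :
    toL2 μ (fun u => ∑ i ∈ s, g i u) = ∑ i ∈ s, toL2 μ (g i) := by
  classical
  induction s using Finset.induction_on with
  | empty =>
    simp only [Finset.sum_empty]
    rw [toL2_of_memLp MemLp.zero']
    exact MemLp.toLp_zero _
  | insert a s ha ih =>
    have hs : ∀ i ∈ s, MemLp (g i) 2 μ := fun i hi => hg i (Finset.mem_insert_of_mem hi)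
    simp only [Finset.sum_insert ha]
    rw [toL2_add (hg a (Finset.mem_insert_self a s)) (memLp_finsetSum s hs), ih hs]

lemma quantile_expMap {f : ℝ → ℝ} (hf : IsDensity f)
    (hsupp : (densityMeasure f).support.OrdConnected) {v : ℝ → ℝ} (hv : IsRegularPath f v) {u : ℝ}
    (hu : u ∈ interior (densityMeasure f).support) :
    quantile (expMap f v) (cdfFun (densityMeasure f) u) = v u + u := by
  refine quantile_map_cdfFun hf hsupp (hv.measurable.add measurable_id) ?_ ?_ hu
  · refine strictMonoOn_of_hasDerivAt_pos (T' := fun u => deriv v u + 1) hsupp fun w hw => ?_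
    exact ⟨(hv.deriv w hw).1.hasDerivAt.add (hasDerivAt_id w), by linarith [(hv.deriv w hw).2]⟩
  · exact fun w hw => ((hv.deriv w hw).1.continuousAt.add continuousAt_id).continuousWithinAt

lemma logMap_expMap {f : ℝ → ℝ} (hf : IsDensity f)
    (hsupp : (densityMeasure f).support.OrdConnected) {v : ℝ → ℝ} (hv : IsRegularPath f v) {u : ℝ}
    (hu : u ∈ interior (densityMeasure f).support) :
    logMap f (expMap f v) u = v u := by
  rw [logMap, quantile_expMap hf hsupp hv hu, add_sub_cancel_right]

lemma intSampleAcov_eq {f : ℝ → ℝ} (hf : IsDensity f)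
    (hsupp : (densityMeasure f).support.OrdConnected) {w : ℤ → ℝ → ℝ}
    (hw : ∀ t, IsRegularPath f (w t)) (n k : ℕ) :
    intSampleAcov (fun t => quantile (expMap f (w t))) (quantile (densityMeasure f)) n k =
      (∑ t ∈ Finset.Icc 1 n, inner ℝ (toL2 (densityMeasure f) (w (t : ℕ)))
        (toL2 (densityMeasure f) (w ((t : ℕ) + k)))) / n := by
  have hF := (continuous_cdfFun hf).measurable
  set q : ℝ → ℝ := fun s => (∑ t ∈ Finset.Icc 1 n,
    w (t : ℕ) (quantile (densityMeasure f) s) * w ((t : ℕ) + k) (quantile (densityMeasure f) s)) / n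
    with hq
  -- on `(0, 1)` the integrand is a function of the quantile `Q_⊕(s)`
  have hcongr : ∀ s ∈ Set.Ioo (0 : ℝ) 1,
      (∑ t ∈ Finset.Icc 1 n, (quantile (expMap f (w (t : ℕ))) s - quantile (densityMeasure f) s) *
        (quantile (expMap f (w ((t : ℕ) + k))) s - quantile (densityMeasure f) s)) / n = q s := by
    intro s hs
    obtain ⟨u, hu, rfl⟩ := exists_cdfFun_eq hf hsupp hs
    simp only [hq]
    congr 1
    refine Finset.sum_congr rfl fun t _ => ?_
    rw [quantile_expMap hf hsupp (hw _) hu, quantile_expMap hf hsupp (hw _) hu,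
      quantile_cdfFun hf hsupp hu]
    ring
  have hFq : ∀ᵐ u ∂densityMeasure f, (∑ t ∈ Finset.Icc 1 n, w (t : ℕ) u * w ((t : ℕ) + k) u) / n =
      q (cdfFun (densityMeasure f) u) := by
    filter_upwards [ae_mem_interior_support hsupp] with u hu
    simp only [hq, quantile_cdfFun hf hsupp hu]
  have hqm : AEStronglyMeasurable q (volume.restrict (Set.Ioc (0 : ℝ) 1)) := by
    -- the quantile function of the mean measure is increasing on `(0, 1)`
    have hmono : MonotoneOn (quantile (densityMeasure f)) (Set.Ioo (0 : ℝ) 1) := by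
      intro s hs s' hs' hss
      obtain ⟨u, hu, rfl⟩ := exists_cdfFun_eq hf hsupp hs
      obtain ⟨u', hu', rfl⟩ := exists_cdfFun_eq hf hsupp hs'
      rw [quantile_cdfFun hf hsupp hu, quantile_cdfFun hf hsupp hu']
      exact ((strictMonoOn_cdfFun hf hsupp).le_iff_le hu hu').1 hss
    have hqm' : AEMeasurable (quantile (densityMeasure f))
        (volume.restrict (Set.Ioc (0 : ℝ) 1)) := by
      rw [← restrict_Ioo_eq_restrict_Ioc]
      exact aemeasurable_restrict_of_monotoneOn measurableSet_Ioo hmono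
    refine AEMeasurable.aestronglyMeasurable ?_
    refine AEMeasurable.div_const (Finset.aemeasurable_fun_sum _ fun t _ => ?_) _
    exact ((hw _).measurable.comp_aemeasurable hqm').mul
      ((hw _).measurable.comp_aemeasurable hqm')
  calc
    _ = ∫ s in Set.Ioc (0 : ℝ) 1, q s := by
      rw [intSampleAcov, intervalIntegral.integral_of_le zero_le_one, integral_Ioc_eq_integral_Ioo,
        integral_Ioc_eq_integral_Ioo]
      exact setIntegral_congr_fun measurableSet_Ioo hcongr
    _ = ∫ u, (∑ t ∈ Finset.Icc 1 n, w (t : ℕ) u * w ((t : ℕ) + k) u) / n ∂densityMeasure f := by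
      rw [← map_cdfFun hf hsupp, integral_map hF.aemeasurable (by rwa [map_cdfFun hf hsupp])]
      exact (integral_congr_ae hFq).symm
    _ = _ := by
      have hint : ∀ t ∈ Finset.Icc 1 n, Integrable
          (fun u => w (t : ℕ) u * w ((t : ℕ) + k) u) (densityMeasure f) :=
        fun t _ => MemLp.integrable_mul (hw _).memLp (hw _).memLp
      rw [integral_div, integral_finsetSum _ hint]
      simp_rw [inner_toL2 (hw _).memLp (hw _).memLp]

/-- With `x_t` the class of the path at time `t` in the tangent space, the numerators and the
denominators of the sample autocorrelations are the usual sample autocovariances of `x_t`. -/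
lemma integral_etaHat_mul_densityHat {f : ℝ → ℝ} (hf : IsDensity f)
    (hsupp : (densityMeasure f).support.OrdConnected) {w : ℤ → ℝ → ℝ}
    (hw : ∀ t, IsRegularPath f (w t)) {n : ℕ} (hn : 0 < n) (k : ℕ) :
    ∫ u, etaHat (fun t => quantile (expMap f (w t))) n k u *
        densityHat (fun t => quantile (expMap f (w t))) n u =
      (∑ t ∈ Finset.Icc 1 (n - k), inner ℝ
        (toL2 (densityMeasure f) (w (t : ℕ)) - (n : ℝ)⁻¹ • ∑ s ∈ Finset.Icc 1 n,
          toL2 (densityMeasure f) (w (s : ℕ)))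
        (toL2 (densityMeasure f) (w ((t : ℕ) + k)) - (n : ℝ)⁻¹ • ∑ s ∈ Finset.Icc 1 n,
          toL2 (densityMeasure f) (w (s : ℕ)))) / n := by
  have hn' : (n : ℝ) ≠ 0 := by positivity
  set m : ℝ → ℝ := fun u => (n : ℝ)⁻¹ * ∑ s ∈ Finset.Icc 1 n, w (s : ℕ) u with hm
  have hsumLp : MemLp (fun u => ∑ s ∈ Finset.Icc 1 n, w (s : ℕ) u) 2 (densityMeasure f) :=
    memLp_finsetSum _ fun s _ => (hw _).memLp
  have hmLp : MemLp m 2 (densityMeasure f) := hsumLp.const_mul _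
  have hmL2 : toL2 (densityMeasure f) m = (n : ℝ)⁻¹ • ∑ s ∈ Finset.Icc 1 n,
      toL2 (densityMeasure f) (w (s : ℕ)) := by
    rw [hm, toL2_const_mul _ hsumLp, toL2_sum _ fun s _ => (hw _).memLp]
  have hcard : ∑ _s ∈ Finset.Icc 1 n, (1 : ℝ) = n := by simp
  set T : ℝ → ℝ := fun u => m u + u with hTdef
  set T' : ℝ → ℝ := fun u => (n : ℝ)⁻¹ * ∑ s ∈ Finset.Icc 1 n, deriv (w (s : ℕ)) u + 1 with hT'def
  have hT : ∀ u ∈ interior (densityMeasure f).support, HasDerivAt T (T' u) u ∧ 0 < T' u := by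
    intro u hu
    constructor
    · refine HasDerivAt.add (HasDerivAt.const_mul _ ?_) (hasDerivAt_id u)
      exact HasDerivAt.fun_sum fun s _ => ((hw _).deriv u hu).1.hasDerivAt
    · have h1 : ∑ s ∈ Finset.Icc 1 n, (-1 : ℝ) < ∑ s ∈ Finset.Icc 1 n, deriv (w (s : ℕ)) u :=
        Finset.sum_lt_sum_of_nonempty ⟨1, by simp; omega⟩ fun s _ => ((hw _).deriv u hu).2
      rw [Finset.sum_neg_distrib, hcard] at h1
      have h2 : (n : ℝ)⁻¹ * (-n) < (n : ℝ)⁻¹ * ∑ s ∈ Finset.Icc 1 n, deriv (w (s : ℕ)) u :=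
        mul_lt_mul_of_pos_left h1 (by positivity)
      rw [mul_neg, inv_mul_cancel₀ hn'] at h2
      simp only [hT'def]
      linarith
  have hq : ∀ u ∈ interior (densityMeasure f).support,
      meanQuantile (fun t => quantile (expMap f (w t))) n (cdfFun (densityMeasure f) u) = T u := by
    intro u hu
    simp only [meanQuantile, quantile_expMap hf hsupp (hw _) hu, Finset.sum_add_distrib, hTdef, hm]
    rw [Finset.sum_const, Nat.card_Icc, nsmul_eq_mul]
    simp only [Nat.add_sub_cancel]
    field_simp
  rw [densityHat, cdfHat, integral_mul_deriv_quantileInv hf hsupp hT hq]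
  have hae : ∀ᵐ u ∂densityMeasure f,
      etaHat (fun t => quantile (expMap f (w t))) n k (T u) =
        (∑ t ∈ Finset.Icc 1 (n - k), (w (t : ℕ) u - m u) * (w ((t : ℕ) + k) u - m u)) / n := by
    filter_upwards [ae_mem_interior_support hsupp] with u hu
    rw [etaHat, cdfHat, quantileInv_apply hf hsupp hT hq hu]
    simp only [quantile_expMap hf hsupp (hw _) hu, hTdef]
    congr 1
    exact Finset.sum_congr rfl fun t _ => by ring
  have hint : ∀ t ∈ Finset.Icc 1 (n - k), Integrable
      (fun u => (w (t : ℕ) u - m u) * (w ((t : ℕ) + k) u - m u)) (densityMeasure f) :=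
    fun t _ => MemLp.integrable_mul ((hw _).memLp.sub hmLp) ((hw _).memLp.sub hmLp)
  rw [integral_congr_ae hae, integral_div, integral_finsetSum _ hint, ← hmL2]
  congr 1
  refine Finset.sum_congr rfl fun t _ => ?_
  rw [← toL2_sub (hw _).memLp hmLp, ← toL2_sub (hw _).memLp hmLp]
  exact (inner_toL2 ((hw _).memLp.sub hmLp) ((hw _).memLp.sub hmLp)).symm

/-! ### The coefficients of the causal expansion -/

lemma summable_norm_coeff_mul {g h : PowerSeries ℂ}
    (hg : Summable fun n => ‖PowerSeries.coeff n g‖)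
    (hh : Summable fun n => ‖PowerSeries.coeff n h‖) :
    Summable fun n => ‖PowerSeries.coeff n (g * h)‖ := by
  have := summable_norm_sum_mul_antidiagonal_of_summable_norm
    (f := fun n => PowerSeries.coeff n g) (g := fun n => PowerSeries.coeff n h) hg hh
  refine this.congr fun n => ?_
  rw [PowerSeries.coeff_mul]

/-- A product of linear factors whose roots lie outside the closed unit disk has an inverse power
series with absolutely summable coefficients: a Cauchy product of geometric series. -/
lemma exists_summable_inverse_prod (s : Multiset ℂ) (hs : ∀ r ∈ s, 1 < ‖r‖) :
    ∃ g : PowerSeries ℂ, (Summable fun n => ‖PowerSeries.coeff n g‖) ∧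
      (s.map fun r => (PowerSeries.X - PowerSeries.C r : PowerSeries ℂ)).prod * g = 1 := by
  induction s using Multiset.induction_on with
  | empty =>
    refine ⟨1, summable_of_hasFiniteSupport ((Set.finite_singleton 0).subset fun n hn => ?_), by simp⟩
    by_contra h
    simp only [Set.mem_singleton_iff] at h
    simp [PowerSeries.coeff_one, h] at hn
  | cons r s ih =>
    obtain ⟨g, hg, hgs⟩ := ih fun r hr => hs r (Multiset.mem_cons_of_mem hr)
    have hr := hs r (Multiset.mem_cons_self r s)
    have hr0 : r ≠ 0 := by rintro rfl; simp at hr; linarith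
    set k : PowerSeries ℂ := PowerSeries.mk fun n => -(r⁻¹) ^ (n + 1) with hk
    have hks : Summable fun n => ‖PowerSeries.coeff n k‖ := by
      simp only [hk, PowerSeries.coeff_mk, norm_neg, norm_pow]
      refine (summable_nat_add_iff 1).2 (summable_geometric_of_lt_one (norm_nonneg _) ?_)
      rw [norm_inv]
      exact inv_lt_one_of_one_lt₀ hr
    have hkr : (PowerSeries.X - PowerSeries.C r) * k = 1 := by
      ext n
      rw [sub_mul, map_sub, PowerSeries.coeff_C_mul]
      cases n with
      | zero => simp [hk, hr0]
      | succ n =>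
        rw [PowerSeries.coeff_succ_X_mul]
        simp only [hk, PowerSeries.coeff_mk, PowerSeries.coeff_one]
        rw [pow_succ _ (n + 1)]
        field_simp
        simp
    refine ⟨k * g, summable_norm_coeff_mul hks hg, ?_⟩
    rw [Multiset.map_cons, Multiset.prod_cons]
    calc _ = ((PowerSeries.X - PowerSeries.C r) * k) *
          ((s.map fun r => (PowerSeries.X - PowerSeries.C r : PowerSeries ℂ)).prod * g) := by ring
      _ = 1 := by rw [hkr, hgs, one_mul]

lemma constantCoeff_autoregressive {p : ℕ} (β : Fin p → ℝ) :
    PowerSeries.constantCoeff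
      (1 - ∑ j : Fin p, PowerSeries.C (β j) * PowerSeries.X ^ ((j : ℕ) + 1) : PowerSeries ℝ) = 1 := by
  simp

lemma summable_coeff_inv {p : ℕ} {β : Fin p → ℝ} (h : AutoregressiveCondition β) :
    Summable fun n : ℕ => |PowerSeries.coeff n
      (1 - ∑ j : Fin p, PowerSeries.C (β j) * PowerSeries.X ^ ((j : ℕ) + 1) : PowerSeries ℝ)⁻¹| := by
  set φ : PowerSeries ℝ := 1 - ∑ j : Fin p, PowerSeries.C (β j) * PowerSeries.X ^ ((j : ℕ) + 1)
    with hφ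
  set P : Polynomial ℂ := 1 - ∑ j : Fin p, Polynomial.C (β j : ℂ) * Polynomial.X ^ ((j : ℕ) + 1)
    with hP
  have hPφ : (P : PowerSeries ℂ) = PowerSeries.map Complex.ofRealHom φ := by
    simp only [hP, hφ, map_sub, map_sum, map_mul, map_pow, PowerSeries.map_C, PowerSeries.map_X,
      map_one, Polynomial.coe_sub, Polynomial.coe_one]
    congr 1
    rw [← Polynomial.coeToPowerSeries.ringHom_apply, map_sum]
    simp
  have heval : ∀ z, P.eval z = 1 - ∑ j : Fin p, (β j : ℂ) * z ^ ((j : ℕ) + 1) := by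
    intro z
    simp [hP, Polynomial.eval_finsetSum]
  have hP0 : P ≠ 0 := by
    intro h0
    have := heval 0
    rw [h0] at this
    simp at this
  have hroots : ∀ r ∈ P.roots, 1 < ‖r‖ := by
    intro r hr
    by_contra! hle
    have h1 := (Polynomial.mem_roots hP0).1 hr
    rw [Polynomial.IsRoot, heval] at h1
    exact h r hle h1
  obtain ⟨g, hg, hgP⟩ := exists_summable_inverse_prod P.roots hroots
  have hfac : (P : PowerSeries ℂ) = PowerSeries.C P.leadingCoeff *
      (P.roots.map fun r => (PowerSeries.X - PowerSeries.C r : PowerSeries ℂ)).prod := by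
    conv_lhs => rw [(IsAlgClosed.splits P).eq_prod_roots]
    rw [Polynomial.coe_mul, Polynomial.coe_C, ← Polynomial.coeToPowerSeries.ringHom_apply,
      map_multiset_prod, Multiset.map_map]
    congr 2
    refine Multiset.map_congr rfl fun r _ => ?_
    simp
  have hl : P.leadingCoeff ≠ 0 := Polynomial.leadingCoeff_ne_zero.2 hP0
  have hinv : PowerSeries.map Complex.ofRealHom φ⁻¹ = PowerSeries.C P.leadingCoeff⁻¹ * g := by
    have h1 : PowerSeries.map Complex.ofRealHom φ⁻¹ * (P : PowerSeries ℂ) = 1 := by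
      rw [hPφ, ← map_mul, PowerSeries.inv_mul_cancel _ (by
        rw [hφ, constantCoeff_autoregressive]; exact one_ne_zero), map_one]
    have h2 : (P : PowerSeries ℂ) * (PowerSeries.C P.leadingCoeff⁻¹ * g) = 1 := by
      calc _ = (PowerSeries.C P.leadingCoeff * PowerSeries.C P.leadingCoeff⁻¹) *
            ((P.roots.map fun r => (PowerSeries.X - PowerSeries.C r : PowerSeries ℂ)).prod * g) := by
              rw [hfac]; ring
        _ = 1 := by rw [hgP, ← map_mul, mul_inv_cancel₀ hl, map_one, one_mul]
    exact left_inv_eq_right_inv h1 h2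
  have : ∀ n, |PowerSeries.coeff n φ⁻¹| = ‖P.leadingCoeff⁻¹‖ * ‖PowerSeries.coeff n g‖ := by
    intro n
    have h1 := congrArg (PowerSeries.coeff n) hinv
    rw [PowerSeries.coeff_map, PowerSeries.coeff_C_mul] at h1
    rw [← norm_mul, ← h1]
    simp
  simp_rw [this]
  exact hg.mul_left _

lemma psi_natCast {p : ℕ} (β : Fin p → ℝ) (n : ℕ) : psi β n = PowerSeries.coeff n
    (1 - ∑ j : Fin p, PowerSeries.C (β j) * PowerSeries.X ^ ((j : ℕ) + 1) : PowerSeries ℝ)⁻¹ := by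
  simp [psi]

lemma psi_of_neg {p : ℕ} (β : Fin p → ℝ) {i : ℤ} (hi : i < 0) : psi β i = 0 := by
  simp [psi, not_le.2 hi]

lemma summable_abs_psi {p : ℕ} {β : Fin p → ℝ} (h : AutoregressiveCondition β) :
    Summable fun i : ℤ => |psi β i| := by
  rw [← Nat.cast_injective (R := ℤ) |>.summable_iff]
  · simpa only [Function.comp_def, psi_natCast] using summable_coeff_inv h
  · intro i hi
    rw [psi_of_neg, abs_zero]
    by_contra! h
    exact hi ⟨i.toNat, Int.toNat_of_nonneg h⟩

/-- The coefficients solve the autoregressive recursion, started by a unit impulse. -/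
lemma psi_eq_sum {p : ℕ} (β : Fin p → ℝ) (k : ℤ) :
    psi β k = ∑ j : Fin p, β j * psi β (k - ((j : ℕ) + 1)) + if k = 0 then 1 else 0 := by
  rcases lt_or_ge k 0 with hk | hk
  · rw [psi_of_neg β hk, if_neg hk.ne, Finset.sum_eq_zero, add_zero]
    intro j _
    rw [psi_of_neg β (by omega), mul_zero]
  · obtain ⟨n, rfl⟩ := Int.eq_ofNat_of_zero_le hk
    set φ : PowerSeries ℝ := 1 - ∑ j : Fin p, PowerSeries.C (β j) * PowerSeries.X ^ ((j : ℕ) + 1)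
      with hφ
    have h1 : φ * φ⁻¹ = 1 := PowerSeries.mul_inv_cancel _ (by
      rw [hφ, constantCoeff_autoregressive]; exact one_ne_zero)
    have h2 : φ⁻¹ = ∑ j : Fin p, PowerSeries.C (β j) * (PowerSeries.X ^ ((j : ℕ) + 1) * φ⁻¹) + 1 := by
      have h3 : φ * φ⁻¹ = φ⁻¹ - ∑ j : Fin p,
          PowerSeries.C (β j) * (PowerSeries.X ^ ((j : ℕ) + 1) * φ⁻¹) := by
        conv_lhs => rw [hφ, ← hφ]
        rw [hφ, sub_mul, one_mul, Finset.sum_mul]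
        simp_rw [mul_assoc]
      rw [← h1, h3]
      ring
    rw [psi_natCast, ← hφ]
    conv_lhs => rw [h2]
    rw [map_add, map_sum, PowerSeries.coeff_one]
    congr 1
    · refine Finset.sum_congr rfl fun j _ => ?_
      rw [PowerSeries.coeff_C_mul, PowerSeries.coeff_X_pow_mul']
      congr 1
      split_ifs with hj
      · rw [show (n : ℤ) - ((j : ℕ) + 1) = ((n - ((j : ℕ) + 1) : ℕ) : ℤ) by omega, psi_natCast]
      · rw [psi_of_neg β (by omega)]
    · simp

/-- A bounded solution of the autoregressive equation in a Banach space is the causal moving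
average of the right-hand side. -/
lemma hasSum_psi_smul {E : Type*} [NormedAddCommGroup E] [NormedSpace ℝ E] [CompleteSpace E]
    {p : ℕ} {β : Fin p → ℝ} (h : AutoregressiveCondition β) {x y : ℤ → E} {C : ℝ}
    (hx : ∀ t, ‖x t‖ ≤ C) (hxy : ∀ t, x t = ∑ j : Fin p, β j • x (t - ((j : ℕ) + 1)) + y t) (t : ℤ) :
    HasSum (fun i : ℤ => psi β i • y (t - i)) (x t) := by
  have hs : ∀ s : ℤ, Summable fun i : ℤ => psi β i • x (s - i) := fun s =>
    Summable.of_norm_bounded ((summable_abs_psi h).mul_right C) fun i => by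
      rw [norm_smul, Real.norm_eq_abs]
      exact mul_le_mul_of_nonneg_left (hx _) (abs_nonneg _)
  have hshift : ∀ j : Fin p, HasSum (fun i : ℤ => psi β (i - ((j : ℕ) + 1)) • x (t - i))
      (∑' i : ℤ, psi β i • x (t - ((j : ℕ) + 1) - i)) := by
    intro j
    rw [← (Equiv.addRight (((j : ℕ) + 1 : ℤ))).hasSum_iff]
    convert (hs (t - ((j : ℕ) + 1))).hasSum using 2 with i
    simp only [Function.comp_apply, Equiv.coe_addRight]
    congr 2 <;> ring
  have h1 : HasSum (fun i : ℤ => psi β i • y (t - i))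
      (∑' i : ℤ, psi β i • x (t - i) -
        ∑ j : Fin p, β j • ∑' i : ℤ, psi β i • x (t - ((j : ℕ) + 1) - i)) := by
    have h2 := (hs t).hasSum.sub (hasSum_sum fun (j : Fin p) (_ : j ∈ Finset.univ) =>
      (hs (t - ((j : ℕ) + 1))).hasSum.const_smul (β j))
    refine h2.congr_fun fun i => ?_
    have h3 : y (t - i) = x (t - i) - ∑ j : Fin p, β j • x (t - i - ((j : ℕ) + 1)) := by
      rw [hxy (t - i)]; abel
    rw [h3, smul_sub, Finset.smul_sum]
    congr 1
    refine Finset.sum_congr rfl fun j _ => ?_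
    rw [smul_comm, show t - i - ((j : ℕ) + 1 : ℤ) = t - ((j : ℕ) + 1) - i by ring]
  have h4 : HasSum (fun i : ℤ => (if i = 0 then (1 : ℝ) else 0) • x (t - i))
      (∑' i : ℤ, psi β i • x (t - i) -
        ∑ j : Fin p, β j • ∑' i : ℤ, psi β i • x (t - ((j : ℕ) + 1) - i)) := by
    have h2 := (hs t).hasSum.sub (hasSum_sum fun (j : Fin p) (_ : j ∈ Finset.univ) =>
      (hshift j).const_smul (β j))
    refine h2.congr_fun fun i => ?_
    have h3 := psi_eq_sum β i
    have h5 : (if i = 0 then (1 : ℝ) else 0) =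
        psi β i - ∑ j : Fin p, β j * psi β (i - ((j : ℕ) + 1)) := by rw [h3]; ring
    rw [h5, sub_smul, Finset.sum_smul]
    simp_rw [mul_smul]
  have h6 : HasSum (fun i : ℤ => (if i = 0 then (1 : ℝ) else 0) • x (t - i)) (x t) := by
    convert hasSum_ite_eq (0 : ℤ) (x t) using 2 with i
    split_ifs with hi <;> simp [hi]
  rwa [h4.unique h6] at h1

/-! ### Absolutely summable sequences -/

lemma Summable.mul_mul_int {a b : ℤ → ℝ} (ha : Summable fun i => |a i|)
    (hb : Summable fun i => |b i|) : Summable fun q : ℤ × ℤ => |a q.1| * |b q.2| :=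
  ha.mul_of_nonneg hb (fun _ => abs_nonneg _) fun _ => abs_nonneg _

lemma exists_bound_of_summable_abs {a : ℤ → ℝ} (ha : Summable fun i => |a i|) :
    ∃ C, 0 ≤ C ∧ ∀ i, |a i| ≤ C :=
  ⟨∑' i, |a i|, tsum_nonneg fun _ => abs_nonneg _, fun i =>
    ha.le_tsum i fun _ _ => abs_nonneg _⟩

lemma summable_abs_mul_shift {a b : ℤ → ℝ} (ha : Summable fun i => |a i|)
    (hb : Summable fun i => |b i|) (r : ℤ) : Summable fun k => |a k * b (k + r)| := by
  obtain ⟨C, hC, hbC⟩ := exists_bound_of_summable_abs hb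
  refine Summable.of_nonneg_of_le (fun _ => abs_nonneg _) (fun k => ?_) (ha.mul_right C)
  rw [abs_mul]
  exact mul_le_mul_of_nonneg_left (hbC _) (abs_nonneg _)

lemma summable_abs_mul {a b : ℤ → ℝ} (ha : Summable fun i => |a i|)
    (hb : Summable fun i => |b i|) : Summable fun k => |a k * b k| := by
  simpa using summable_abs_mul_shift ha hb 0

lemma summable_abs_shift {a : ℤ → ℝ} (ha : Summable fun i => |a i|) (r : ℤ) :
    Summable fun i => |a (i + r)| :=
  ((Equiv.addRight r).summable_iff (f := fun i => |a i|)).2 ha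

lemma summable_abs_reflect {a : ℤ → ℝ} (ha : Summable fun i => |a i|) (r : ℤ) :
    Summable fun i => |a (r - i)| :=
  ((Equiv.subLeft r).summable_iff (f := fun i => |a i|)).2 ha

/-- The cross-correlation of two absolutely summable sequences is absolutely summable. -/
lemma summable_abs_tsum_mul_shift {a b : ℤ → ℝ} (ha : Summable fun i => |a i|)
    (hb : Summable fun i => |b i|) : Summable fun r : ℤ => |∑' k, a k * b (k + r)| := by
  let e : ℤ × ℤ ≃ ℤ × ℤ :=
    { toFun := fun q => (q.2, q.2 + q.1)
      invFun := fun q => (q.2 - q.1, q.1)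
      left_inv := fun q => by simp
      right_inv := fun q => by simp }
  have h1 : Summable fun q : ℤ × ℤ => |a q.2| * |b (q.2 + q.1)| :=
    (e.summable_iff (f := fun q : ℤ × ℤ => |a q.1| * |b q.2|)).2 (Summable.mul_mul_int ha hb)
  have h2 : Summable fun r : ℤ => ∑' k : ℤ, |a k| * |b (k + r)| := h1.prod
  refine Summable.of_nonneg_of_le (fun _ => abs_nonneg _) (fun r => ?_) h2
  have h3 := summable_abs_mul_shift ha hb r
  have h4 := norm_tsum_le_tsum_norm (f := fun k => a k * b (k + r)) h3
  simpa [Real.norm_eq_abs, abs_mul] using h4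

/-- The number of pairs of lag `r` in `{1, …, n}` is `n - |r|`; divided by `n` it tends to one. -/
lemma tendsto_sum_sum_sub_div {c : ℤ → ℝ} (hc : Summable fun r => |c r|) :
    Tendsto (fun n : ℕ => (∑ s ∈ Finset.Icc 1 n, ∑ t ∈ Finset.Icc 1 n,
      c ((t : ℤ) - (s : ℤ))) / n) atTop (𝓝 (∑' r, c r)) := by
  set N : ℕ → ℤ → ℕ := fun n r =>
    ((Finset.Icc 1 n).filter fun s : ℕ => 1 ≤ (s : ℤ) + r ∧ (s : ℤ) + r ≤ n).card with hN
  have hNle : ∀ n r, (N n r : ℝ) ≤ n := fun n r => by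
    have : N n r ≤ (Finset.Icc 1 n).card := Finset.card_filter_le _ _
    rw [Nat.card_Icc] at this
    exact_mod_cast by omega
  have hNge : ∀ (n : ℕ) (r : ℤ), (n : ℝ) - |(r : ℝ)| ≤ N n r := fun n r => by
    have h1 : Finset.Icc (1 + r.natAbs) n ⊆ (Finset.Icc 1 n).filter
        (fun s : ℕ => 1 ≤ (s : ℤ) + r ∧ (s : ℤ) + r ≤ n) ∨
        ((Finset.Icc 1 (n - r.natAbs)) ⊆ (Finset.Icc 1 n).filter
        (fun s : ℕ => 1 ≤ (s : ℤ) + r ∧ (s : ℤ) + r ≤ n)) := by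
      rcases le_total 0 r with h | h
      · right
        intro s hs
        simp only [Finset.mem_Icc, Finset.mem_filter] at hs ⊢
        omega
      · left
        intro s hs
        simp only [Finset.mem_Icc, Finset.mem_filter] at hs ⊢
        omega
    have h2 : (n : ℤ) - |r| ≤ N n r := by
      rw [Int.abs_eq_natAbs]
      rcases h1 with h | h
      · have := Finset.card_le_card h
        rw [Nat.card_Icc] at this
        change _ ≤ N n r at this
        omega
      · have := Finset.card_le_card h
        rw [Nat.card_Icc] at this
        change _ ≤ N n r at this
        omega
    exact_mod_cast h2
  have hsum : ∀ n : ℕ, ∑ s ∈ Finset.Icc 1 n, ∑ t ∈ Finset.Icc 1 n, c ((t : ℤ) - (s : ℤ)) =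
      ∑' r : ℤ, (N n r : ℝ) * c r := by
    intro n
    have h1 : ∀ s ∈ Finset.Icc 1 n, HasSum
        (fun r : ℤ => if 1 ≤ (s : ℤ) + r ∧ (s : ℤ) + r ≤ n then c r else 0)
        (∑ t ∈ Finset.Icc 1 n, c ((t : ℤ) - (s : ℤ))) := by
      intro s _
      have h2 : ∑ t ∈ Finset.Icc 1 n, c ((t : ℤ) - (s : ℤ)) =
          ∑ r ∈ (Finset.Icc 1 n).image (fun t : ℕ => (t : ℤ) - (s : ℤ)), c r := by
        rw [Finset.sum_image]
        intro x _ y _ h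
        simpa using h
      rw [h2]
      have h3 : ∀ r ∈ (Finset.Icc 1 n).image (fun t : ℕ => (t : ℤ) - (s : ℤ)), c r =
          if 1 ≤ (s : ℤ) + r ∧ (s : ℤ) + r ≤ n then c r else 0 := by
        intro r hr
        obtain ⟨t, ht, rfl⟩ := Finset.mem_image.1 hr
        rw [Finset.mem_Icc] at ht
        rw [if_pos (by omega)]
      rw [Finset.sum_congr rfl h3]
      refine hasSum_sum_of_ne_finset_zero fun r hr => if_neg fun hr' => hr ?_
      refine Finset.mem_image.2 ⟨((s : ℤ) + r).toNat, ?_, ?_⟩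
      · rw [Finset.mem_Icc]; omega
      · omega
    rw [← (hasSum_sum h1).tsum_eq]
    refine tsum_congr fun r => ?_
    rw [← Finset.sum_filter, Finset.sum_const, nsmul_eq_mul]
  have hform : ∀ n : ℕ, (∑ s ∈ Finset.Icc 1 n, ∑ t ∈ Finset.Icc 1 n, c ((t : ℤ) - (s : ℤ))) / n =
      ∑' r : ℤ, ((N n r : ℝ) / n) * c r := by
    intro n
    rw [hsum, ← tsum_div_const]
    exact tsum_congr fun r => by ring
  simp_rw [hform]
  refine tendsto_tsum_of_dominated_convergence hc (fun r => ?_) (Eventually.of_forall fun n r => ?_)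
  · have h1 : Tendsto (fun n : ℕ => (N n r : ℝ) / n) atTop (𝓝 1) := by
      have h2 : Tendsto (fun n : ℕ => 1 - |(r : ℝ)| / n) atTop (𝓝 1) := by
        simpa using (tendsto_const_div_atTop_nhds_zero_nat |(r : ℝ)|).const_sub 1
      refine tendsto_of_tendsto_of_tendsto_of_le_of_le' h2 tendsto_const_nhds ?_ ?_
      · filter_upwards [eventually_gt_atTop 0] with n hn
        have hn' : (0 : ℝ) < n := by exact_mod_cast hn
        rw [le_div_iff₀ hn', sub_mul, one_mul, div_mul_cancel₀ _ hn'.ne']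
        exact hNge n r
      · filter_upwards [eventually_gt_atTop 0] with n hn
        have hn' : (0 : ℝ) < n := by exact_mod_cast hn
        rw [div_le_one hn']
        exact hNle n r
    simpa using h1.mul_const (c r)
  · rw [norm_mul, Real.norm_eq_abs, Real.norm_eq_abs, abs_of_nonneg (by positivity)]
    refine mul_le_of_le_one_left (abs_nonneg _) ?_
    rcases Nat.eq_zero_or_pos n with rfl | hn
    · simp
    · have hn' : (0 : ℝ) < n := by exact_mod_cast hn
      rw [div_le_one hn']
      exact hNle n r

/-! ### Bilinear moving averages in a Hilbert space -/

section Hilbert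

variable {G : Type*} [NormedAddCommGroup G] [InnerProductSpace ℝ G]

/-- `ξ_{ab}` has the second-order structure of the centred products `⟨e_a, e_b⟩ - E⟨e_a, e_b⟩` of an
iid sequence: `κ₁` is the second moment of `⟨e_0, e_1⟩`, and `κ₂` is the fourth cumulant. -/
def IsProductArray (ξ : ℤ → ℤ → G) (κ₁ κ₂ : ℝ) : Prop :=
  ∀ a b c d, inner ℝ (ξ a b) (ξ c d) = (if (c, d) = (a, b) then κ₁ else 0) +
    (if (c, d) = (b, a) then κ₁ else 0) + if a = b ∧ (c, d) = (a, a) then κ₂ else 0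

/-- The bilinear moving average `∑_{i, j} a_i b_j ξ_{t-i, t-j}`. -/
noncomputable def bilinearAverage (ξ : ℤ → ℤ → G) (a b : ℤ → ℝ) (t : ℤ) : G :=
  ∑' q : ℤ × ℤ, (a q.1 * b q.2) • ξ (t - q.1) (t - q.2)

variable {ξ : ℤ → ℤ → G} {κ₁ κ₂ : ℝ}

lemma IsProductArray.norm_sq_le (hξ : IsProductArray ξ κ₁ κ₂) (a b : ℤ) :
    ‖ξ a b‖ ^ 2 ≤ 2 * |κ₁| + |κ₂| := by
  rw [← real_inner_self_eq_norm_sq, hξ a b a b]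
  have h1 := le_abs_self κ₁
  have h2 := le_abs_self κ₂
  have h3 := abs_nonneg κ₁
  have h4 := abs_nonneg κ₂
  split_ifs <;> linarith

lemma IsProductArray.norm_le (hξ : IsProductArray ξ κ₁ κ₂) (a b : ℤ) :
    ‖ξ a b‖ ≤ √(2 * |κ₁| + |κ₂|) :=
  Real.le_sqrt_of_sq_le (hξ.norm_sq_le a b)

/-- For fixed lags `i, j` the variables `ξ_{t-i, t-j}` are orthogonal in `t`. -/
lemma IsProductArray.norm_sum_le (hξ : IsProductArray ξ κ₁ κ₂) (T : Finset ℤ) (i j : ℤ) :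
    ‖∑ t ∈ T, ξ (t - i) (t - j)‖ ≤ √(2 * |κ₁| + |κ₂|) * √T.card := by
  rw [← Real.sqrt_mul (by positivity)]
  refine Real.le_sqrt_of_sq_le ?_
  rw [← real_inner_self_eq_norm_sq, sum_inner]
  have : ∀ t ∈ T, inner ℝ (ξ (t - i) (t - j)) (∑ s ∈ T, ξ (s - i) (s - j)) =
      ‖ξ (t - i) (t - j)‖ ^ 2 := by
    intro t ht
    rw [inner_sum, Finset.sum_eq_single t, real_inner_self_eq_norm_sq]
    · intro s _ hst
      rw [hξ]
      simp only [Prod.mk.injEq]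
      rw [if_neg (by omega), if_neg (by omega), if_neg (by omega)]
      simp
    · exact fun h => absurd ht h
  rw [Finset.sum_congr rfl this]
  refine (Finset.sum_le_sum fun t _ => hξ.norm_sq_le _ _).trans (le_of_eq ?_)
  rw [Finset.sum_const, nsmul_eq_mul, mul_comm]

variable [CompleteSpace G]

lemma IsProductArray.summable (hξ : IsProductArray ξ κ₁ κ₂) {a b : ℤ → ℝ}
    (ha : Summable fun i => |a i|) (hb : Summable fun i => |b i|) (t : ℤ) :
    Summable fun q : ℤ × ℤ => (a q.1 * b q.2) • ξ (t - q.1) (t - q.2) := by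
  refine Summable.of_norm_bounded
    ((Summable.mul_mul_int ha hb).mul_right (√(2 * |κ₁| + |κ₂|))) fun q => ?_
  rw [norm_smul, Real.norm_eq_abs, abs_mul]
  exact mul_le_mul_of_nonneg_left (hξ.norm_le _ _) (by positivity)

lemma IsProductArray.hasSum_bilinearAverage (hξ : IsProductArray ξ κ₁ κ₂) {a b : ℤ → ℝ}
    (ha : Summable fun i => |a i|) (hb : Summable fun i => |b i|) (t : ℤ) :
    HasSum (fun q : ℤ × ℤ => (a (t - q.1) * b (t - q.2)) • ξ q.1 q.2) (bilinearAverage ξ a b t) := by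
  have h := (hξ.summable ha hb t).hasSum
  rw [← ((Equiv.subLeft t).prodCongr (Equiv.subLeft t)).hasSum_iff] at h
  refine h.congr_fun fun q => ?_
  simp

open Classical in
/-- A sum of bilinear moving averages, restricted at time `t` to the lags in `R t`, has a norm of
order the square root of the number of summands. -/
lemma IsProductArray.norm_sum_tsum_le (hξ : IsProductArray ξ κ₁ κ₂) {a b : ℤ → ℝ}
    (ha : Summable fun i => |a i|) (hb : Summable fun i => |b i|) (T : Finset ℤ)
    (R : ℤ → ℤ × ℤ → Prop) :
    ‖∑ t ∈ T, ∑' q : ℤ × ℤ, (if R t q then (a q.1 * b q.2) • ξ (t - q.1) (t - q.2) else 0)‖ ≤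
      √(2 * |κ₁| + |κ₂|) * ∑' q : ℤ × ℤ, |a q.1| * |b q.2| * √(T.filter fun t => R t q).card := by
  have hs : ∀ t ∈ T, Summable fun q : ℤ × ℤ =>
      (if R t q then (a q.1 * b q.2) • ξ (t - q.1) (t - q.2) else 0) := by
    intro t _
    refine Summable.of_norm_bounded
      ((Summable.mul_mul_int ha hb).mul_right (√(2 * |κ₁| + |κ₂|))) fun q => ?_
    split_ifs
    · rw [norm_smul, Real.norm_eq_abs, abs_mul]
      exact mul_le_mul_of_nonneg_left (hξ.norm_le _ _) (by positivity)
    · rw [norm_zero]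
      positivity
  have hbound : ∀ q : ℤ × ℤ,
      ‖∑ t ∈ T, (if R t q then (a q.1 * b q.2) • ξ (t - q.1) (t - q.2) else 0)‖ ≤
        √(2 * |κ₁| + |κ₂|) * (|a q.1| * |b q.2| * √(T.filter fun t => R t q).card) := by
    intro q
    rw [← Finset.sum_filter, ← Finset.smul_sum, norm_smul, Real.norm_eq_abs, abs_mul]
    have := mul_le_mul_of_nonneg_left (hξ.norm_sum_le (T.filter fun t => R t q) q.1 q.2)
      (show 0 ≤ |a q.1| * |b q.2| by positivity)
    linarith
  have hsum : Summable fun q : ℤ × ℤ => √(2 * |κ₁| + |κ₂|) *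
      (|a q.1| * |b q.2| * √(T.filter fun t => R t q).card) := by
    refine Summable.mul_left _ ?_
    refine Summable.of_nonneg_of_le (fun q => by positivity) (fun q => ?_)
      ((Summable.mul_mul_int ha hb).mul_right (√T.card))
    refine mul_le_mul_of_nonneg_left (Real.sqrt_le_sqrt ?_) (by positivity)
    exact_mod_cast Finset.card_filter_le _ _
  rw [← Summable.tsum_finsetSum hs, ← tsum_mul_left]
  exact tsum_of_norm_bounded hsum.hasSum hbound

lemma IsProductArray.norm_sum_bilinearAverage_le (hξ : IsProductArray ξ κ₁ κ₂) {a b : ℤ → ℝ}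
    (ha : Summable fun i => |a i|) (hb : Summable fun i => |b i|) (T : Finset ℤ) :
    ‖∑ t ∈ T, bilinearAverage ξ a b t‖ ≤
      √(2 * |κ₁| + |κ₂|) * (∑' q : ℤ × ℤ, |a q.1| * |b q.2|) * √T.card := by
  have := hξ.norm_sum_tsum_le ha hb T fun _ _ => True
  simp only [if_true, Finset.filter_true] at this
  rw [tsum_mul_right, ← mul_assoc] at this
  exact this

/-- The autocovariance at lag `r` between two bilinear moving averages. -/
noncomputable def bilinearAcov (κ₁ κ₂ : ℝ) (a b c d : ℤ → ℝ) (r : ℤ) : ℝ :=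
  (∑' k, a k * b k * c (k + r) * d (k + r)) * κ₂ +
    (∑' k, a k * c (k + r)) * (∑' l, b l * d (l + r)) * κ₁ +
    (∑' k, a k * d (k + r)) * (∑' l, b l * c (l + r)) * κ₁

lemma hasSum_mul_ite {ι : Type*} [DecidableEq ι] (x : ι) (g : ι → ℝ) (κ : ℝ) :
    HasSum (fun w => g w * if w = x then κ else 0) (g x * κ) := by
  convert hasSum_ite_eq x (g x * κ) using 2 with w
  split_ifs with h <;> simp [h]

lemma tsum_reflect_mul (a b : ℤ → ℝ) (s t : ℤ) :
    ∑' k, a (s - k) * b (t - k) = ∑' k, a k * b (k + (t - s)) := by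
  rw [← (Equiv.subLeft s).tsum_eq]
  refine tsum_congr fun k => ?_
  simp only [Equiv.subLeft_apply, sub_sub_cancel]
  rw [show t - (s - k) = k + (t - s) by ring]

lemma hasSum_mul_prod {f g : ℤ → ℝ} (hf : Summable fun k => |f k|) (hg : Summable fun k => |g k|) :
    HasSum (fun q : ℤ × ℤ => f q.1 * g q.2) ((∑' k, f k) * ∑' l, g l) := by
  have h := summable_mul_of_summable_norm (f := f) (g := g) hf hg
  rw [tsum_mul_tsum_of_summable_norm (f := f) (g := g) hf hg]
  exact h.hasSum

lemma IsProductArray.inner_bilinearAverage (hξ : IsProductArray ξ κ₁ κ₂) {a b c d : ℤ → ℝ}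
    (ha : Summable fun i => |a i|) (hb : Summable fun i => |b i|)
    (hc : Summable fun i => |c i|) (hd : Summable fun i => |d i|) (s t : ℤ) :
    inner ℝ (bilinearAverage ξ a b s) (bilinearAverage ξ c d t) =
      bilinearAcov κ₁ κ₂ a b c d (t - s) := by
  have h1 : ∀ p q : ℤ, inner ℝ (ξ p q) (bilinearAverage ξ c d t) =
      c (t - p) * d (t - q) * κ₁ + c (t - q) * d (t - p) * κ₁ +
        if p = q then c (t - p) * d (t - p) * κ₂ else 0 := by
    intro p q
    have h2 := (hξ.hasSum_bilinearAverage hc hd t).mapL (innerSL ℝ (ξ p q))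
    refine HasSum.unique h2 ?_
    have h3 := (hasSum_mul_ite (p, q) (fun w : ℤ × ℤ => c (t - w.1) * d (t - w.2)) κ₁).add
      (hasSum_mul_ite (q, p) (fun w : ℤ × ℤ => c (t - w.1) * d (t - w.2)) κ₁)
    have h4 : HasSum (fun w : ℤ × ℤ => c (t - w.1) * d (t - w.2) *
        if p = q ∧ w = (p, p) then κ₂ else 0) (if p = q then c (t - p) * d (t - p) * κ₂ else 0) := by
      by_cases hpq : p = q
      · simpa [hpq] using hasSum_mul_ite (p, p) (fun w : ℤ × ℤ => c (t - w.1) * d (t - w.2)) κ₂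
      · simp [hpq, hasSum_zero]
    refine (h3.add h4).congr_fun fun w => ?_
    simp only [innerSL_apply_apply, inner_smul_right, hξ p q w.1 w.2, Prod.mk.eta]
    ring
  have h2 : HasSum (fun q : ℤ × ℤ => a (s - q.1) * b (s - q.2) *
      (c (t - q.1) * d (t - q.2) * κ₁ + c (t - q.2) * d (t - q.1) * κ₁ +
        if q.1 = q.2 then c (t - q.1) * d (t - q.1) * κ₂ else 0))
      (inner ℝ (bilinearAverage ξ a b s) (bilinearAverage ξ c d t)) := by
    have h3 := (hξ.hasSum_bilinearAverage ha hb s).mapL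
      ((innerSL ℝ).flip (bilinearAverage ξ c d t))
    refine h3.congr_fun fun q => ?_
    simp only [ContinuousLinearMap.flip_apply, innerSL_apply_apply, inner_smul_left, h1,
      RCLike.conj_to_real]
  refine h2.unique ?_
  have hprod : ∀ {x y : ℤ → ℝ}, (Summable fun i => |x i|) → (Summable fun i => |y i|) →
      Summable fun k => |x (s - k) * y (t - k)| := fun {x y} hx hy => by
    have := summable_abs_mul (summable_abs_reflect hx s) (summable_abs_reflect hy t)
    exact this
  have e1 := (hasSum_mul_prod (hprod ha hc) (hprod hb hd)).mul_right κ₁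
  have e2 := (hasSum_mul_prod (hprod ha hd) (hprod hb hc)).mul_right κ₁
  have e3 : HasSum (fun q : ℤ × ℤ => if q.1 = q.2 then
      a (s - q.1) * b (s - q.1) * c (t - q.1) * d (t - q.1) * κ₂ else 0)
      ((∑' k, a (s - k) * b (s - k) * c (t - k) * d (t - k)) * κ₂) := by
    have hinj : Function.Injective fun k : ℤ => (k, k) := fun x y h => congrArg Prod.fst h
    rw [← hinj.hasSum_iff]
    · have hs : Summable fun k => a (s - k) * b (s - k) * c (t - k) * d (t - k) := by
        have := (summable_abs_mul (hprod ha hc) (hprod hb hd)).of_abs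
        refine this.congr fun k => ?_
        ring
      simpa [Function.comp_def] using hs.hasSum.mul_right κ₂
    · intro q hq
      refine if_neg fun h => hq ⟨q.1, ?_⟩
      exact Prod.ext rfl h
  rw [bilinearAcov, ← tsum_reflect_mul a c s t, ← tsum_reflect_mul b d s t,
    ← tsum_reflect_mul a d s t, ← tsum_reflect_mul b c s t]
  have e4 : ∑' k, a k * b k * c (k + (t - s)) * d (k + (t - s)) =
      ∑' k, a (s - k) * b (s - k) * c (t - k) * d (t - k) := by
    have := tsum_reflect_mul (fun k => a k * b k) (fun k => c k * d k) s t
    simpa only [mul_assoc] using this.symm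
  rw [e4]
  refine ((e3.add e1).add e2).congr_fun fun q => ?_
  split_ifs with h
  · rw [← h]; ring
  · ring

lemma summable_abs_bilinearAcov {a b c d : ℤ → ℝ}
    (ha : Summable fun i => |a i|) (hb : Summable fun i => |b i|)
    (hc : Summable fun i => |c i|) (hd : Summable fun i => |d i|) (κ₁ κ₂ : ℝ) :
    Summable fun r => |bilinearAcov κ₁ κ₂ a b c d r| := by
  have h1 := summable_abs_tsum_mul_shift (summable_abs_mul ha hb) (summable_abs_mul hc hd)
  have h2 := summable_abs_mul (summable_abs_tsum_mul_shift ha hc)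
    (summable_abs_tsum_mul_shift hb hd)
  have h3 := summable_abs_mul (summable_abs_tsum_mul_shift ha hd)
    (summable_abs_tsum_mul_shift hb hc)
  refine Summable.of_nonneg_of_le (fun _ => abs_nonneg _) (fun r => ?_)
    (((h1.mul_right |κ₂|).add (h2.mul_right |κ₁|)).add (h3.mul_right |κ₁|))
  rw [bilinearAcov]
  refine (abs_add_le _ _).trans (add_le_add ((abs_add_le _ _).trans (add_le_add ?_ ?_)) ?_)
  · rw [abs_mul]; simp only [mul_assoc]; exact le_rfl
  · rw [abs_mul]
  · rw [abs_mul]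

/-- The long-run covariance of two bilinear moving averages is the sum of their
autocovariances. -/
lemma IsProductArray.tendsto_inner_sum_div (hξ : IsProductArray ξ κ₁ κ₂) {a b c d : ℤ → ℝ}
    (ha : Summable fun i => |a i|) (hb : Summable fun i => |b i|)
    (hc : Summable fun i => |c i|) (hd : Summable fun i => |d i|) :
    Tendsto (fun n : ℕ => inner ℝ (∑ t ∈ Finset.Icc 1 n, bilinearAverage ξ a b (t : ℕ))
      (∑ t ∈ Finset.Icc 1 n, bilinearAverage ξ c d (t : ℕ)) / n) atTop
      (𝓝 (∑' r, bilinearAcov κ₁ κ₂ a b c d r)) := by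
  refine (tendsto_sum_sum_sub_div (summable_abs_bilinearAcov ha hb hc hd κ₁ κ₂)).congr fun n => ?_
  rw [sum_inner]
  simp_rw [inner_sum, hξ.inner_bilinearAverage ha hb hc hd]

end Hilbert

/-! ### Products of independent random elements of a Hilbert space -/

instance holderTriple_four_four_two : ENNReal.HolderTriple 4 4 2 where
  inv_add_inv_eq_inv := by
    rw [← two_mul, show (4 : ENNReal) = 2 * 2 by norm_num, ENNReal.mul_inv (by simp) (by simp),
      ← mul_assoc, ENNReal.mul_inv_cancel (by simp) (by simp), one_mul]

section Noise

variable {Ω : Type*} [MeasurableSpace Ω] {H : Type*} [NormedAddCommGroup H] [InnerProductSpace ℝ H]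
  [MeasurableSpace H] [BorelSpace H]

/-- iid, centred random elements of a Hilbert space with finite fourth moment. -/
structure IsNoise (P : Measure Ω) (e : ℤ → Ω → H) : Prop where
  indep : iIndepFun e P
  ident : ∀ t, IdentDistrib (e t) (e 0) P P
  memLp_zero : MemLp (e 0) 4 P
  mean_zero : ∫ ω, e 0 ω ∂P = 0

variable {P : Measure Ω} {e : ℤ → Ω → H}

/-- The variance `E‖e_0‖²` of the noise. -/
noncomputable def noiseVar (P : Measure Ω) (e : ℤ → Ω → H) : ℝ := ∫ ω, ‖e 0 ω‖ ^ 2 ∂P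

/-- The second moment of `⟨e_0, e_1⟩`: the squared Hilbert–Schmidt norm of the covariance
operator. -/
noncomputable def noiseCross (P : Measure Ω) (e : ℤ → Ω → H) : ℝ :=
  ∫ ω, inner ℝ (e 0 ω) (e 1 ω) ^ 2 ∂P

/-- The fourth cumulant of the noise, with the arguments contracted in pairs: what `E‖e_0‖⁴` exceeds
its value for a Gaussian element with the same covariance operator. -/
noncomputable def noiseCumulant (P : Measure Ω) (e : ℤ → Ω → H) : ℝ :=
  ∫ ω, ‖e 0 ω‖ ^ 4 ∂P - noiseVar P e ^ 2 - 2 * noiseCross P e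

/-- The centred product of the noise at two times. -/
noncomputable def centredProduct (P : Measure Ω) (e : ℤ → Ω → H) (s t : ℤ) (ω : Ω) : ℝ :=
  inner ℝ (e s ω) (e t ω) - if s = t then noiseVar P e else 0

lemma centredProduct_comm (s t : ℤ) (ω : Ω) :
    centredProduct P e s t ω = centredProduct P e t s ω := by
  rw [centredProduct, centredProduct, real_inner_comm]
  simp only [eq_comm]

namespace IsNoise

lemma memLp (he : IsNoise P e) (t : ℤ) : MemLp (e t) 4 P :=
  (he.ident t).memLp_iff.2 he.memLp_zero

lemma aemeasurable (he : IsNoise P e) (t : ℤ) : AEMeasurable (e t) P :=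
  (he.ident t).aemeasurable_fst

variable [IsProbabilityMeasure P]

lemma memLp_two (he : IsNoise P e) (t : ℤ) : MemLp (e t) 2 P :=
  (he.memLp t).mono_exponent (by norm_num)

lemma integrable (he : IsNoise P e) (t : ℤ) : Integrable (e t) P :=
  (he.memLp t).integrable (by norm_num)

lemma integral_eq_zero (he : IsNoise P e) (t : ℤ) : ∫ ω, e t ω ∂P = 0 := by
  rw [(he.ident t).integral_eq, he.mean_zero]

lemma integral_norm_sq (he : IsNoise P e) (t : ℤ) : ∫ ω, ‖e t ω‖ ^ 2 ∂P = noiseVar P e :=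
  ((he.ident t).comp (u := fun x => ‖x‖ ^ 2) (by fun_prop)).integral_eq

lemma integral_norm_pow_four (he : IsNoise P e) (t : ℤ) :
    ∫ ω, ‖e t ω‖ ^ 4 ∂P = ∫ ω, ‖e 0 ω‖ ^ 4 ∂P :=
  ((he.ident t).comp (u := fun x => ‖x‖ ^ 4) (by fun_prop)).integral_eq

lemma integral_inner_sq [SecondCountableTopology H] (he : IsNoise P e) {s t : ℤ} (hst : s ≠ t) :
    ∫ ω, inner ℝ (e s ω) (e t ω) ^ 2 ∂P = noiseCross P e := by
  have h1 : IdentDistrib (e t) (e 1) P P := (he.ident t).trans (he.ident 1).symm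
  have h2 := IdentDistrib.prodMk (he.ident s) h1 (he.indep.indepFun hst)
    (he.indep.indepFun zero_ne_one)
  have h3 : Measurable fun x : H × H => (inner ℝ x.1 x.2 : ℝ) ^ 2 := by
    have : Continuous fun x : H × H => (inner ℝ x.1 x.2 : ℝ) ^ 2 := by fun_prop
    exact this.measurable
  exact (h2.comp h3).integral_eq

lemma memLp_inner (he : IsNoise P e) (s t : ℤ) :
    MemLp (fun ω => (inner ℝ (e s ω) (e t ω) : ℝ)) 2 P :=
  (innerSL ℝ).memLp_of_bilin 2 (he.memLp s) (he.memLp t)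

lemma memLp_centredProduct (he : IsNoise P e) (s t : ℤ) :
    MemLp (centredProduct P e s t) 2 P :=
  (he.memLp_inner s t).sub (memLp_const _)

lemma integral_inner (he : IsNoise P e) [CompleteSpace H] {s t : ℤ} (hst : s ≠ t) :
    ∫ ω, (inner ℝ (e s ω) (e t ω) : ℝ) ∂P = 0 := by
  have h : ∫ ω, (inner ℝ (e s ω) (e t ω) : ℝ) ∂P = inner ℝ (∫ ω, e s ω ∂P) (∫ ω, e t ω ∂P) :=
    (he.indep.indepFun hst).integral_bilin (he.integrable s) (he.integrable t) (innerSL ℝ)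
  rw [h, he.integral_eq_zero, inner_zero_left]

lemma integral_centredProduct (he : IsNoise P e) [CompleteSpace H] (s t : ℤ) :
    ∫ ω, centredProduct P e s t ω ∂P = 0 := by
  simp only [centredProduct]
  rw [integral_sub ((he.memLp_inner s t).integrable one_le_two) (integrable_const _),
    integral_const]
  by_cases h : s = t
  · subst h
    simp [he.integral_norm_sq]
  · simp [he.integral_inner h, h]

/-- If the index `c` occurs only once, conditioning on the other factors gives zero. -/
lemma integral_mul_eq_zero_of_isolated (he : IsNoise P e) [CompleteSpace H]
    [SecondCountableTopology H] {a b c d : ℤ} (ha : c ≠ a) (hb : c ≠ b) (hd : c ≠ d) :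
    ∫ ω, centredProduct P e a b ω * centredProduct P e c d ω ∂P = 0 := by
  have hind := he.indep.indepFun_finset₀ {a, b, d} {c} (by simp [ha, hb, hd])
    he.aemeasurable
  set φ : ((({a, b, d} : Finset ℤ) : Type) → H) → H := fun x =>
    ((inner ℝ (x ⟨a, by simp⟩) (x ⟨b, by simp⟩) : ℝ) - if a = b then noiseVar P e else 0) •
      x ⟨d, by simp⟩ with hφ
  have hφm : Measurable φ := by
    have : Continuous φ := by fun_prop
    exact this.measurable
  have hind2 : IndepFun (fun ω => centredProduct P e a b ω • e d ω) (e c) P :=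
    hind.comp hφm (measurable_pi_apply (⟨c, by simp⟩ : (({c} : Finset ℤ) : Type)))
  have hint : Integrable (fun ω => centredProduct P e a b ω • e d ω) P :=
    memLp_one_iff_integrable.1 ((he.memLp_two d).smul (he.memLp_centredProduct a b))
  have h : ∫ ω, (inner ℝ (centredProduct P e a b ω • e d ω) (e c ω) : ℝ) ∂P =
      inner ℝ (∫ ω, centredProduct P e a b ω • e d ω ∂P) (∫ ω, e c ω ∂P) :=
    hind2.integral_bilin hint (he.integrable c) (innerSL ℝ)
  rw [he.integral_eq_zero, inner_zero_right] at h
  rw [← h]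
  refine integral_congr_ae (ae_of_all _ fun ω => ?_)
  simp only [centredProduct, if_neg hd, sub_zero, inner_smul_left,
    RCLike.conj_to_real]
  rw [real_inner_comm (e d ω)]

/-- The centred product as an element of `L²(P)`. -/
noncomputable def productL2 (he : IsNoise P e) (s t : ℤ) : Lp ℝ 2 P :=
  (he.memLp_centredProduct s t).toLp

/-- Fourth-order moments of the noise: they vanish unless the indices agree in pairs. -/
lemma isProductArray (he : IsNoise P e) [CompleteSpace H] [SecondCountableTopology H] :
    IsProductArray he.productL2 (noiseCross P e) (noiseCumulant P e) := by
  intro a b c d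
  have hI : inner ℝ (he.productL2 a b) (he.productL2 c d) =
      ∫ ω, centredProduct P e a b ω * centredProduct P e c d ω ∂P := by
    rw [L2.inner_def]
    refine integral_congr_ae ?_
    filter_upwards [(he.memLp_centredProduct a b).coeFn_toLp,
      (he.memLp_centredProduct c d).coeFn_toLp] with ω h1 h2
    rw [productL2, productL2, h1, h2]
    simp [mul_comm]
  rw [hI]
  -- an index that occurs only once
  have isoC : ∀ {a b c d : ℤ}, c ≠ a → c ≠ b → c ≠ d →
      ∫ ω, centredProduct P e a b ω * centredProduct P e c d ω ∂P = 0 :=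
    fun h1 h2 h3 => he.integral_mul_eq_zero_of_isolated h1 h2 h3
  have isoD : ∀ {a b c d : ℤ}, d ≠ a → d ≠ b → d ≠ c →
      ∫ ω, centredProduct P e a b ω * centredProduct P e c d ω ∂P = 0 := fun {a b c d} h1 h2 h3 => by
    simp_rw [centredProduct_comm c d]
    exact isoC h1 h2 h3
  have hswap : ∀ a b c d, ∫ ω, centredProduct P e a b ω * centredProduct P e c d ω ∂P =
      ∫ ω, centredProduct P e c d ω * centredProduct P e a b ω ∂P := fun a b c d => by
    simp_rw [mul_comm]
  have hcross : ∀ {a b : ℤ}, a ≠ b →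
      ∫ ω, centredProduct P e a b ω * centredProduct P e a b ω ∂P = noiseCross P e :=
    fun {a b} hab => by
      rw [← he.integral_inner_sq hab]
      simp [centredProduct, hab, sq]
  have hdiag : ∀ a, ∫ ω, centredProduct P e a a ω * centredProduct P e a a ω ∂P =
      ∫ ω, ‖e 0 ω‖ ^ 4 ∂P - noiseVar P e ^ 2 := fun a => by
    have h2 : Integrable (fun ω => ‖e a ω‖ ^ 2) P := (he.memLp_two a).integrable_norm_pow two_ne_zero
    have h4 : Integrable (fun ω => ‖e a ω‖ ^ 4) P :=
      (he.memLp a).integrable_norm_pow four_ne_zero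
    have : ∀ ω, centredProduct P e a a ω * centredProduct P e a a ω =
        ‖e a ω‖ ^ 4 - 2 * noiseVar P e * ‖e a ω‖ ^ 2 + noiseVar P e ^ 2 := fun ω => by
      simp only [centredProduct, real_inner_self_eq_norm_sq, if_true]
      ring
    simp_rw [this]
    have h3 : Integrable (fun ω => ‖e a ω‖ ^ 4 - 2 * noiseVar P e * ‖e a ω‖ ^ 2) P :=
      h4.sub (h2.const_mul _)
    rw [integral_add h3 (integrable_const _), integral_sub h4 (h2.const_mul _), integral_const_mul, he.integral_norm_sq,
      he.integral_norm_pow_four, integral_const]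
    simp
    ring
  by_cases hab : a = b
  · by_cases hcd : c = d
    · subst hab hcd
      by_cases hac : a = c
      · subst hac
        rw [hdiag, noiseCumulant]
        simp
        ring
      · have hind : IndepFun (centredProduct P e a a) (centredProduct P e c c) P := by
          have h := (he.indep.indepFun hac).comp
            (φ := fun x => (inner ℝ x x : ℝ) - noiseVar P e)
            (ψ := fun x => (inner ℝ x x : ℝ) - noiseVar P e)
            (by fun_prop) (by fun_prop)
          have h' : ∀ t, centredProduct P e t t =
              (fun x => (inner ℝ x x : ℝ) - noiseVar P e) ∘ e t := fun t => by
            ext ω; simp [centredProduct]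
          rwa [h', h']
        have h := hind.integral_fun_mul_eq_mul_integral
          (he.memLp_centredProduct a a).aestronglyMeasurable
          (he.memLp_centredProduct c c).aestronglyMeasurable
        rw [h, he.integral_centredProduct, zero_mul]
        simp [Ne.symm hac]
    · have hrhs : ((if (c, d) = (a, b) then noiseCross P e else 0) +
          (if (c, d) = (b, a) then noiseCross P e else 0) +
          if a = b ∧ (c, d) = (a, a) then noiseCumulant P e else 0) = 0 := by
        simp only [Prod.mk.injEq]
        rw [if_neg (by omega), if_neg (by omega), if_neg (by omega)]
        simp
      rw [hrhs]
      by_cases hca : c = a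
      · exact isoD (by omega) (by omega) (by omega)
      · exact isoC (by omega) (by omega) (by omega)
  · by_cases hcd : c = d
    · have hrhs : ((if (c, d) = (a, b) then noiseCross P e else 0) +
          (if (c, d) = (b, a) then noiseCross P e else 0) +
          if a = b ∧ (c, d) = (a, a) then noiseCumulant P e else 0) = 0 := by
        simp only [Prod.mk.injEq]
        rw [if_neg (by omega), if_neg (by omega), if_neg (by omega)]
        simp
      rw [hrhs, hswap]
      by_cases hca : c = a
      · exact isoD (by omega) (by omega) (by omega)
      · exact isoC (by omega) (by omega) (by omega)
    · by_cases h1 : c = a ∧ d = b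
      · obtain ⟨rfl, rfl⟩ := h1
        rw [hcross hab]
        simp [hab]
      · by_cases h2 : c = b ∧ d = a
        · obtain ⟨rfl, rfl⟩ := h2
          simp_rw [centredProduct_comm c d]
          rw [hcross hab]
          simp [hab, Ne.symm hab]
        · have hrhs : ((if (c, d) = (a, b) then noiseCross P e else 0) +
              (if (c, d) = (b, a) then noiseCross P e else 0) +
              if a = b ∧ (c, d) = (a, a) then noiseCumulant P e else 0) = 0 := by
            simp only [Prod.mk.injEq]
            rw [if_neg (by omega), if_neg (by omega), if_neg (by omega)]
            simp
          rw [hrhs]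
          by_cases h3 : c = a ∨ c = b
          · exact isoD (by omega) (by omega) (by omega)
          · exact isoC (by omega) (by omega) (by omega)

end IsNoise

end Noise

/-! ### Characteristic functions and `L²` approximation -/

section CharFun

variable {Ω : Type*} [MeasurableSpace Ω] {P : Measure Ω} [IsProbabilityMeasure P]

lemma integral_abs_le_norm (g : Lp ℝ 2 P) : ∫ ω, |g ω| ∂P ≤ ‖g‖ := by
  have h : ∫ ω, |g ω| ∂P = (eLpNorm g 1 P).toReal := by
    rw [eLpNorm_one_eq_lintegral_enorm]
    exact integral_norm_eq_lintegral_enorm (Lp.aestronglyMeasurable g)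
  rw [h, Lp.norm_def]
  exact ENNReal.toReal_mono (Lp.eLpNorm_ne_top g)
    (eLpNorm_le_eLpNorm_of_exponent_le one_le_two (Lp.aestronglyMeasurable g))

lemma norm_charFun_map_sub_le (X Z : Lp ℝ 2 P) (u : ℝ) :
    ‖charFun (P.map X) u - charFun (P.map Z) u‖ ≤ |u| * ‖X - Z‖ := by
  have hm : ∀ Y : Lp ℝ 2 P, AEMeasurable Y P := fun Y => (Lp.aestronglyMeasurable Y).aemeasurable
  have hc : ∀ Y : Lp ℝ 2 P, charFun (P.map Y) u = ∫ ω, Complex.exp (u * Y ω * Complex.I) ∂P :=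
    fun Y => by
      rw [charFun_apply_real, integral_map (hm Y) (by fun_prop)]
  have hi : ∀ Y : Lp ℝ 2 P, Integrable (fun ω => Complex.exp (u * Y ω * Complex.I)) P :=
    fun Y => by
      refine Integrable.mono' (integrable_const 1) ?_ (ae_of_all _ fun ω => ?_)
      · have := (hm Y).complex_ofReal
        exact (by fun_prop : AEMeasurable (fun ω => Complex.exp (u * Y ω * Complex.I)) P
          ).aestronglyMeasurable
      · rw [← Complex.ofReal_mul, Complex.norm_exp_ofReal_mul_I]
  rw [hc, hc, ← integral_sub (hi X) (hi Z)]
  refine (norm_integral_le_integral_norm _).trans ?_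
  calc ∫ ω, ‖Complex.exp (u * X ω * Complex.I) - Complex.exp (u * Z ω * Complex.I)‖ ∂P
      ≤ ∫ ω, |u| * |(X - Z) ω| ∂P := by
        refine integral_mono_ae ((hi X).sub (hi Z)).norm ?_ ?_
        · exact ((Lp.memLp (X - Z)).integrable one_le_two).abs.const_mul _
        · filter_upwards [Lp.coeFn_sub X Z] with ω hω
          rw [hω, Pi.sub_apply, ← abs_mul]
          have h1 : Complex.exp (u * X ω * Complex.I) - Complex.exp (u * Z ω * Complex.I) =
              Complex.exp ((u * Z ω : ℝ) * Complex.I) *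
                (Complex.exp (Complex.I * (u * (X ω - Z ω) : ℝ)) - 1) := by
            rw [mul_sub, ← Complex.exp_add, mul_one]
            push_cast
            ring_nf
          rw [h1, norm_mul, Complex.norm_exp_ofReal_mul_I, one_mul]
          exact Real.norm_exp_I_mul_ofReal_sub_one_le
    _ ≤ |u| * ‖X - Z‖ := by
        rw [integral_const_mul]
        gcongr
        exact integral_abs_le_norm _

/-- A sequence in `L²` that can be approximated, uniformly in the index, by asymptotically normal
sequences is itself asymptotically normal. -/
lemma tendsto_charFun_of_forall_approx {X : ℕ → Lp ℝ 2 P} {σ : ℝ}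
    (hX : Tendsto (fun n => ‖X n‖) atTop (𝓝 σ))
    (happ : ∀ δ > 0, ∃ (Z : ℕ → Lp ℝ 2 P) (τ : ℝ), (∀ᶠ n in atTop, ‖X n - Z n‖ ≤ δ) ∧
      (∀ᶠ n in atTop, ‖Z n‖ = τ) ∧
      ∀ u : ℝ, Tendsto (fun n => charFun (P.map (Z n)) u) atTop
        (𝓝 (Complex.exp (-(τ ^ 2 * u ^ 2 / 2 : ℝ))))) (u : ℝ) :
    Tendsto (fun n => charFun (P.map (X n)) u) atTop
      (𝓝 (Complex.exp (-(σ ^ 2 * u ^ 2 / 2 : ℝ)))) := by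
  rw [Metric.tendsto_nhds]
  intro η hη
  have hcont : Continuous fun x : ℝ => Complex.exp (-(x ^ 2 * u ^ 2 / 2 : ℝ)) := by fun_prop
  obtain ⟨δ₀, hδ₀, hd⟩ := Metric.continuous_iff.1 hcont σ (η / 3) (by positivity)
  set δ := min (δ₀ / 2) (η / 3 / (|u| + 1)) with hδ
  have hδpos : 0 < δ := by positivity
  obtain ⟨Z, τ, h1, h2, h3⟩ := happ δ hδpos
  have hστ : |σ - τ| ≤ δ := by
    have h : Tendsto (fun n => |‖X n‖ - τ|) atTop (𝓝 |σ - τ|) := (hX.sub_const τ).abs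
    refine le_of_tendsto h ?_
    filter_upwards [h1, h2] with n hn1 hn2
    rw [← hn2]
    exact (abs_norm_sub_norm_le _ _).trans hn1
  have h4 : dist (Complex.exp (-(τ ^ 2 * u ^ 2 / 2 : ℝ))) (Complex.exp (-(σ ^ 2 * u ^ 2 / 2 : ℝ)))
      < η / 3 := by
    refine hd τ ?_
    rw [Real.dist_eq, abs_sub_comm]
    have : δ ≤ δ₀ / 2 := min_le_left _ _
    linarith
  filter_upwards [h1, Metric.tendsto_nhds.1 (h3 u) (η / 3) (by positivity)] with n hn1 hn2
  have h5 : dist (charFun (P.map (X n)) u) (charFun (P.map (Z n)) u) ≤ η / 3 := by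
    rw [dist_eq_norm]
    refine (norm_charFun_map_sub_le _ _ _).trans ?_
    have : δ ≤ η / 3 / (|u| + 1) := min_le_right _ _
    rw [le_div_iff₀ (by positivity)] at this
    nlinarith [abs_nonneg u, norm_nonneg (X n - Z n)]
  have := dist_triangle4 (charFun (P.map (X n)) u) (charFun (P.map (Z n)) u)
    (Complex.exp (-(τ ^ 2 * u ^ 2 / 2 : ℝ))) (Complex.exp (-(σ ^ 2 * u ^ 2 / 2 : ℝ)))
  linarith

/-- The central limit theorem for centred iid random variables, through characteristic
functions. -/
lemma tendsto_charFun_iid {W : ℕ → Ω → ℝ} (hW : MemLp (W 0) 2 P) (h0 : ∫ ω, W 0 ω ∂P = 0)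
    (hind : iIndepFun W P) (hid : ∀ j, IdentDistrib (W j) (W 0) P P) (u : ℝ) :
    Tendsto (fun K : ℕ => charFun
        (P.map fun ω => (√(K : ℝ))⁻¹ * ∑ j ∈ Finset.range K, W j ω) u)
      atTop (𝓝 (Complex.exp (-(Var[W 0; P] * u ^ 2 / 2 : ℝ)))) := by
  have h := tendstoInDistribution_inv_sqrt_mul_sum_sub (P := P) (X := W)
    (Y := id) (P' := gaussianReal 0 Var[W 0; P].toNNReal) ⟨aemeasurable_id, by simp⟩ hW hind hid
  have h2 := ProbabilityMeasure.tendsto_iff_tendsto_charFun.1 h.tendsto u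
  simp only [ProbabilityMeasure.coe_mk, Measure.map_id, charFun_gaussianReal, h0, mul_zero,
    sub_zero] at h2
  convert h2 using 2
  rw [Real.coe_toNNReal _ (variance_nonneg _ _)]
  push_cast
  congr 1
  ring

end CharFun

/-! ### The central limit theorem for quadratic forms in the noise -/

section Counting

lemma sum_Icc_one_eq_sum_range {M : Type*} [AddCommMonoid M] (f : ℕ → M) (n : ℕ) :
    ∑ t ∈ Finset.Icc 1 n, f t = ∑ s ∈ Finset.range n, f (s + 1) := by
  rw [Finset.range_eq_Ico, Finset.sum_Ico_add' f 0 n 1]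
  rfl

lemma sum_range_mul_eq {M : Type*} [AddCommMonoid M] (f : ℕ → M) (K L : ℕ) :
    ∑ s ∈ Finset.range (K * L), f s = ∑ j ∈ Finset.range K, ∑ l ∈ Finset.range L, f (j * L + l) := by
  induction K with
  | zero => simp
  | succ K ih => rw [Nat.succ_mul, Finset.sum_range_add, ih, Finset.sum_range_succ]

/-- The times `t` and `t - q.1`, `t - q.2` lie in the same block `{j L + 1, …, (j + 1) L}`. -/
def InBlock (L : ℕ) (t : ℤ) (q : ℤ × ℤ) : Prop :=
  (0 ≤ (t - 1) % L - q.1 ∧ (t - 1) % L - q.1 < L) ∧ 0 ≤ (t - 1) % L - q.2 ∧ (t - 1) % L - q.2 < L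

open Classical in
lemma card_filter_not_inBlock_le (K L : ℕ) (q : ℤ × ℤ) :
    (((Finset.range (K * L)).image fun s : ℕ => (s : ℤ) + 1).filter fun t => ¬ InBlock L t q).card ≤
      K * min L (2 * (q.1.natAbs + q.2.natAbs)) := by
  set m := q.1.natAbs + q.2.natAbs with hm
  have h1 : (((Finset.range (K * L)).image fun s : ℕ => (s : ℤ) + 1).filter
      fun t => ¬ InBlock L t q).card ≤
        ((Finset.range (K * L)).filter fun s : ℕ => ¬ InBlock L ((s : ℤ) + 1) q).card := by
    rw [Finset.filter_image]
    exact Finset.card_image_le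
  refine h1.trans ?_
  rw [Finset.card_filter, sum_range_mul_eq]
  have h2 : ∀ j ∈ Finset.range K, (∑ l ∈ Finset.range L,
      if ¬ InBlock L (((j * L + l : ℕ) : ℤ) + 1) q then 1 else 0) ≤ min L (2 * m) := by
    intro j _
    rw [← Finset.card_filter]
    refine le_min ((Finset.card_filter_le _ _).trans (Finset.card_range L).le) ?_
    have hsub : ((Finset.range L).filter fun l => ¬ InBlock L (((j * L + l : ℕ) : ℤ) + 1) q) ⊆
        Finset.range m ∪ Finset.Ico (L - m) L := by
      intro l hl
      simp only [Finset.mem_filter, Finset.mem_range] at hl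
      obtain ⟨hl1, hl2⟩ := hl
      have hmod : ((((j * L + l : ℕ) : ℤ) + 1) - 1) % L = l := by
        rw [add_sub_cancel_right]
        have : (j * L + l) % L = l := by rw [Nat.mul_add_mod', Nat.mod_eq_of_lt hl1]
        exact_mod_cast this
      simp only [InBlock, hmod] at hl2
      simp only [Finset.mem_union, Finset.mem_range, Finset.mem_Ico]
      omega
    refine (Finset.card_le_card hsub).trans ((Finset.card_union_le _ _).trans ?_)
    simp only [Finset.card_range, Nat.card_Ico]
    omega
  refine (Finset.sum_le_sum h2).trans ?_
  simp

end Counting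

section Approximation

variable {G : Type*} [NormedAddCommGroup G] [InnerProductSpace ℝ G] [CompleteSpace G]
  {ξ : ℤ → ℤ → G} {κ₁ κ₂ : ℝ} {a b : ℤ → ℝ}

/-- The part of a sum of bilinear moving averages that involves only the `j`-th block of
times. -/
noncomputable def blockSum (ξ : ℤ → ℤ → G) (a b : ℤ → ℝ) (L j : ℕ) : G :=
  ∑ t : Fin L, ∑ l : Fin L, ∑ m : Fin L,
    (a ((t : ℕ) - (l : ℕ) : ℤ) * b ((t : ℕ) - (m : ℕ) : ℤ)) •
      ξ ((j * L + (l : ℕ) : ℕ) + 1 : ℤ) ((j * L + (m : ℕ) : ℕ) + 1 : ℤ)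

open Classical in
lemma tsum_inBlock_eq (ξ : ℤ → ℤ → G) (a b : ℤ → ℝ) {L : ℕ} (j : ℕ) (t : Fin L) :
    ∑' q : ℤ × ℤ, (if InBlock L ((j * L + (t : ℕ) : ℕ) + 1 : ℤ) q then (a q.1 * b q.2) •
      ξ (((j * L + (t : ℕ) : ℕ) + 1 : ℤ) - q.1) (((j * L + (t : ℕ) : ℕ) + 1 : ℤ) - q.2) else 0) =
    ∑ l : Fin L, ∑ m : Fin L, (a ((t : ℕ) - (l : ℕ) : ℤ) * b ((t : ℕ) - (m : ℕ) : ℤ)) •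
      ξ ((j * L + (l : ℕ) : ℕ) + 1 : ℤ) ((j * L + (m : ℕ) : ℕ) + 1 : ℤ) := by
  have hmod : (((j * L + (t : ℕ) : ℕ) + 1 : ℤ) - 1) % L = (t : ℕ) := by
    rw [add_sub_cancel_right]
    have : (j * L + (t : ℕ)) % L = t := by rw [Nat.mul_add_mod', Nat.mod_eq_of_lt t.2]
    exact_mod_cast this
  set g : Fin L × Fin L → ℤ × ℤ := fun p =>
    (((t : ℕ) - (p.1 : ℕ) : ℤ), ((t : ℕ) - (p.2 : ℕ) : ℤ)) with hg
  have hinj : Function.Injective g := by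
    rintro ⟨l, m⟩ ⟨l', m'⟩ h
    simp only [hg, Prod.mk.injEq] at h
    ext <;> simp <;> omega
  rw [← hinj.tsum_eq, tsum_fintype, Fintype.sum_prod_type]
  · refine Finset.sum_congr rfl fun l _ => Finset.sum_congr rfl fun m _ => ?_
    rw [if_pos]
    · congr 2 <;> simp only [hg] <;> push_cast <;> ring
    · have := l.2
      have := m.2
      simp only [InBlock, hmod, hg]
      omega
  · intro q hq
    have hb : InBlock L ((j * L + (t : ℕ) : ℕ) + 1 : ℤ) q := by
      by_contra h
      rw [Function.mem_support, if_neg h] at hq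
      exact hq rfl
    simp only [InBlock, hmod] at hb
    refine ⟨(⟨((t : ℕ) - q.1 : ℤ).toNat, by omega⟩, ⟨((t : ℕ) - q.2 : ℤ).toNat, by omega⟩), ?_⟩
    ext <;> simp only [hg] <;> omega

/-- The relative error of the approximation by blocks of length `L`. -/
noncomputable def blockError (κ₁ κ₂ : ℝ) (a b : ℤ → ℝ) (L : ℕ) : ℝ :=
  √(2 * |κ₁| + |κ₂|) * ∑' q : ℤ × ℤ,
    |a q.1| * |b q.2| * √(min 1 (2 * ((q.1.natAbs : ℝ) + q.2.natAbs) / L))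

lemma tendsto_blockError (ha : Summable fun i => |a i|) (hb : Summable fun i => |b i|) :
    Tendsto (blockError κ₁ κ₂ a b) atTop (𝓝 0) := by
  rw [← mul_zero √(2 * |κ₁| + |κ₂|)]
  refine Tendsto.const_mul _ ?_
  rw [← tsum_zero (β := ℤ × ℤ) (α := ℝ)]
  refine tendsto_tsum_of_dominated_convergence (Summable.mul_mul_int ha hb) (fun q => ?_)
    (Eventually.of_forall fun L q => ?_)
  · rw [← mul_zero (|a q.1| * |b q.2|)]
    refine Tendsto.const_mul _ ?_
    have h1 : Tendsto (fun L : ℕ => 2 * ((q.1.natAbs : ℝ) + q.2.natAbs) / L) atTop (𝓝 0) :=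
      tendsto_const_div_atTop_nhds_zero_nat _
    have h2 := ((tendsto_const_nhds (x := (1 : ℝ))).min h1).sqrt
    rwa [min_eq_right zero_le_one, Real.sqrt_zero] at h2
  · rw [Real.norm_eq_abs, abs_of_nonneg (by positivity)]
    refine mul_le_of_le_one_right (by positivity) ?_
    exact Real.sqrt_le_one.2 (min_le_left _ _)

lemma IsProductArray.norm_sum_sub_sum_blockSum_le (hξ : IsProductArray ξ κ₁ κ₂)
    (ha : Summable fun i => |a i|) (hb : Summable fun i => |b i|) (K : ℕ) {L : ℕ} (hL : 0 < L) :
    ‖∑ s ∈ Finset.range (K * L), bilinearAverage ξ a b ((s : ℤ) + 1) -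
      ∑ j ∈ Finset.range K, blockSum ξ a b L j‖ ≤ blockError κ₁ κ₂ a b L * √((K * L : ℕ) : ℝ) := by
  classical
  set T := (Finset.range (K * L)).image fun s : ℕ => (s : ℤ) + 1 with hT
  have hsumT : ∀ g : ℤ → G, ∑ t ∈ T, g t = ∑ s ∈ Finset.range (K * L), g ((s : ℤ) + 1) :=
    fun g => Finset.sum_image fun x _ y _ h => by simpa using h
  have h1 : ∑ s ∈ Finset.range (K * L), bilinearAverage ξ a b ((s : ℤ) + 1) -
      ∑ j ∈ Finset.range K, blockSum ξ a b L j = ∑ t ∈ T, ∑' q : ℤ × ℤ,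
        (if ¬ InBlock L t q then (a q.1 * b q.2) • ξ (t - q.1) (t - q.2) else 0) := by
    have h2 : ∑ j ∈ Finset.range K, blockSum ξ a b L j = ∑ t ∈ T, ∑' q : ℤ × ℤ,
        (if InBlock L t q then (a q.1 * b q.2) • ξ (t - q.1) (t - q.2) else 0) := by
      rw [hsumT, sum_range_mul_eq]
      refine Finset.sum_congr rfl fun j _ => ?_
      rw [Finset.sum_range, blockSum]
      exact Finset.sum_congr rfl fun t _ => (tsum_inBlock_eq ξ a b j t).symm
    rw [h2, ← hsumT, ← Finset.sum_sub_distrib]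
    refine Finset.sum_congr rfl fun t _ => ?_
    have hs := hξ.summable ha hb t
    have hin : Summable fun q : ℤ × ℤ =>
        (if InBlock L t q then (a q.1 * b q.2) • ξ (t - q.1) (t - q.2) else 0) := by
      refine (hs.indicator {q | InBlock L t q}).congr fun q => ?_
      simp [Set.indicator_apply]
    rw [bilinearAverage, ← hs.tsum_sub hin]
    refine tsum_congr fun q => ?_
    by_cases h : InBlock L t q <;> simp [h]
  rw [h1]
  have h0 : ‖∑ t ∈ T, ∑' q : ℤ × ℤ,
      (if ¬ InBlock L t q then (a q.1 * b q.2) • ξ (t - q.1) (t - q.2) else 0)‖ ≤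
      √(2 * |κ₁| + |κ₂|) * ∑' q : ℤ × ℤ,
        |a q.1| * |b q.2| * √(T.filter fun t => ¬ InBlock L t q).card := by
    convert hξ.norm_sum_tsum_le ha hb T fun t q => ¬ InBlock L t q
  refine h0.trans ?_
  rw [blockError, mul_assoc, ← tsum_mul_right]
  refine mul_le_mul_of_nonneg_left (Summable.tsum_le_tsum (fun q => ?_) ?_ ?_) (by positivity)
  · rw [mul_assoc (|a q.1| * |b q.2|), ← Real.sqrt_mul (by positivity)]
    refine mul_le_mul_of_nonneg_left (Real.sqrt_le_sqrt ?_) (by positivity)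
    have h3 : ((T.filter fun t => ¬ InBlock L t q).card : ℝ) ≤
        ((K * min L (2 * (q.1.natAbs + q.2.natAbs)) : ℕ) : ℝ) := by
      exact_mod_cast card_filter_not_inBlock_le K L q
    refine h3.trans (le_of_eq ?_)
    have hL' : (0 : ℝ) < L := by exact_mod_cast hL
    push_cast
    rw [mul_comm (K : ℝ) (L : ℝ), ← mul_assoc, min_mul_of_nonneg _ _ hL'.le, one_mul,
      div_mul_cancel₀ _ hL'.ne', mul_comm]
  · refine Summable.of_nonneg_of_le (fun q => by positivity) (fun q => ?_)
      ((Summable.mul_mul_int ha hb).mul_right (√T.card))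
    refine mul_le_mul_of_nonneg_left (Real.sqrt_le_sqrt ?_) (by positivity)
    exact_mod_cast Finset.card_filter_le _ _
  · refine Summable.mul_right _ (Summable.of_nonneg_of_le (fun q => by positivity) (fun q => ?_)
      (Summable.mul_mul_int ha hb))
    refine mul_le_of_le_one_right (by positivity) ?_
    exact Real.sqrt_le_one.2 (min_le_left _ _)

end Approximation

section Independence

variable {Ω : Type*} [MeasurableSpace Ω] {P : Measure Ω} [IsProbabilityMeasure P]

/-- Disjoint blocks of an independent family are independent. -/
lemma iIndepFun_blocks {ι κ η E : Type*} [Countable ι] [Countable κ] [Countable η]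
    [MeasurableSpace E] {e : η → Ω → E} (hind : iIndepFun e P) (hm : ∀ t, AEMeasurable (e t) P)
    {τ : ι → κ → η} (hτ : Function.Injective (Function.uncurry τ)) :
    iIndepFun (fun i ω => fun k => e (τ i k) ω) P := by
  have hprob : ∀ t, IsProbabilityMeasure (P.map (e t)) := fun t =>
    Measure.isProbabilityMeasure_map (hm t)
  have h1 : iIndepFun (fun p : ι × κ => e (τ p.1 p.2)) P := hind.precomp hτ
  have h2 := h1.map_fun_eq_infinitePi_map₀' fun p => hm _
  have h3 : ∀ i, P.map (fun ω k => e (τ i k) ω) =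
      Measure.infinitePi fun k => P.map (e (τ i k)) := fun i =>
    (h1.precomp (g := fun k => (i, k)) fun k k' h => (Prod.mk.inj h).2).map_fun_eq_infinitePi_map₀'
      fun k => hm _
  rw [iIndepFun_iff_map_fun_eq_infinitePi_map₀' fun i => aemeasurable_pi_lambda _ fun k => hm _]
  simp_rw [h3]
  have h4 := Measure.infinitePi_map_curry (fun i k => P.map (e (τ i k)))
  rw [← h4, ← h2, AEMeasurable.map_map_of_aemeasurable]
  · rfl
  · exact (MeasurableEquiv.curry ι κ E).measurable.aemeasurable
  · exact aemeasurable_pi_lambda _ fun p => hm _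

end Independence

section BlockCLT

variable {Ω : Type*} [MeasurableSpace Ω] {H : Type*} [NormedAddCommGroup H] [InnerProductSpace ℝ H]
  [MeasurableSpace H] [BorelSpace H] [CompleteSpace H] [SecondCountableTopology H]
  {P : Measure Ω} [IsProbabilityMeasure P] {e : ℤ → Ω → H}

/-- A representative of `blockSum`: a fixed function of the `j`-th block of the noise. -/
noncomputable def blockVar (P : Measure Ω) (e : ℤ → Ω → H) (a b : ℤ → ℝ) (L j : ℕ) (ω : Ω) : ℝ :=
  ∑ t : Fin L, ∑ l : Fin L, ∑ m : Fin L,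
    (a ((t : ℕ) - (l : ℕ) : ℤ) * b ((t : ℕ) - (m : ℕ) : ℤ)) *
      centredProduct P e ((j * L + (l : ℕ) : ℕ) + 1 : ℤ) ((j * L + (m : ℕ) : ℕ) + 1 : ℤ) ω

namespace IsNoise

lemma coeFn_blockSum (he : IsNoise P e) (a b : ℤ → ℝ) (L j : ℕ) :
    ((blockSum he.productL2 a b L j : Lp ℝ 2 P) : Ω → ℝ) =ᵐ[P] blockVar P e a b L j := by
  have hm : ∀ (s t : ℤ) (c : ℝ), MemLp (fun ω => c * centredProduct P e s t ω) 2 P :=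
    fun s t c => (he.memLp_centredProduct s t).const_mul c
  have hmem : MemLp (blockVar P e a b L j) 2 P :=
    memLp_finsetSum _ fun t _ => memLp_finsetSum _ fun l _ => memLp_finsetSum _ fun m _ => hm _ _ _
  have h : blockSum he.productL2 a b L j = hmem.toLp := by
    have hfun : blockVar P e a b L j = ∑ t : Fin L, ∑ l : Fin L, ∑ m : Fin L, fun ω =>
        (a ((t : ℕ) - (l : ℕ) : ℤ) * b ((t : ℕ) - (m : ℕ) : ℤ)) *
        centredProduct P e ((j * L + (l : ℕ) : ℕ) + 1 : ℤ) ((j * L + (m : ℕ) : ℕ) + 1 : ℤ) ω := by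
      ext ω
      simp [blockVar]
    refine Lp.ext ?_
    refine EventuallyEq.trans ?_ hmem.coeFn_toLp.symm
    rw [hfun, blockSum]
    refine (Lp.coeFn_finsetSum _ _).trans (eventuallyEq_sum fun t _ => ?_)
    refine (Lp.coeFn_finsetSum _ _).trans (eventuallyEq_sum fun l _ => ?_)
    refine (Lp.coeFn_finsetSum _ _).trans (eventuallyEq_sum fun m _ => ?_)
    refine (Lp.coeFn_smul _ _).trans ?_
    filter_upwards [(he.memLp_centredProduct ((j * L + (l : ℕ) : ℕ) + 1 : ℤ)
      ((j * L + (m : ℕ) : ℕ) + 1 : ℤ)).coeFn_toLp] with ω hω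
    rw [Pi.smul_apply, productL2, hω, smul_eq_mul]
  rw [h]
  exact hmem.coeFn_toLp

lemma memLp_blockVar (he : IsNoise P e) (a b : ℤ → ℝ) (L j : ℕ) :
    MemLp (blockVar P e a b L j) 2 P :=
  memLp_finsetSum _ fun _ _ => memLp_finsetSum _ fun _ _ => memLp_finsetSum _ fun _ _ =>
    (he.memLp_centredProduct _ _).const_mul _

lemma integral_blockVar (he : IsNoise P e) (a b : ℤ → ℝ) (L j : ℕ) :
    ∫ ω, blockVar P e a b L j ω ∂P = 0 := by
  have hi : ∀ (s t : ℤ) (c : ℝ), Integrable (fun ω => c * centredProduct P e s t ω) P :=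
    fun s t c => ((he.memLp_centredProduct s t).integrable one_le_two).const_mul c
  simp only [blockVar]
  rw [integral_finsetSum _ fun _ _ => integrable_finsetSum _ fun _ _ =>
    integrable_finsetSum _ fun _ _ => hi _ _ _]
  refine Finset.sum_eq_zero fun t _ => ?_
  rw [integral_finsetSum _ fun l _ => integrable_finsetSum _ fun m _ => hi _ _ _]
  refine Finset.sum_eq_zero fun l _ => ?_
  rw [integral_finsetSum _ fun m _ => hi _ _ _]
  refine Finset.sum_eq_zero fun m _ => ?_
  rw [integral_const_mul, he.integral_centredProduct, mul_zero]

/-- The function of a block of the noise that gives the sum over this block. -/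
noncomputable def blockFun (v : ℝ) (a b : ℤ → ℝ) (L : ℕ) (x : Fin L → H) : ℝ :=
  ∑ t : Fin L, ∑ l : Fin L, ∑ m : Fin L,
    (a ((t : ℕ) - (l : ℕ) : ℤ) * b ((t : ℕ) - (m : ℕ) : ℤ)) *
      ((inner ℝ (x l) (x m) : ℝ) - if l = m then v else 0)

lemma measurable_blockFun (v : ℝ) (a b : ℤ → ℝ) (L : ℕ) :
    Measurable (blockFun (H := H) v a b L) := by
  have : Continuous (blockFun (H := H) v a b L) := by
    unfold blockFun
    fun_prop
  exact this.measurable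

lemma blockVar_eq (P : Measure Ω) (e : ℤ → Ω → H) (a b : ℤ → ℝ) (L j : ℕ) :
    blockVar P e a b L j = fun ω => blockFun (noiseVar P e) a b L
      fun l => e ((j * L + (l : ℕ) : ℕ) + 1 : ℤ) ω := by
  ext ω
  simp only [blockVar, blockFun, centredProduct]
  refine Finset.sum_congr rfl fun t _ => Finset.sum_congr rfl fun l _ =>
    Finset.sum_congr rfl fun m _ => ?_
  congr 3
  simp [Fin.ext_iff]

lemma injective_blockIndex (L : ℕ) :
    Function.Injective (Function.uncurry fun (j : ℕ) (l : Fin L) =>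
      ((j * L + (l : ℕ) : ℕ) + 1 : ℤ)) := by
  rintro ⟨j, l⟩ ⟨j', l'⟩ h
  simp only [Function.uncurry] at h
  have h1 : j * L + (l : ℕ) = j' * L + (l' : ℕ) := by omega
  have hl : (l : ℕ) = l' := by
    have := congrArg (· % L) h1
    simpa [Nat.mul_add_mod', Nat.mod_eq_of_lt l.2, Nat.mod_eq_of_lt l'.2] using this
  have hL : 0 < L := l.pos
  have hj : j = j' := by
    rw [hl] at h1
    exact Nat.eq_of_mul_eq_mul_right hL (by omega)
  ext <;> simp [hj, hl]

lemma iIndepFun_blockVar (he : IsNoise P e) (a b : ℤ → ℝ) (L : ℕ) :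
    iIndepFun (blockVar P e a b L) P := by
  have h := iIndepFun_blocks he.indep he.aemeasurable (injective_blockIndex L)
  have h2 := h.comp (fun _ => blockFun (noiseVar P e) a b L) fun _ => measurable_blockFun _ a b L
  have h3 : blockVar P e a b L = fun j => blockFun (noiseVar P e) a b L ∘
      fun ω (l : Fin L) => e ((j * L + (l : ℕ) : ℕ) + 1 : ℤ) ω := by
    ext1 j
    rw [blockVar_eq]
    rfl
  rw [h3]
  exact h2

lemma identDistrib_blockVar (he : IsNoise P e) (a b : ℤ → ℝ) (L j : ℕ) :
    IdentDistrib (blockVar P e a b L j) (blockVar P e a b L 0) P P := by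
  have hi : ∀ j : ℕ, iIndepFun (fun (l : Fin L) => e ((j * L + (l : ℕ) : ℕ) + 1 : ℤ)) P :=
    fun j => he.indep.precomp (g := fun l : Fin L => ((j * L + (l : ℕ) : ℕ) + 1 : ℤ))
      fun l l' h => Fin.ext (by simpa using h)
  have h := IdentDistrib.pi (X := fun (l : Fin L) => e ((j * L + (l : ℕ) : ℕ) + 1 : ℤ))
    (Y := fun (l : Fin L) => e ((0 * L + (l : ℕ) : ℕ) + 1 : ℤ))
    (fun l => (he.ident _).trans (he.ident _).symm) (hi j) (hi 0)
  rw [blockVar_eq, blockVar_eq]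
  exact h.comp (measurable_blockFun _ a b L)

/-- Sums over blocks are orthogonal and have the same norm. -/
lemma norm_sum_blockSum (he : IsNoise P e) (a b : ℤ → ℝ) (L K : ℕ) :
    ‖∑ j ∈ Finset.range K, blockSum he.productL2 a b L j‖ =
      √K * √Var[blockVar P e a b L 0; P] := by
  have hae : (∑ j ∈ Finset.range K, blockSum he.productL2 a b L j : Lp ℝ 2 P) =ᵐ[P]
      ∑ j ∈ Finset.range K, blockVar P e a b L j :=
    (Lp.coeFn_finsetSum _ _).trans (eventuallyEq_sum fun j _ => he.coeFn_blockSum a b L j)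
  have hvar : Var[∑ j ∈ Finset.range K, blockVar P e a b L j; P] =
      K * Var[blockVar P e a b L 0; P] := by
    rw [IndepFun.variance_sum (fun j _ => he.memLp_blockVar a b L j)
      fun i _ j _ hij => (he.iIndepFun_blockVar a b L).indepFun hij]
    simp [(he.identDistrib_blockVar a b L _).variance_eq]
  have hzero : ∫ ω, (∑ j ∈ Finset.range K, blockVar P e a b L j) ω ∂P = 0 := by
    simp only [Finset.sum_apply]
    rw [integral_finsetSum _ fun j _ => (he.memLp_blockVar a b L j).integrable one_le_two]
    exact Finset.sum_eq_zero fun j _ => he.integral_blockVar a b L j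
  have hsq : ‖∑ j ∈ Finset.range K, blockSum he.productL2 a b L j‖ ^ 2 =
      Var[∑ j ∈ Finset.range K, blockVar P e a b L j; P] := by
    rw [← real_inner_self_eq_norm_sq, L2.inner_def, variance_of_integral_eq_zero ?_ hzero]
    · refine integral_congr_ae ?_
      filter_upwards [hae] with ω hω
      rw [hω]
      simp [sq]
    · exact Finset.aemeasurable_sum _ fun j _ => (he.memLp_blockVar a b L j).aemeasurable
  rw [← Real.sqrt_mul (Nat.cast_nonneg K), ← hvar, ← hsq, Real.sqrt_sq (norm_nonneg _)]

lemma tendsto_charFun_blockSum (he : IsNoise P e) (a b : ℤ → ℝ) (L : ℕ) (u : ℝ) :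
    Tendsto (fun K : ℕ => charFun (P.map ((√(L : ℝ))⁻¹ • (√(K : ℝ))⁻¹ •
        ∑ j ∈ Finset.range K, blockSum he.productL2 a b L j : Lp ℝ 2 P)) u) atTop
      (𝓝 (Complex.exp (-(((√(L : ℝ))⁻¹ * √Var[blockVar P e a b L 0; P]) ^ 2 * u ^ 2 / 2 : ℝ)))) := by
  have h := tendsto_charFun_iid (he.memLp_blockVar a b L 0) (he.integral_blockVar a b L 0)
    (he.iIndepFun_blockVar a b L) (he.identDistrib_blockVar a b L) ((√(L : ℝ))⁻¹ * u)
  rw [mul_pow, Real.sq_sqrt (variance_nonneg _ _)]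
  have hlim : Var[blockVar P e a b L 0; P] * ((√(L : ℝ))⁻¹ * u) ^ 2 / 2 =
      (√(L : ℝ))⁻¹ ^ 2 * Var[blockVar P e a b L 0; P] * u ^ 2 / 2 := by ring
  rw [hlim] at h
  refine h.congr fun K => ?_
  have hae : ((√(L : ℝ))⁻¹ • (√(K : ℝ))⁻¹ •
      ∑ j ∈ Finset.range K, blockSum he.productL2 a b L j : Lp ℝ 2 P) =ᵐ[P]
      fun ω => (√(L : ℝ))⁻¹ * ((√(K : ℝ))⁻¹ * ∑ j ∈ Finset.range K, blockVar P e a b L j ω) := by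
    have h1 : (∑ j ∈ Finset.range K, blockSum he.productL2 a b L j : Lp ℝ 2 P) =ᵐ[P]
        ∑ j ∈ Finset.range K, blockVar P e a b L j :=
      (Lp.coeFn_finsetSum _ _).trans (eventuallyEq_sum fun j _ => he.coeFn_blockSum a b L j)
    filter_upwards [h1, Lp.coeFn_smul ((√(L : ℝ))⁻¹) ((√(K : ℝ))⁻¹ •
      ∑ j ∈ Finset.range K, blockSum he.productL2 a b L j : Lp ℝ 2 P),
      Lp.coeFn_smul ((√(K : ℝ))⁻¹)
      (∑ j ∈ Finset.range K, blockSum he.productL2 a b L j : Lp ℝ 2 P)] with ω h1 h2 h3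
    rw [h2, Pi.smul_apply, h3, Pi.smul_apply, h1]
    simp
  rw [Measure.map_congr hae]
  refine (charFun_map_mul_comp ?_ _ _).symm
  refine AEMeasurable.const_mul (Finset.aemeasurable_fun_sum _ fun j _ => ?_) _
  exact (he.memLp_blockVar a b L j).aemeasurable

/-- The **central limit theorem** for quadratic forms in the noise. -/
theorem tendsto_charFun_bilinearAverage (he : IsNoise P e) {a b : ℤ → ℝ}
    (ha : Summable fun i => |a i|) (hb : Summable fun i => |b i|) (u : ℝ) :
    Tendsto (fun n : ℕ => charFun (P.map ((√(n : ℝ))⁻¹ •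
        ∑ t ∈ Finset.Icc 1 n, bilinearAverage he.productL2 a b (t : ℕ) : Lp ℝ 2 P)) u) atTop
      (𝓝 (Complex.exp (-((∑' r, bilinearAcov (noiseCross P e) (noiseCumulant P e) a b a b r) *
        u ^ 2 / 2 : ℝ)))) := by
  set v := ∑' r, bilinearAcov (noiseCross P e) (noiseCumulant P e) a b a b r with hv
  set Y : ℤ → Lp ℝ 2 P := bilinearAverage he.productL2 a b with hY
  have hξ := he.isProductArray
  have hlim : Tendsto (fun n : ℕ => ‖((√(n : ℝ))⁻¹ • ∑ t ∈ Finset.Icc 1 n, Y (t : ℕ) : Lp ℝ 2 P)‖ ^ 2)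
      atTop (𝓝 v) := by
    refine (hξ.tendsto_inner_sum_div ha hb ha hb).congr fun n => ?_
    rw [norm_smul, mul_pow, real_inner_self_eq_norm_sq, norm_inv, inv_pow, Real.norm_eq_abs, sq_abs,
      Real.sq_sqrt (Nat.cast_nonneg n), inv_mul_eq_div]
  have hv0 : 0 ≤ v := ge_of_tendsto' hlim fun n => sq_nonneg _
  have hnorm : Tendsto (fun n : ℕ => ‖((√(n : ℝ))⁻¹ • ∑ t ∈ Finset.Icc 1 n, Y (t : ℕ) : Lp ℝ 2 P)‖)
      atTop (𝓝 √v) := by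
    refine hlim.sqrt.congr fun n => ?_
    rw [Real.sqrt_sq (norm_nonneg _)]
  have key := tendsto_charFun_of_forall_approx hnorm ?_ u
  · rwa [Real.sq_sqrt hv0] at key
  intro δ hδ
  -- choose the block length
  obtain ⟨L, hL1, hL0⟩ := ((tendsto_order.1 (tendsto_blockError (κ₁ := noiseCross P e)
    (κ₂ := noiseCumulant P e) ha hb)).2 (δ / 3) (by positivity)).and (eventually_gt_atTop 0) |>.exists
  set W : ℕ → Lp ℝ 2 P := fun K => ∑ j ∈ Finset.range K, blockSum he.productL2 a b L j with hW
  set σ := √Var[blockVar P e a b L 0; P] with hσ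
  have hdiv : Tendsto (fun n : ℕ => n / L) atTop atTop :=
    Nat.tendsto_div_const_atTop hL0.ne'
  refine ⟨fun n => (√(L : ℝ))⁻¹ • (√((n / L : ℕ) : ℝ))⁻¹ • W (n / L), (√(L : ℝ))⁻¹ * σ, ?_, ?_, ?_⟩
  · set C := √(2 * |noiseCross P e| + |noiseCumulant P e|) *
      ∑' q : ℤ × ℤ, |a q.1| * |b q.2| with hC
    -- the three contributions to the error
    have hE1 : Tendsto (fun n : ℕ => C * √L / √(n : ℝ)) atTop (𝓝 0) :=
      tendsto_const_nhds.div_atTop (Real.tendsto_sqrt_atTop.comp tendsto_natCast_atTop_atTop)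
    have hE2 : Tendsto (fun n : ℕ => |√((n / L : ℕ) : ℝ) / √(n : ℝ) - (√(L : ℝ))⁻¹| * σ)
        atTop (𝓝 0) := by
      have h1 : Tendsto (fun n : ℕ => ((n / L : ℕ) : ℝ) / n) atTop (𝓝 (L : ℝ)⁻¹) := by
        have h2 := (tendsto_nat_floor_mul_div_atTop (R := ℝ) (a := (L : ℝ)⁻¹)
          (by positivity)).comp tendsto_natCast_atTop_atTop
        refine h2.congr fun n => ?_
        simp only [Function.comp]
        rw [inv_mul_eq_div, Nat.floor_div_natCast, Nat.floor_natCast]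
      have h3 := h1.sqrt
      rw [Real.sqrt_inv] at h3
      have h4 := ((h3.sub_const (√(L : ℝ))⁻¹).abs).mul_const σ
      rw [sub_self, abs_zero, zero_mul] at h4
      refine h4.congr fun n => ?_
      rw [Real.sqrt_div (Nat.cast_nonneg _)]
    filter_upwards [(tendsto_order.1 hE1).2 (δ / 3) (by positivity),
      (tendsto_order.1 hE2).2 (δ / 3) (by positivity), eventually_ge_atTop L] with n h1 h2 hn
    set K := n / L with hK
    have hKpos : 0 < K := Nat.div_pos hn hL0
    have hnpos : (0 : ℝ) < √(n : ℝ) := Real.sqrt_pos.2 (by exact_mod_cast hL0.trans_le hn)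
    have hKL : K * L ≤ n := Nat.div_mul_le_self n L
    -- decomposition of the sum
    have hsplit : ∑ t ∈ Finset.Icc 1 n, Y (t : ℕ) =
        (∑ s ∈ Finset.range (K * L), Y ((s : ℤ) + 1) - W K) +
          ∑ s ∈ Finset.Ico (K * L) n, Y ((s : ℤ) + 1) + W K := by
      rw [sum_Icc_one_eq_sum_range, ← Finset.sum_range_add_sum_Ico _ hKL]
      push_cast
      abel
    have hb1 : ‖∑ s ∈ Finset.range (K * L), Y ((s : ℤ) + 1) - W K‖ ≤ δ / 3 * √(n : ℝ) := by
      refine (hξ.norm_sum_sub_sum_blockSum_le ha hb K hL0).trans ?_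
      refine mul_le_mul hL1.le (Real.sqrt_le_sqrt (by exact_mod_cast hKL)) (by positivity)
        (by positivity)
    have hb2 : ‖∑ s ∈ Finset.Ico (K * L) n, Y ((s : ℤ) + 1)‖ ≤ C * √L := by
      have h3 := hξ.norm_sum_bilinearAverage_le ha hb
        ((Finset.Ico (K * L) n).image fun s : ℕ => (s : ℤ) + 1)
      rw [Finset.sum_image fun x _ y _ h => by simpa using h] at h3
      refine h3.trans (mul_le_mul_of_nonneg_left (Real.sqrt_le_sqrt ?_) (by positivity))
      have h4 : ((Finset.Ico (K * L) n).image fun s : ℕ => (s : ℤ) + 1).card ≤ L := by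
        refine Finset.card_image_le.trans ?_
        rw [Nat.card_Ico]
        have := Nat.mod_lt n hL0
        have : K * L + n % L = n := Nat.div_add_mod' n L
        omega
      exact_mod_cast h4
    have hb3 : ‖(√(n : ℝ))⁻¹ • W K - (√(L : ℝ))⁻¹ • (√(K : ℝ))⁻¹ • W K‖ =
        |√(K : ℝ) / √(n : ℝ) - (√(L : ℝ))⁻¹| * σ := by
      rw [smul_smul, ← sub_smul, norm_smul, hW]
      simp only
      rw [he.norm_sum_blockSum, ← mul_assoc, Real.norm_eq_abs]
      have hKs : (0 : ℝ) < √(K : ℝ) := Real.sqrt_pos.2 (by exact_mod_cast hKpos)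
      rw [← abs_of_pos hKs, ← abs_mul, abs_of_pos hKs, sub_mul, mul_assoc _ _ √(K : ℝ),
        inv_mul_cancel₀ hKs.ne', mul_one, inv_mul_eq_div]
    calc ‖(√(n : ℝ))⁻¹ • ∑ t ∈ Finset.Icc 1 n, Y (t : ℕ) - (√(L : ℝ))⁻¹ • (√(K : ℝ))⁻¹ • W K‖
        = ‖(√(n : ℝ))⁻¹ • (∑ s ∈ Finset.range (K * L), Y ((s : ℤ) + 1) - W K) +
            (√(n : ℝ))⁻¹ • ∑ s ∈ Finset.Ico (K * L) n, Y ((s : ℤ) + 1) +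
            ((√(n : ℝ))⁻¹ • W K - (√(L : ℝ))⁻¹ • (√(K : ℝ))⁻¹ • W K)‖ := by
          rw [hsplit, smul_add, smul_add]
          congr 1
          abel
      _ ≤ (√(n : ℝ))⁻¹ * (δ / 3 * √(n : ℝ)) + (√(n : ℝ))⁻¹ * (C * √L) +
            |√(K : ℝ) / √(n : ℝ) - (√(L : ℝ))⁻¹| * σ := by
          refine (norm_add₃_le).trans (add_le_add (add_le_add ?_ ?_) hb3.le)
          · rw [norm_smul, norm_inv, Real.norm_eq_abs, abs_of_pos hnpos]
            gcongr
          · rw [norm_smul, norm_inv, Real.norm_eq_abs, abs_of_pos hnpos]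
            gcongr
      _ ≤ δ := by
          rw [mul_comm (δ / 3), inv_mul_cancel_left₀ hnpos.ne', inv_mul_eq_div]
          linarith
  · filter_upwards [eventually_ge_atTop L] with n hn
    have hKs : (0 : ℝ) < √((n / L : ℕ) : ℝ) :=
      Real.sqrt_pos.2 (by exact_mod_cast Nat.div_pos hn hL0)
    rw [norm_smul, norm_smul, hW]
    simp only
    rw [he.norm_sum_blockSum, norm_inv, norm_inv, Real.norm_eq_abs, Real.norm_eq_abs,
      abs_of_pos hKs, inv_mul_cancel_left₀ hKs.ne', abs_of_nonneg (Real.sqrt_nonneg _)]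
  · intro u
    exact (he.tendsto_charFun_blockSum a b L u).comp hdiv

end IsNoise

end BlockCLT

/-! ### Linear processes in a Hilbert space -/

instance fact_one_le_four : Fact ((1 : ENNReal) ≤ 4) := ⟨by norm_num⟩

section LinearProcess

variable {Ω : Type*} [MeasurableSpace Ω] {H : Type*} [NormedAddCommGroup H] [InnerProductSpace ℝ H]
  {P : Measure Ω} [IsProbabilityMeasure P]

/-- The pointwise inner product `L⁴ × L⁴ → L²` as a continuous bilinear map. -/
noncomputable def innerLp (P : Measure Ω) (H : Type*) [NormedAddCommGroup H]
    [InnerProductSpace ℝ H] : Lp H 4 P →L[ℝ] Lp H 4 P →L[ℝ] Lp ℝ 2 P :=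
  (innerSL ℝ : H →L[ℝ] H →L[ℝ] ℝ).holderL P 4 4 2

lemma coeFn_innerLp (f g : Lp H 4 P) :
    innerLp P H f g =ᵐ[P] fun ω => (inner ℝ (f ω) (g ω) : ℝ) :=
  (innerSL ℝ : H →L[ℝ] H →L[ℝ] ℝ).coeFn_holder f g

/-- The inclusion of `L⁴` in `L²`. -/
noncomputable def inclLp (P : Measure Ω) [IsProbabilityMeasure P] (H : Type*) [NormedAddCommGroup H]
    [InnerProductSpace ℝ H] : Lp H 4 P →L[ℝ] Lp H 2 P :=
  (ContinuousLinearMap.lsmul ℝ ℝ : ℝ →L[ℝ] H →L[ℝ] H).holderL P 4 4 2 (Lp.const 4 P 1)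

lemma coeFn_inclLp (f : Lp H 4 P) : inclLp P H f =ᵐ[P] f := by
  have h := (ContinuousLinearMap.lsmul ℝ ℝ : ℝ →L[ℝ] H →L[ℝ] H).coeFn_holder (r := 2)
    (Lp.const 4 P (1 : ℝ)) f
  refine EventuallyEq.trans h ?_
  filter_upwards [Lp.coeFn_const (p := 4) (μ := P) (1 : ℝ)] with ω hω
  rw [hω]
  simp

/-- A continuous bilinear map applied to two absolutely convergent series. -/
lemma hasSum_bilin_of_summable {E F G ι κ : Type*} [NormedAddCommGroup E] [NormedSpace ℝ E]
    [NormedAddCommGroup F] [NormedSpace ℝ F] [NormedAddCommGroup G] [NormedSpace ℝ G]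
    [CompleteSpace G] (B : E →L[ℝ] F →L[ℝ] G) {x : ι → E} {y : κ → F} {a : E} {b : F}
    (hx : HasSum x a) (hy : HasSum y b) (hxn : Summable fun i => ‖x i‖)
    (hyn : Summable fun j => ‖y j‖) :
    HasSum (fun q : ι × κ => B (x q.1) (y q.2)) (B a b) := by
  have hs : Summable fun q : ι × κ => B (x q.1) (y q.2) := by
    refine Summable.of_norm_bounded ((hxn.mul_of_nonneg hyn (fun _ => norm_nonneg _)
      fun _ => norm_nonneg _).mul_left ‖B‖) fun q => ?_
    rw [← mul_assoc]
    exact B.le_opNorm₂ _ _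
  have h1 : HasSum (fun i => B (x i) b) (B a b) := by
    have := (B.flip b).hasSum hx
    simpa using this
  have h2 := hs.hasSum.prod_fiberwise fun i => (B (x i)).hasSum hy
  rw [h1.unique h2]
  exact hs.hasSum

variable [MeasurableSpace H] [BorelSpace H] {e : ℤ → Ω → H} {ψ : ℤ → ℝ}

namespace IsNoise

/-- The noise as an element of `L⁴`. -/
noncomputable def noiseLp (he : IsNoise P e) (t : ℤ) : Lp H 4 P := (he.memLp t).toLp

lemma coeFn_noiseLp (he : IsNoise P e) (t : ℤ) : he.noiseLp t =ᵐ[P] e t :=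
  (he.memLp t).coeFn_toLp

/-- The linear process `∑_i ψ_i e_{t-i}`, as an element of `L⁴`. -/
noncomputable def linearLp (he : IsNoise P e) (ψ : ℤ → ℝ) (t : ℤ) : Lp H 4 P :=
  ∑' i : ℤ, ψ i • he.noiseLp (t - i)

lemma norm_noiseLp (he : IsNoise P e) (t : ℤ) : ‖he.noiseLp t‖ = ‖he.noiseLp 0‖ := by
  rw [noiseLp, noiseLp, Lp.norm_toLp, Lp.norm_toLp, (he.ident t).eLpNorm_eq]

lemma summable_norm_smul_noiseLp (he : IsNoise P e) (hψ : Summable fun i => |ψ i|) (t : ℤ) :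
    Summable fun i : ℤ => ‖ψ i • he.noiseLp (t - i)‖ := by
  refine (hψ.mul_right ‖he.noiseLp 0‖).congr fun i => ?_
  rw [norm_smul, Real.norm_eq_abs, he.norm_noiseLp (t - i)]

variable [CompleteSpace H]

lemma hasSum_linearLp (he : IsNoise P e) (hψ : Summable fun i => |ψ i|) (t : ℤ) :
    HasSum (fun i : ℤ => ψ i • he.noiseLp (t - i)) (he.linearLp ψ t) :=
  (he.summable_norm_smul_noiseLp hψ t).of_norm.hasSum

lemma innerLp_noiseLp (he : IsNoise P e) (s t : ℤ) :
    innerLp P H (he.noiseLp s) (he.noiseLp t) =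
      he.productL2 s t + (if s = t then noiseVar P e else 0) • Lp.const 2 P (1 : ℝ) := by
  refine Lp.ext ?_
  filter_upwards [coeFn_innerLp (he.noiseLp s) (he.noiseLp t), he.coeFn_noiseLp s,
    he.coeFn_noiseLp t, (he.memLp_centredProduct s t).coeFn_toLp,
    Lp.coeFn_add (he.productL2 s t) ((if s = t then noiseVar P e else 0) • Lp.const 2 P (1 : ℝ)),
    Lp.coeFn_smul (if s = t then noiseVar P e else 0) (Lp.const 2 P (1 : ℝ)),
    Lp.coeFn_const (p := 2) (μ := P) (1 : ℝ)] with ω h1 h2 h3 h4 h5 h6 h7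
  rw [h1, h5, Pi.add_apply, h6, Pi.smul_apply, h7, productL2, h4, h2, h3]
  simp [centredProduct]

variable [SecondCountableTopology H]

/-- The products of a linear process are, up to their mean, bilinear moving averages of the
products of the noise. -/
lemma innerLp_linearLp (he : IsNoise P e) (hψ : Summable fun i => |ψ i|) (t k : ℤ) :
    innerLp P H (he.linearLp ψ t) (he.linearLp ψ (t + k)) =
      bilinearAverage he.productL2 ψ (fun l => ψ (l + k)) t +
        (noiseVar P e * ∑' i, ψ i * ψ (i + k)) • Lp.const 2 P (1 : ℝ) := by
  have h1 := hasSum_bilin_of_summable (innerLp P H) (he.hasSum_linearLp hψ t)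
    (he.hasSum_linearLp hψ (t + k)) (he.summable_norm_smul_noiseLp hψ t)
    (he.summable_norm_smul_noiseLp hψ (t + k))
  have hψk : Summable fun l => |ψ (l + k)| := summable_abs_shift hψ k
  rw [← ((Equiv.refl ℤ).prodCongr (Equiv.addRight k)).hasSum_iff] at h1
  have h2 := (he.isProductArray.summable hψ hψk t).hasSum
  have h3 : HasSum (fun q : ℤ × ℤ => ψ q.1 * ψ (q.2 + k) * if q.1 = q.2 then noiseVar P e else 0)
      (noiseVar P e * ∑' i, ψ i * ψ (i + k)) := by
    have hinj : Function.Injective fun i : ℤ => (i, i) := fun i j h => (Prod.mk.inj h).1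
    rw [← hinj.hasSum_iff]
    · have hs : Summable fun i => ψ i * ψ (i + k) := (summable_abs_mul hψ hψk).of_abs
      refine (hs.hasSum.mul_left (noiseVar P e)).congr_fun fun i => ?_
      simp [mul_comm]
    · rintro ⟨i, j⟩ hij
      have : i ≠ j := fun h => hij ⟨i, by rw [h]⟩
      simp [this]
  have h4 := h2.add (h3.smul_const (Lp.const 2 P (1 : ℝ)))
  refine h1.unique (h4.congr_fun fun q => ?_)
  simp only [Function.comp, Equiv.prodCongr_apply, Prod.map, Equiv.refl_apply, Equiv.coe_addRight,
    map_smul, smul_apply]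
  rw [show t + k - (q.2 + k) = t - q.2 by ring, he.innerLp_noiseLp, smul_smul, smul_add, smul_smul,
    mul_comm (ψ (q.2 + k))]
  congr 3
  by_cases h : q.1 = q.2 <;> simp [h]

lemma integral_bilinearAverage (he : IsNoise P e) {a b : ℤ → ℝ} (ha : Summable fun i => |a i|)
    (hb : Summable fun i => |b i|) (t : ℤ) :
    ∫ ω, bilinearAverage he.productL2 a b t ω ∂P = 0 := by
  have hI : ∀ f : Lp ℝ 2 P, ∫ ω, f ω ∂P = inner ℝ (Lp.const 2 P (1 : ℝ)) f := fun f => by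
    rw [L2.inner_def]
    refine integral_congr_ae ?_
    filter_upwards [Lp.coeFn_const (p := 2) (μ := P) (1 : ℝ)] with ω hω
    rw [hω]
    simp
  rw [hI]
  have h1 := (innerSL ℝ (Lp.const 2 P (1 : ℝ))).hasSum (he.isProductArray.summable ha hb t).hasSum
  have h2 : ∀ q : ℤ × ℤ, innerSL ℝ (Lp.const 2 P (1 : ℝ))
      ((a q.1 * b q.2) • he.productL2 (t - q.1) (t - q.2)) = 0 := fun q => by
    rw [map_smul, innerSL_apply_apply, ← hI, productL2,
      integral_congr_ae (he.memLp_centredProduct (t - q.1) (t - q.2)).coeFn_toLp,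
      he.integral_centredProduct, smul_zero]
  simp_rw [h2] at h1
  exact h1.unique hasSum_zero

lemma integral_inner_linearLp (he : IsNoise P e) (hψ : Summable fun i => |ψ i|) (t k : ℤ) :
    ∫ ω, (inner ℝ (he.linearLp ψ t ω) (he.linearLp ψ (t + k) ω) : ℝ) ∂P =
      noiseVar P e * ∑' i, ψ i * ψ (i + k) := by
  rw [← integral_congr_ae (coeFn_innerLp _ _), he.innerLp_linearLp hψ]
  have h : (bilinearAverage he.productL2 ψ (fun l => ψ (l + k)) t +
      (noiseVar P e * ∑' i, ψ i * ψ (i + k)) • Lp.const 2 P (1 : ℝ) : Lp ℝ 2 P) =ᵐ[P]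
      fun ω => bilinearAverage he.productL2 ψ (fun l => ψ (l + k)) t ω +
        noiseVar P e * ∑' i, ψ i * ψ (i + k) := by
    filter_upwards [Lp.coeFn_add (bilinearAverage he.productL2 ψ (fun l => ψ (l + k)) t)
        ((noiseVar P e * ∑' i, ψ i * ψ (i + k)) • Lp.const 2 P (1 : ℝ)),
      Lp.coeFn_smul (noiseVar P e * ∑' i, ψ i * ψ (i + k)) (Lp.const 2 P (1 : ℝ)),
      Lp.coeFn_const (p := 2) (μ := P) (1 : ℝ)] with ω h1 h2 h3
    rw [h1, Pi.add_apply, h2, Pi.smul_apply, h3]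
    simp
  rw [integral_congr_ae h, integral_add ((Lp.memLp _).integrable one_le_two) (integrable_const _),
    he.integral_bilinearAverage hψ (summable_abs_shift hψ k)]
  simp

lemma integral_linearLp (he : IsNoise P e) (hψ : Summable fun i => |ψ i|) (t : ℤ) :
    ∫ ω, he.linearLp ψ t ω ∂P = 0 := by
  refine ext_inner_left ℝ fun x => ?_
  rw [inner_zero_right]
  have hint : ∀ f : Lp H 4 P, Integrable f P := fun f => (Lp.memLp f).integrable (by norm_num)
  have hI : ∀ f : Lp H 4 P, (inner ℝ x (∫ ω, f ω ∂P) : ℝ) =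
      inner ℝ (Lp.const 2 P (1 : ℝ)) (innerLp P H (Lp.const 4 P x) f) := fun f => by
    rw [← _root_.integral_inner (hint f), L2.inner_def]
    refine integral_congr_ae ?_
    filter_upwards [Lp.coeFn_const (p := 2) (μ := P) (1 : ℝ), coeFn_innerLp (Lp.const 4 P x) f,
      Lp.coeFn_const (p := 4) (μ := P) x] with ω h1 h2 h3
    rw [h1, h2, h3]
    simp
  rw [hI]
  have h1 := (innerSL ℝ (Lp.const 2 P (1 : ℝ))).hasSum
    ((innerLp P H (Lp.const 4 P x)).hasSum (he.hasSum_linearLp hψ t))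
  have h2 : ∀ i : ℤ, innerSL ℝ (Lp.const 2 P (1 : ℝ))
      (innerLp P H (Lp.const 4 P x) (ψ i • he.noiseLp (t - i))) = 0 := fun i => by
    rw [map_smul, map_smul, innerSL_apply_apply, ← hI, integral_congr_ae (he.coeFn_noiseLp _),
      he.integral_eq_zero, inner_zero_right, smul_zero]
  simp_rw [h2] at h1
  exact h1.unique hasSum_zero

/-- Partial sums of a linear process have a norm of order the square root of the number of
summands. -/
lemma norm_sum_linearLp_le (he : IsNoise P e) (hψ : Summable fun i => |ψ i|) (T : Finset ℤ) :
    ‖∑ t ∈ T, inclLp P H (he.linearLp ψ t)‖ ≤ √(noiseVar P e) * (∑' i, |ψ i|) * √T.card := by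
  have horth : ∀ s t : ℤ, inner ℝ (inclLp P H (he.noiseLp s)) (inclLp P H (he.noiseLp t)) =
      if s = t then noiseVar P e else 0 := fun s t => by
    have h1 : inner ℝ (inclLp P H (he.noiseLp s)) (inclLp P H (he.noiseLp t)) =
        ∫ ω, (inner ℝ (e s ω) (e t ω) : ℝ) ∂P := by
      rw [L2.inner_def]
      refine integral_congr_ae ?_
      filter_upwards [coeFn_inclLp (he.noiseLp s), coeFn_inclLp (he.noiseLp t),
        he.coeFn_noiseLp s, he.coeFn_noiseLp t] with ω h1 h2 h3 h4
      rw [h1, h2, h3, h4]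
    rw [h1]
    split_ifs with h
    · subst h
      simp_rw [real_inner_self_eq_norm_sq]
      exact he.integral_norm_sq s
    · exact he.integral_inner h
  have hnorm : ∀ i : ℤ, ‖∑ t ∈ T, inclLp P H (he.noiseLp (t - i))‖ =
      √(noiseVar P e) * √T.card := fun i => by
    rw [← Real.sqrt_sq (norm_nonneg (∑ t ∈ T, inclLp P H (he.noiseLp (t - i)))),
      ← real_inner_self_eq_norm_sq, sum_inner,
      ← Real.sqrt_mul (show 0 ≤ noiseVar P e from integral_nonneg fun _ => sq_nonneg _)]
    congr 1
    simp_rw [inner_sum, horth, sub_left_inj]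
    simp [mul_comm]
  have h1 : HasSum (fun i : ℤ => ψ i • ∑ t ∈ T, inclLp P H (he.noiseLp (t - i)))
      (∑ t ∈ T, inclLp P H (he.linearLp ψ t)) := by
    have := hasSum_sum fun t (_ : t ∈ T) => (inclLp P H).hasSum (he.hasSum_linearLp hψ t)
    refine this.congr_fun fun i => ?_
    simp [Finset.smul_sum]
  have h2 : HasSum (fun i => √(noiseVar P e) * |ψ i| * √T.card)
      (√(noiseVar P e) * (∑' i, |ψ i|) * √T.card) :=
    (hψ.hasSum.mul_left _).mul_right _
  rw [← h1.tsum_eq]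
  refine tsum_of_norm_bounded h2 fun i => ?_
  rw [norm_smul, hnorm, Real.norm_eq_abs]
  exact le_of_eq (by ring)

/-- A solution of the autoregressive equation whose one-dimensional projections are bounded in
`L²` is the causal linear process. -/
lemma ae_eq_linearLp (he : IsNoise P e) {p : ℕ} {β : Fin p → ℝ} (hβ : AutoregressiveCondition β)
    {v : ℤ → Ω → H} (hv : ∀ t, MemLp (v t) 2 P)
    (hbdd : ∀ x : H, ∃ C : ℝ, ∀ t, ∫ ω, (inner ℝ x (v t ω) : ℝ) ^ 2 ∂P ≤ C)
    (heq : ∀ t, v t =ᵐ[P] fun ω => ∑ j : Fin p, β j • v (t - ((j : ℕ) + 1)) ω + e t ω) (t : ℤ) :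
    v t =ᵐ[P] he.linearLp (psi β) t := by
  have hψ := summable_abs_psi hβ
  suffices h : (fun ω => v t ω - he.linearLp (psi β) t ω) =ᵐ[P] 0 by
    filter_upwards [h] with ω hω
    exact sub_eq_zero.1 hω
  refine ae_eq_zero_of_forall_inner (𝕜 := ℝ) fun x => ?_
  have hx : ∀ t, MemLp (fun ω => (inner ℝ x (v t ω) : ℝ)) 2 P := fun t => (hv t).const_inner x
  obtain ⟨C, hC⟩ := hbdd x
  set X : ℤ → Lp ℝ 2 P := fun t => (hx t).toLp with hX
  set Y : ℤ → Lp ℝ 2 P := fun t => innerLp P H (Lp.const 4 P x) (he.noiseLp t) with hY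
  have hYc : ∀ f : Lp H 4 P, innerLp P H (Lp.const 4 P x) f =ᵐ[P] fun ω => (inner ℝ x (f ω) : ℝ) :=
    fun f => by
      filter_upwards [coeFn_innerLp (Lp.const 4 P x) f, Lp.coeFn_const (p := 4) (μ := P) x]
        with ω h1 h2
      rw [h1, h2]
      simp
  have hXn : ∀ t, ‖X t‖ ≤ √C := fun t => by
    refine Real.le_sqrt_of_sq_le ?_
    rw [← real_inner_self_eq_norm_sq, L2.inner_def]
    refine le_trans (le_of_eq ?_) (hC t)
    refine integral_congr_ae ?_
    filter_upwards [(hx t).coeFn_toLp] with ω hω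
    rw [hX, hω]
    simp [sq]
  have hrec : ∀ t, X t = ∑ j : Fin p, β j • X (t - ((j : ℕ) + 1)) + Y t := fun t => by
    refine Lp.ext ?_
    have h1 : ∀ᵐ ω ∂P, ∀ j : Fin p, (β j • X (t - ((j : ℕ) + 1)) : Lp ℝ 2 P) ω =
        β j * inner ℝ x (v (t - ((j : ℕ) + 1)) ω) := by
      rw [ae_all_iff]
      intro j
      filter_upwards [Lp.coeFn_smul (β j) (X (t - ((j : ℕ) + 1))),
        (hx (t - ((j : ℕ) + 1))).coeFn_toLp] with ω h1 h2
      rw [h1, Pi.smul_apply, hX, h2, smul_eq_mul]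
    filter_upwards [h1, (hx t).coeFn_toLp, heq t, hYc (he.noiseLp t), he.coeFn_noiseLp t,
      Lp.coeFn_add (∑ j : Fin p, β j • X (t - ((j : ℕ) + 1))) (Y t),
      Lp.coeFn_finsetSum Finset.univ fun j : Fin p => β j • X (t - ((j : ℕ) + 1))]
      with ω h1 h2 h3 h4 h5 h6 h7
    rw [h6, Pi.add_apply, h7, Finset.sum_apply, hY, h4, h5, hX, h2, h3, inner_add_right, inner_sum]
    congr 1
    refine Finset.sum_congr rfl fun j _ => ?_
    rw [h1 j, inner_smul_right]
  have h1 := hasSum_psi_smul hβ hXn hrec t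
  have h2 := (innerLp P H (Lp.const 4 P x)).hasSum (he.hasSum_linearLp hψ t)
  have h3 : X t = innerLp P H (Lp.const 4 P x) (he.linearLp (psi β) t) := by
    refine h1.unique (h2.congr_fun fun i => ?_)
    simp [hY]
  filter_upwards [(hx t).coeFn_toLp, hYc (he.linearLp (psi β) t)] with ω h4 h5
  rw [inner_sub_right, ← h4, ← h5, ← h3]
  simp [hX]

end IsNoise

end LinearProcess

/-! ### Sample autocovariances in a Hilbert space -/

section SampleAcov

variable {H : Type*} [NormedAddCommGroup H] [InnerProductSpace ℝ H]

/-- The sample autocovariance about zero, with `n` summands. -/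
noncomputable def sampleAcov (w : ℤ → H) (n k : ℕ) : ℝ :=
  (∑ t ∈ Finset.Icc 1 n, inner ℝ (w (t : ℕ)) (w ((t : ℕ) + k))) / n

/-- The sample autocovariance about the sample mean, with `n - k` summands. -/
noncomputable def centredAcov (w : ℤ → H) (n k : ℕ) : ℝ :=
  (∑ t ∈ Finset.Icc 1 (n - k), inner ℝ
    (w (t : ℕ) - (n : ℝ)⁻¹ • ∑ s ∈ Finset.Icc 1 n, w (s : ℕ))
    (w ((t : ℕ) + k) - (n : ℝ)⁻¹ • ∑ s ∈ Finset.Icc 1 n, w (s : ℕ))) / n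

lemma abs_centredAcov_sub_sampleAcov_le (w : ℤ → H) (n k : ℕ) :
    |centredAcov w n k - sampleAcov w n k| ≤
      (∑ t ∈ Finset.Ioc (n - k) n, ‖w (t : ℕ)‖ * ‖w ((t : ℕ) + k)‖ +
        ‖∑ t ∈ Finset.Icc 1 (n - k), w (t : ℕ)‖ *
          ‖(n : ℝ)⁻¹ • ∑ s ∈ Finset.Icc 1 n, w (s : ℕ)‖ +
        ‖∑ t ∈ Finset.Icc 1 (n - k), w ((t : ℕ) + k)‖ *
          ‖(n : ℝ)⁻¹ • ∑ s ∈ Finset.Icc 1 n, w (s : ℕ)‖ +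
        n * (‖(n : ℝ)⁻¹ • ∑ s ∈ Finset.Icc 1 n, w (s : ℕ)‖ *
          ‖(n : ℝ)⁻¹ • ∑ s ∈ Finset.Icc 1 n, w (s : ℕ)‖)) / n := by
  set m : H := (n : ℝ)⁻¹ • ∑ s ∈ Finset.Icc 1 n, w (s : ℕ) with hm
  have h1 : ∑ t ∈ Finset.Icc 1 (n - k), inner ℝ (w (t : ℕ) - m) (w ((t : ℕ) + k) - m) =
      ∑ t ∈ Finset.Icc 1 (n - k), inner ℝ (w (t : ℕ)) (w ((t : ℕ) + k)) -
        inner ℝ (∑ t ∈ Finset.Icc 1 (n - k), w (t : ℕ)) m -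
        inner ℝ m (∑ t ∈ Finset.Icc 1 (n - k), w ((t : ℕ) + k)) +
        ((n - k : ℕ) : ℝ) * inner ℝ m m := by
    simp only [inner_sub_left, inner_sub_right, Finset.sum_sub_distrib, sum_inner, inner_sum,
      Finset.sum_const, Nat.card_Icc, nsmul_eq_mul]
    simp only [Nat.add_sub_cancel]
    ring
  have h2 : ∑ t ∈ Finset.Icc 1 n, (inner ℝ (w (t : ℕ)) (w ((t : ℕ) + k)) : ℝ) =
      ∑ t ∈ Finset.Icc 1 (n - k), (inner ℝ (w (t : ℕ)) (w ((t : ℕ) + k)) : ℝ) +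
        ∑ t ∈ Finset.Ioc (n - k) n, (inner ℝ (w (t : ℕ)) (w ((t : ℕ) + k)) : ℝ) := by
    rw [← Finset.sum_union]
    · refine Finset.sum_congr ?_ fun _ _ => rfl
      ext t
      simp only [Finset.mem_Icc, Finset.mem_union, Finset.mem_Ioc]
      omega
    · rw [Finset.disjoint_left]
      intro t
      simp only [Finset.mem_Icc, Finset.mem_Ioc]
      omega
  rw [centredAcov, sampleAcov, ← sub_div, abs_div, Nat.abs_cast, h1, h2]
  gcongr
  have b1 : |∑ t ∈ Finset.Ioc (n - k) n, (inner ℝ (w (t : ℕ)) (w ((t : ℕ) + k)) : ℝ)| ≤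
      ∑ t ∈ Finset.Ioc (n - k) n, ‖w (t : ℕ)‖ * ‖w ((t : ℕ) + k)‖ :=
    (Finset.abs_sum_le_sum_abs _ _).trans (Finset.sum_le_sum fun t _ => abs_real_inner_le_norm _ _)
  have b2 := abs_real_inner_le_norm (∑ t ∈ Finset.Icc 1 (n - k), w (t : ℕ)) m
  have b3 := abs_real_inner_le_norm m (∑ t ∈ Finset.Icc 1 (n - k), w ((t : ℕ) + k))
  rw [mul_comm ‖m‖] at b3
  have b4 : ((n - k : ℕ) : ℝ) * inner ℝ m m ≤ n * (‖m‖ * ‖m‖) := by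
    rw [real_inner_self_eq_norm_mul_norm]
    gcongr
    exact Nat.sub_le _ _
  have b5 : 0 ≤ ((n - k : ℕ) : ℝ) * inner ℝ m m :=
    mul_nonneg (Nat.cast_nonneg _) real_inner_self_nonneg
  rw [abs_le] at b1 b2 b3 ⊢
  constructor <;> linarith [b1.1, b1.2, b2.1, b2.2, b3.1, b3.2]

end SampleAcov

section Probability

variable {Ω : Type*} [MeasurableSpace Ω] {H : Type*} [NormedAddCommGroup H] [InnerProductSpace ℝ H]
  {P : Measure Ω} [IsProbabilityMeasure P]

lemma integrable_norm_mul_norm (f g : Lp H 2 P) : Integrable (fun ω => ‖f ω‖ * ‖g ω‖) P :=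
  (Lp.memLp f).norm.integrable_mul (Lp.memLp g).norm

lemma integral_norm_mul_norm_le (f g : Lp H 2 P) : ∫ ω, ‖f ω‖ * ‖g ω‖ ∂P ≤ ‖f‖ * ‖g‖ := by
  have h1 : ∀ f : Lp H 2 P, ‖(Lp.memLp f).norm.toLp‖ = ‖f‖ := fun f => by
    rw [Lp.norm_toLp, Lp.norm_def, eLpNorm_norm]
  rw [← h1 f, ← h1 g]
  refine le_trans (le_of_eq ?_) (real_inner_le_norm _ _)
  rw [L2.inner_def]
  refine integral_congr_ae ?_
  filter_upwards [(Lp.memLp f).norm.coeFn_toLp, (Lp.memLp g).norm.coeFn_toLp] with ω h2 h3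
  rw [h2, h3]
  simp [mul_comm]

lemma tendstoInMeasure_of_integral_abs_le {D : ℕ → Ω → ℝ} {c : ℕ → ℝ}
    (hD : ∀ᶠ n in atTop, Integrable (D n) P) (hle : ∀ᶠ n in atTop, ∫ ω, |D n ω| ∂P ≤ c n)
    (hc : Tendsto c atTop (𝓝 0)) : TendstoInMeasure P D atTop fun _ => 0 := by
  rw [tendstoInMeasure_iff_measureReal_norm]
  intro η hη
  have h0 : Tendsto (fun n => c n / η) atTop (𝓝 0) := by simpa using hc.div_const η
  refine squeeze_zero' (Eventually.of_forall fun _ => measureReal_nonneg) ?_ h0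
  filter_upwards [hD, hle] with n h1 h2
  rw [le_div_iff₀ hη, mul_comm]
  refine le_trans ?_ h2
  have := mul_meas_ge_le_integral_of_nonneg (ae_of_all _ fun ω => abs_nonneg (D n ω)) h1.abs η
  simpa using this

/-- Random variables that vanish off events of small probability converge to zero. -/
lemma tendstoInMeasure_of_eq_zero {N D : ℕ → Ω → ℝ} {c : ℝ} (hc : c ≠ 0)
    (hN : TendstoInMeasure P N atTop fun _ => c) (hD : ∀ n ω, N n ω ≠ 0 → D n ω = 0) :
    TendstoInMeasure P D atTop fun _ => 0 := by
  rw [tendstoInMeasure_iff_norm] at hN ⊢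
  intro η hη
  refine tendsto_of_tendsto_of_tendsto_of_le_of_le tendsto_const_nhds (hN |c| (abs_pos.2 hc))
    (fun _ => zero_le) fun n => measure_mono fun ω hω => ?_
  simp only [Set.mem_ofPred_eq] at hω ⊢
  by_cases h : N n ω = 0
  · simp [h]
  · rw [hD n ω h, sub_self, norm_zero] at hω
    linarith

lemma tendstoInMeasure_const_div {N : ℕ → Ω → ℝ} {c : ℝ} (hc : 0 < c)
    (hN : TendstoInMeasure P N atTop fun _ => c) :
    TendstoInMeasure P (fun n ω => c / N n ω) atTop fun _ => 1 := by
  rw [tendstoInMeasure_iff_norm] at hN ⊢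
  intro η hη
  set δ := min (c / 2) (η * (c / 2)) with hδ
  have hδpos : 0 < δ := by positivity
  refine tendsto_of_tendsto_of_tendsto_of_le_of_le tendsto_const_nhds (hN δ hδpos)
    (fun _ => zero_le) fun n => measure_mono fun ω hω => ?_
  simp only [Set.mem_ofPred_eq, Real.norm_eq_abs] at hω ⊢
  by_contra! h
  have h1 : |N n ω - c| < c / 2 := h.trans_le (min_le_left _ _)
  have h2 : |N n ω - c| < η * (c / 2) := h.trans_le (min_le_right _ _)
  have h3 : c / 2 < N n ω := by
    have := (abs_lt.1 h1).1
    linarith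
  have h4 : 0 < N n ω := by linarith
  rw [div_sub_one h4.ne', abs_div, abs_of_pos h4, le_div_iff₀ h4, abs_sub_comm] at hω
  nlinarith

end Probability

section Asymptotics

variable {Ω : Type*} [MeasurableSpace Ω] {H : Type*} [NormedAddCommGroup H] [InnerProductSpace ℝ H]
  [MeasurableSpace H] [BorelSpace H] [CompleteSpace H] [SecondCountableTopology H]
  {P : Measure Ω} [IsProbabilityMeasure P] {e : ℤ → Ω → H} {ψ : ℤ → ℝ}

/-- The autocovariance `E⟨x_0, x_k⟩` of the linear process with coefficients `ψ`. -/
noncomputable def linearAcov (P : Measure Ω) (e : ℤ → Ω → H) (ψ : ℤ → ℝ) (k : ℕ) : ℝ :=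
  noiseVar P e * ∑' i, ψ i * ψ (i + k)

namespace IsNoise

/-- The normalized error `√n (γ̂_k - γ_k)` of the sample autocovariance, as an element of `L²`. -/
noncomputable def acovError (he : IsNoise P e) (ψ : ℤ → ℝ) (n k : ℕ) : Lp ℝ 2 P :=
  (√(n : ℝ))⁻¹ • ∑ t ∈ Finset.Icc 1 n,
    bilinearAverage he.productL2 ψ (fun l => ψ (l + k)) (t : ℕ)

lemma coeFn_acovError (he : IsNoise P e) (hψ : Summable fun i => |ψ i|) {x : ℤ → Ω → H}
    (hx : ∀ t, x t =ᵐ[P] he.linearLp ψ t) (n k : ℕ) :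
    he.acovError ψ n k =ᵐ[P] fun ω =>
      √(n : ℝ) * (sampleAcov (fun t => x t ω) n k - linearAcov P e ψ k) := by
  have h1 : ∀ᵐ ω ∂P, ∀ t : ℤ, bilinearAverage he.productL2 ψ (fun l => ψ (l + k)) t ω =
      inner ℝ (x t ω) (x (t + k) ω) - linearAcov P e ψ k := by
    rw [ae_all_iff]
    intro t
    have h2 := eq_sub_of_add_eq (he.innerLp_linearLp hψ t k).symm
    rw [h2]
    filter_upwards [hx t, hx (t + k), coeFn_innerLp (he.linearLp ψ t) (he.linearLp ψ (t + k)),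
      Lp.coeFn_sub (innerLp P H (he.linearLp ψ t) (he.linearLp ψ (t + k)))
        ((noiseVar P e * ∑' i, ψ i * ψ (i + k)) • Lp.const 2 P (1 : ℝ)),
      Lp.coeFn_smul (noiseVar P e * ∑' i, ψ i * ψ (i + k)) (Lp.const 2 P (1 : ℝ)),
      Lp.coeFn_const (p := 2) (μ := P) (1 : ℝ)] with ω h3 h4 h5 h6 h7 h8
    rw [h6, Pi.sub_apply, h5, h7, Pi.smul_apply, h8, h3, h4, linearAcov]
    simp
  filter_upwards [h1, Lp.coeFn_smul (√(n : ℝ))⁻¹ (∑ t ∈ Finset.Icc 1 n,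
    bilinearAverage he.productL2 ψ (fun l => ψ (l + k)) ((t : ℕ) : ℤ)),
    Lp.coeFn_finsetSum (Finset.Icc 1 n) fun t : ℕ =>
      bilinearAverage he.productL2 ψ (fun l => ψ (l + k)) ((t : ℕ) : ℤ)] with ω h1 h2 h3
  rw [acovError, h2, Pi.smul_apply, h3, Finset.sum_apply]
  simp_rw [h1]
  rw [Finset.sum_sub_distrib, sampleAcov, smul_eq_mul]
  rcases Nat.eq_zero_or_pos n with rfl | hn
  · simp
  · have hn' : (0 : ℝ) < n := by exact_mod_cast hn
    have hs : (0 : ℝ) < √(n : ℝ) := Real.sqrt_pos.2 hn'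
    have hss : √(n : ℝ) * √(n : ℝ) = n := Real.mul_self_sqrt hn'.le
    simp only [Finset.sum_const, Nat.card_Icc, Nat.add_sub_cancel, nsmul_eq_mul]
    rw [inv_mul_eq_div, div_eq_iff hs.ne', mul_right_comm, hss]
    field_simp

lemma norm_acovError_le (he : IsNoise P e) (hψ : Summable fun i => |ψ i|) (k : ℕ) :
    ∃ C, ∀ n, ‖he.acovError ψ n k‖ ≤ C := by
  refine ⟨√(2 * |noiseCross P e| + |noiseCumulant P e|) *
    ∑' q : ℤ × ℤ, |ψ q.1| * |ψ (q.2 + k)|, fun n => ?_⟩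
  have h := he.isProductArray.norm_sum_bilinearAverage_le hψ (summable_abs_shift hψ k)
    ((Finset.Icc 1 n).image fun t : ℕ => (t : ℤ))
  rw [Finset.sum_image fun x _ y _ h => by simpa using h,
    Finset.card_image_of_injective _ Nat.cast_injective, Nat.card_Icc, Nat.add_sub_cancel] at h
  rw [acovError, norm_smul, norm_inv, Real.norm_eq_abs, abs_of_nonneg (Real.sqrt_nonneg _)]
  rcases Nat.eq_zero_or_pos n with rfl | hn
  · simp only [Nat.cast_zero, Real.sqrt_zero, inv_zero, zero_mul]
    positivity
  · have hs : (0 : ℝ) < √(n : ℝ) := Real.sqrt_pos.2 (by exact_mod_cast hn)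
    rw [inv_mul_le_iff₀ hs, mul_comm √(n : ℝ)]
    exact h

lemma tendsto_inner_acovError (he : IsNoise P e) (hψ : Summable fun i => |ψ i|) (k l : ℕ) :
    Tendsto (fun n => inner ℝ (he.acovError ψ n k) (he.acovError ψ n l)) atTop
      (𝓝 (∑' r, bilinearAcov (noiseCross P e) (noiseCumulant P e)
        ψ (fun i => ψ (i + k)) ψ (fun i => ψ (i + l)) r)) := by
  refine (he.isProductArray.tendsto_inner_sum_div hψ (summable_abs_shift hψ k) hψ
    (summable_abs_shift hψ l)).congr fun n => ?_
  rw [acovError, acovError, real_inner_smul_left, real_inner_smul_right, ← mul_assoc,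
    ← mul_inv, Real.mul_self_sqrt (Nat.cast_nonneg n), inv_mul_eq_div]

lemma sum_smul_acovError (he : IsNoise P e) (hψ : Summable fun i => |ψ i|) {m : ℕ}
    (θ : Fin m → ℝ) (n : ℕ) :
    ∑ k : Fin m, θ k • he.acovError ψ n k = (√(n : ℝ))⁻¹ • ∑ t ∈ Finset.Icc 1 n,
      bilinearAverage he.productL2 ψ (fun l => ∑ k : Fin m, θ k * ψ (l + (k : ℕ))) (t : ℕ) := by
  have h1 : ∀ t : ℤ,
      bilinearAverage he.productL2 ψ (fun l => ∑ k : Fin m, θ k * ψ (l + (k : ℕ))) t =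
      ∑ k : Fin m, θ k • bilinearAverage he.productL2 ψ (fun l => ψ (l + (k : ℕ))) t := fun t => by
    have h2 := hasSum_sum fun k (_ : k ∈ (Finset.univ : Finset (Fin m))) =>
      ((he.isProductArray.summable hψ (summable_abs_shift hψ (k : ℕ)) t).hasSum.const_smul (θ k))
    have h3 := h2.tsum_eq
    rw [bilinearAverage]
    simp only [bilinearAverage]
    rw [← h3]
    refine tsum_congr fun q => ?_
    simp_rw [smul_smul, ← Finset.sum_smul, Finset.mul_sum]
    congr 1
    exact Finset.sum_congr rfl fun k _ => by ring
  simp_rw [h1, acovError]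
  rw [Finset.sum_comm, Finset.smul_sum]
  simp_rw [Finset.smul_sum]
  refine Finset.sum_congr rfl fun k _ => Finset.sum_congr rfl fun t _ => ?_
  rw [smul_comm]

/-- Joint asymptotic normality of the sample autocovariances about zero, for one linear
combination. -/
lemma tendsto_charFun_sum_acovError (he : IsNoise P e) (hψ : Summable fun i => |ψ i|) {m : ℕ}
    (θ : Fin m → ℝ) (u : ℝ) :
    Tendsto (fun n => charFun (P.map (∑ k : Fin m, θ k • he.acovError ψ n k : Lp ℝ 2 P)) u) atTop
      (𝓝 (Complex.exp (-((∑ k : Fin m, ∑ l : Fin m, θ k * θ l *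
        ∑' r, bilinearAcov (noiseCross P e) (noiseCumulant P e)
          ψ (fun i => ψ (i + (k : ℕ))) ψ (fun i => ψ (i + (l : ℕ))) r) * u ^ 2 / 2 : ℝ)))) := by
  have hb : Summable fun l => |∑ k : Fin m, θ k * ψ (l + (k : ℕ))| := by
    refine Summable.of_nonneg_of_le (fun _ => abs_nonneg _)
      (fun l => Finset.abs_sum_le_sum_abs _ _) (summable_sum fun k _ => ?_)
    simp_rw [abs_mul]
    exact (summable_abs_shift hψ (k : ℕ)).mul_left _
  have h1 := he.tendsto_charFun_bilinearAverage hψ hb u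
  simp_rw [← he.sum_smul_acovError hψ θ] at h1
  -- identify the asymptotic variance, as both sides are limits of the same variances
  have h2 := he.isProductArray.tendsto_inner_sum_div hψ hb hψ hb
  have h3 : Tendsto (fun n => inner ℝ (∑ k : Fin m, θ k • he.acovError ψ n k)
      (∑ l : Fin m, θ l • he.acovError ψ n l)) atTop
      (𝓝 (∑ k : Fin m, ∑ l : Fin m, θ k * θ l *
        ∑' r, bilinearAcov (noiseCross P e) (noiseCumulant P e)
          ψ (fun i => ψ (i + (k : ℕ))) ψ (fun i => ψ (i + (l : ℕ))) r)) := by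
    simp_rw [sum_inner, inner_sum, real_inner_smul_left, real_inner_smul_right, ← mul_assoc]
    exact tendsto_finsetSum _ fun k _ => tendsto_finsetSum _ fun l _ =>
      (he.tendsto_inner_acovError hψ k l).const_mul _
  have h4 := tendsto_nhds_unique h2 (h3.congr fun n => by
    rw [he.sum_smul_acovError hψ, real_inner_smul_left, real_inner_smul_right, ← mul_assoc,
      ← mul_inv, Real.mul_self_sqrt (Nat.cast_nonneg n), inv_mul_eq_div])
  rwa [h4] at h1

/-- Replacing the mean by the sample mean and dropping the last summands changes the sample
autocovariance by `O(n⁻¹)` in `L¹`. -/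
lemma integral_abs_centredAcov_sub_sampleAcov_le (he : IsNoise P e)
    (hψ : Summable fun i => |ψ i|) {x : ℤ → Ω → H} (hx : ∀ t, x t =ᵐ[P] he.linearLp ψ t) (k : ℕ) :
    ∃ C, ∀ n, 0 < n →
      Integrable (fun ω => centredAcov (fun t => x t ω) n k - sampleAcov (fun t => x t ω) n k) P ∧
      ∫ ω, |centredAcov (fun t => x t ω) n k - sampleAcov (fun t => x t ω) n k| ∂P ≤ C / n := by
  set C₀ := √(noiseVar P e) * (∑' i, |ψ i|) with hC₀
  have hC₀nn : 0 ≤ C₀ := mul_nonneg (Real.sqrt_nonneg _) (tsum_nonneg fun _ => abs_nonneg _)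
  set X : ℤ → Lp H 2 P := fun t => inclLp P H (he.linearLp ψ t) with hX
  have hXx : ∀ᵐ ω ∂P, ∀ t, X t ω = x t ω := by
    rw [ae_all_iff]
    intro t
    filter_upwards [hx t, coeFn_inclLp (he.linearLp ψ t)] with ω h1 h2
    rw [hX, h2, h1]
  have hXn : ∀ t, ‖X t‖ ≤ C₀ := fun t => by
    have := he.norm_sum_linearLp_le hψ {t}
    simpa using this
  have hsum : ∀ (m k : ℕ), ‖∑ t ∈ Finset.Icc 1 m, X ((t : ℕ) + k)‖ ≤ C₀ * √(m : ℝ) := fun m k => by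
    have h := he.norm_sum_linearLp_le hψ ((Finset.Icc 1 m).image fun t : ℕ => (t : ℤ) + k)
    have hinj : Function.Injective fun t : ℕ => (t : ℤ) + k := fun a b h => by simpa using h
    rw [Finset.sum_image fun a _ b _ h => hinj h, Finset.card_image_of_injective _ hinj,
      Nat.card_Icc, Nat.add_sub_cancel] at h
    exact h
  refine ⟨k * C₀ ^ 2 + 3 * C₀ ^ 2, fun n hn => ?_⟩
  have hn' : (0 : ℝ) < n := by exact_mod_cast hn
  set M : Lp H 2 P := (n : ℝ)⁻¹ • ∑ s ∈ Finset.Icc 1 n, X (s : ℕ) with hM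
  set S₁ : Lp H 2 P := ∑ t ∈ Finset.Icc 1 (n - k), X (t : ℕ) with hS₁
  set S₂ : Lp H 2 P := ∑ t ∈ Finset.Icc 1 (n - k), X ((t : ℕ) + k) with hS₂
  have hSn : ∀ j : ℕ, ‖∑ t ∈ Finset.Icc 1 (n - k), X ((t : ℕ) + j)‖ ≤ C₀ * √(n : ℝ) := fun j => by
    refine (hsum (n - k) j).trans (mul_le_mul_of_nonneg_left (Real.sqrt_le_sqrt ?_) hC₀nn)
    exact_mod_cast Nat.sub_le _ _
  have hS₁n : ‖S₁‖ ≤ C₀ * √(n : ℝ) := by simpa using hSn 0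
  have hS₂n : ‖S₂‖ ≤ C₀ * √(n : ℝ) := hSn k
  have hss : √(n : ℝ) * √(n : ℝ) = n := Real.mul_self_sqrt hn'.le
  have hMn : ‖M‖ * √(n : ℝ) ≤ C₀ := by
    have h1 := hsum n 0
    simp only [Nat.cast_zero, add_zero] at h1
    rw [hM, norm_smul, norm_inv, Real.norm_eq_abs, Nat.abs_cast, mul_assoc, inv_mul_le_iff₀ hn']
    have := mul_le_mul_of_nonneg_right h1 (Real.sqrt_nonneg (n : ℝ))
    rw [mul_assoc, hss] at this
    linarith
  set B : Ω → ℝ := fun ω => (∑ t ∈ Finset.Ioc (n - k) n, ‖X (t : ℕ) ω‖ * ‖X ((t : ℕ) + k) ω‖ +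
    ‖S₁ ω‖ * ‖M ω‖ + ‖S₂ ω‖ * ‖M ω‖ + n * (‖M ω‖ * ‖M ω‖)) / n with hB
  have i1 : Integrable (fun ω => ∑ t ∈ Finset.Ioc (n - k) n,
      ‖X (t : ℕ) ω‖ * ‖X ((t : ℕ) + k) ω‖) P :=
    integrable_finsetSum _ fun _ _ => integrable_norm_mul_norm _ _
  have i2 := integrable_norm_mul_norm S₁ M
  have i3 := integrable_norm_mul_norm S₂ M
  have i4 : Integrable (fun ω => (n : ℝ) * (‖M ω‖ * ‖M ω‖)) P :=
    (integrable_norm_mul_norm M M).const_mul _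
  have hBint : Integrable B P := (((i1.add i2).add i3).add i4).div_const _
  have hle : ∀ᵐ ω ∂P,
      |centredAcov (fun t => x t ω) n k - sampleAcov (fun t => x t ω) n k| ≤ B ω := by
    filter_upwards [hXx, Lp.coeFn_finsetSum (Finset.Icc 1 (n - k)) fun t : ℕ => X (t : ℕ),
      Lp.coeFn_finsetSum (Finset.Icc 1 (n - k)) fun t : ℕ => X ((t : ℕ) + k),
      Lp.coeFn_smul (n : ℝ)⁻¹ (∑ s ∈ Finset.Icc 1 n, X ((s : ℕ) : ℤ)),
      Lp.coeFn_finsetSum (Finset.Icc 1 n) fun t : ℕ => X (t : ℕ)] with ω h1 h2 h3 h4 h5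
    refine (abs_centredAcov_sub_sampleAcov_le _ n k).trans (le_of_eq ?_)
    rw [hB]
    simp only
    rw [hS₁, hS₂, hM, h2, h3, h4, Pi.smul_apply, h5]
    simp only [Finset.sum_apply, h1]
  have hmeas : AEStronglyMeasurable
      (fun ω => centredAcov (fun t => x t ω) n k - sampleAcov (fun t => x t ω) n k) P := by
    have hm : ∀ t, AEStronglyMeasurable (x t) P := fun t =>
      (Lp.aestronglyMeasurable (he.linearLp ψ t)).congr (hx t).symm
    have hmean : AEStronglyMeasurable (fun ω => (n : ℝ)⁻¹ • ∑ s ∈ Finset.Icc 1 n, x (s : ℕ) ω) P :=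
      (Finset.aestronglyMeasurable_fun_sum _ fun s _ => hm _).const_smul _
    unfold centredAcov sampleAcov
    refine AEStronglyMeasurable.sub ?_ ?_
    · simp_rw [div_eq_mul_inv]
      exact (Finset.aestronglyMeasurable_fun_sum _ fun t _ =>
        ((hm _).sub hmean).inner ((hm _).sub hmean)).mul_const _
    · simp_rw [div_eq_mul_inv]
      exact (Finset.aestronglyMeasurable_fun_sum _ fun t _ => (hm _).inner (hm _)).mul_const _
  have hint := hBint.mono' hmeas hle
  refine ⟨hint, (integral_mono_ae hint.abs hBint hle).trans ?_⟩
  have hBval : ∫ ω, B ω ∂P = (∑ t ∈ Finset.Ioc (n - k) n,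
      ∫ ω, ‖X (t : ℕ) ω‖ * ‖X ((t : ℕ) + k) ω‖ ∂P + ∫ ω, ‖S₁ ω‖ * ‖M ω‖ ∂P +
      ∫ ω, ‖S₂ ω‖ * ‖M ω‖ ∂P + n * ∫ ω, ‖M ω‖ * ‖M ω‖ ∂P) / n := by
    have i12 : Integrable (fun ω => ∑ t ∈ Finset.Ioc (n - k) n,
      ‖X (t : ℕ) ω‖ * ‖X ((t : ℕ) + k) ω‖ + ‖S₁ ω‖ * ‖M ω‖) P := i1.add i2
    have i123 : Integrable (fun ω => ∑ t ∈ Finset.Ioc (n - k) n,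
      ‖X (t : ℕ) ω‖ * ‖X ((t : ℕ) + k) ω‖ + ‖S₁ ω‖ * ‖M ω‖ + ‖S₂ ω‖ * ‖M ω‖) P := i12.add i3
    rw [hB, integral_div, integral_add i123 i4, integral_add i12 i3,
      integral_add i1 i2, integral_const_mul,
      integral_finsetSum _ fun _ _ => integrable_norm_mul_norm _ _]
  rw [hBval]
  have b1 : ∑ t ∈ Finset.Ioc (n - k) n, ∫ ω, ‖X (t : ℕ) ω‖ * ‖X ((t : ℕ) + k) ω‖ ∂P ≤
      k * C₀ ^ 2 := by
    have h1 : ∀ t ∈ Finset.Ioc (n - k) n,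
        ∫ ω, ‖X (t : ℕ) ω‖ * ‖X ((t : ℕ) + k) ω‖ ∂P ≤ C₀ ^ 2 := fun t _ => by
      refine (integral_norm_mul_norm_le _ _).trans ?_
      rw [sq]
      exact mul_le_mul (hXn _) (hXn _) (norm_nonneg _) hC₀nn
    refine (Finset.sum_le_card_nsmul _ _ _ h1).trans ?_
    rw [nsmul_eq_mul, Nat.card_Ioc]
    have : n - (n - k) ≤ k := by omega
    gcongr
  have bS : ∀ S : Lp H 2 P, ‖S‖ ≤ C₀ * √(n : ℝ) → ∫ ω, ‖S ω‖ * ‖M ω‖ ∂P ≤ C₀ ^ 2 := fun S hS => by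
    refine (integral_norm_mul_norm_le _ _).trans ?_
    have := mul_le_mul_of_nonneg_right hS (norm_nonneg M)
    have := mul_le_mul_of_nonneg_left hMn hC₀nn
    nlinarith
  have b4 : n * ∫ ω, ‖M ω‖ * ‖M ω‖ ∂P ≤ C₀ ^ 2 := by
    have h1 := mul_le_mul_of_nonneg_left (integral_norm_mul_norm_le M M) hn'.le
    have h2 := mul_le_mul hMn hMn (by positivity) hC₀nn
    have h3 : ‖M‖ * √(n : ℝ) * (‖M‖ * √(n : ℝ)) = n * (‖M‖ * ‖M‖) := by
      rw [mul_mul_mul_comm, hss, mul_comm]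
    rw [h3] at h2
    rw [sq]
    exact h1.trans h2
  exact div_le_div_of_nonneg_right (by linarith [bS S₁ hS₁n, bS S₂ hS₂n]) hn'.le

end IsNoise

end Asymptotics

/-! ### Asymptotic normality of the sample autocorrelations -/

section Delta

variable {Ω : Type*} [MeasurableSpace Ω] {H : Type*} [NormedAddCommGroup H] [InnerProductSpace ℝ H]
  [MeasurableSpace H] [BorelSpace H] [CompleteSpace H] [SecondCountableTopology H]
  {P : Measure Ω} [IsProbabilityMeasure P] {e : ℤ → Ω → H} {ψ : ℤ → ℝ}

/-- The asymptotic covariance matrix of the sample autocovariances at lags `0, …, h`. -/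
noncomputable def acovMatrix (κ₁ κ₂ : ℝ) (ψ : ℤ → ℝ) (h : ℕ) :
    Matrix (Fin (h + 1)) (Fin (h + 1)) ℝ :=
  Matrix.of fun i j => ∑' r, bilinearAcov κ₁ κ₂ ψ (fun l => ψ (l + (i : ℕ))) ψ
    (fun l => ψ (l + (j : ℕ))) r

/-- The Jacobian of `(γ_0, …, γ_h) ↦ (γ_1 / γ_0, …, γ_h / γ_0)`. -/
noncomputable def acorrJacobian (γ : ℕ → ℝ) (h : ℕ) : Matrix (Fin h) (Fin (h + 1)) ℝ :=
  (γ 0)⁻¹ • Matrix.of fun (i : Fin h) (j : Fin (h + 1)) =>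
    if j = 0 then -(γ ((i : ℕ) + 1) / γ 0) else if j = i.succ then 1 else 0

lemma sum_acorrJacobian_mul (γ : ℕ → ℝ) {h : ℕ} (i : Fin h) (z : Fin (h + 1) → ℝ) :
    ∑ j, acorrJacobian γ h i j * z j = (γ 0)⁻¹ * (z i.succ - γ ((i : ℕ) + 1) / γ 0 * z 0) := by
  rw [Fin.sum_univ_succ]
  simp only [acorrJacobian, Matrix.smul_apply, Matrix.of_apply, if_true, smul_eq_mul,
    Fin.succ_ne_zero, if_false, Fin.succ_inj]
  simp_rw [mul_assoc, ite_mul, one_mul, zero_mul, mul_ite, mul_zero]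
  rw [Finset.sum_ite_eq' Finset.univ i]
  simp
  ring

lemma dotProduct_acovMatrix_mulVec (κ₁ κ₂ : ℝ) (ψ : ℤ → ℝ) {h : ℕ} (θ : Fin (h + 1) → ℝ) :
    θ ⬝ᵥ (acovMatrix κ₁ κ₂ ψ h).mulVec θ = ∑ k : Fin (h + 1), ∑ l : Fin (h + 1), θ k * θ l *
      ∑' r, bilinearAcov κ₁ κ₂ ψ (fun i => ψ (i + (k : ℕ))) ψ (fun i => ψ (i + (l : ℕ))) r := by
  simp only [dotProduct, Matrix.mulVec, acovMatrix, Matrix.of_apply, Finset.mul_sum]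
  exact Finset.sum_congr rfl fun k _ => Finset.sum_congr rfl fun l _ => by ring

namespace IsNoise

lemma posSemidef_acovMatrix (he : IsNoise P e) (hψ : Summable fun i => |ψ i|) (h : ℕ) :
    (acovMatrix (noiseCross P e) (noiseCumulant P e) ψ h).PosSemidef := by
  refine .of_dotProduct_mulVec_nonneg ?_ fun θ => ?_
  · ext i j
    rw [Matrix.conjTranspose_apply, star_trivial]
    simp only [acovMatrix, Matrix.of_apply]
    refine tendsto_nhds_unique (he.tendsto_inner_acovError hψ (j : ℕ) (i : ℕ)) ?_
    simp_rw [real_inner_comm (he.acovError ψ _ (i : ℕ))]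
    exact he.tendsto_inner_acovError hψ (i : ℕ) (j : ℕ)
  · rw [star_trivial, dotProduct_acovMatrix_mulVec]
    have h1 : Tendsto (fun n => inner ℝ (∑ k : Fin (h + 1), θ k • he.acovError ψ n k)
        (∑ l : Fin (h + 1), θ l • he.acovError ψ n l)) atTop
        (𝓝 (∑ k : Fin (h + 1), ∑ l : Fin (h + 1), θ k * θ l *
          ∑' r, bilinearAcov (noiseCross P e) (noiseCumulant P e)
            ψ (fun i => ψ (i + (k : ℕ))) ψ (fun i => ψ (i + (l : ℕ))) r)) := by
      simp_rw [sum_inner, inner_sum, real_inner_smul_left, real_inner_smul_right, ← mul_assoc]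
      exact tendsto_finsetSum _ fun k _ => tendsto_finsetSum _ fun l _ =>
        (he.tendsto_inner_acovError hψ k l).const_mul _
    exact ge_of_tendsto' h1 fun n => real_inner_self_nonneg

variable {x : ℤ → Ω → H}

lemma aemeasurable_centredAcov (he : IsNoise P e) (hx : ∀ t, x t =ᵐ[P] he.linearLp ψ t)
    (n k : ℕ) : AEMeasurable (fun ω => centredAcov (fun t => x t ω) n k) P := by
  have hm : ∀ t, AEStronglyMeasurable (x t) P := fun t =>
    (Lp.aestronglyMeasurable (he.linearLp ψ t)).congr (hx t).symm
  have hmean : AEStronglyMeasurable (fun ω => (n : ℝ)⁻¹ • ∑ s ∈ Finset.Icc 1 n, x (s : ℕ) ω) P :=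
    (Finset.aestronglyMeasurable_fun_sum _ fun s _ => hm _).const_smul _
  unfold centredAcov
  simp_rw [div_eq_mul_inv]
  exact ((Finset.aestronglyMeasurable_fun_sum _ fun t _ =>
    ((hm _).sub hmean).inner ((hm _).sub hmean)).mul_const _).aemeasurable

lemma tendstoInMeasure_sqrt_mul_sub (he : IsNoise P e) (hψ : Summable fun i => |ψ i|)
    (hx : ∀ t, x t =ᵐ[P] he.linearLp ψ t) {m : ℕ} (θ : Fin m → ℝ) :
    TendstoInMeasure P (fun (n : ℕ) ω => ∑ k : Fin m, θ k * (√(n : ℝ) *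
      (centredAcov (fun t => x t ω) n k - sampleAcov (fun t => x t ω) n k))) atTop fun _ => 0 := by
  choose C hC using fun k : ℕ => he.integral_abs_centredAcov_sub_sampleAcov_le hψ hx k
  have hint : ∀ n : ℕ, 0 < n → ∀ k : Fin m, Integrable (fun ω => θ k * (√(n : ℝ) *
      (centredAcov (fun t => x t ω) n k - sampleAcov (fun t => x t ω) n k))) P := fun n hn k =>
    ((hC k n hn).1.const_mul _).const_mul _
  refine tendstoInMeasure_of_integral_abs_le (c := fun n : ℕ => (∑ k : Fin m, |θ k| * C k) / √(n : ℝ))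
    ?_ ?_ (tendsto_const_nhds.div_atTop (Real.tendsto_sqrt_atTop.comp tendsto_natCast_atTop_atTop))
  · filter_upwards [eventually_gt_atTop 0] with n hn
    exact integrable_finsetSum _ fun k _ => hint n hn k
  · filter_upwards [eventually_gt_atTop 0] with n hn
    have hn' : (0 : ℝ) < n := by exact_mod_cast hn
    have hs : (0 : ℝ) < √(n : ℝ) := Real.sqrt_pos.2 hn'
    have hss : √(n : ℝ) * √(n : ℝ) = n := Real.mul_self_sqrt hn'.le
    calc ∫ ω, |∑ k : Fin m, θ k * (√(n : ℝ) *
          (centredAcov (fun t => x t ω) n k - sampleAcov (fun t => x t ω) n k))| ∂P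
        ≤ ∫ ω, ∑ k : Fin m, |θ k * (√(n : ℝ) *
          (centredAcov (fun t => x t ω) n k - sampleAcov (fun t => x t ω) n k))| ∂P :=
          integral_mono (integrable_finsetSum _ fun k _ => hint n hn k).abs
            (integrable_finsetSum _ fun k _ => (hint n hn k).abs)
            fun ω => Finset.abs_sum_le_sum_abs _ _
      _ = ∑ k : Fin m, |θ k| * (√(n : ℝ) * ∫ ω,
          |centredAcov (fun t => x t ω) n k - sampleAcov (fun t => x t ω) n k| ∂P) := by
          rw [integral_finsetSum _ fun k _ => (hint n hn k).abs]
          refine Finset.sum_congr rfl fun k _ => ?_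
          simp_rw [abs_mul, abs_of_pos hs]
          rw [integral_const_mul, integral_const_mul]
      _ ≤ ∑ k : Fin m, |θ k| * (√(n : ℝ) * (C k / n)) := by
          gcongr with k _
          exact (hC k n hn).2
      _ = (∑ k : Fin m, |θ k| * C k) / √(n : ℝ) := by
          rw [Finset.sum_div]
          refine Finset.sum_congr rfl fun k _ => ?_
          rw [eq_div_iff hs.ne', mul_assoc, mul_right_comm, hss, mul_div_cancel₀ _ hn'.ne']

lemma tendstoInMeasure_centredAcov (he : IsNoise P e) (hψ : Summable fun i => |ψ i|)
    (hx : ∀ t, x t =ᵐ[P] he.linearLp ψ t) (k : ℕ) :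
    TendstoInMeasure P (fun n ω => centredAcov (fun t => x t ω) n k) atTop
      fun _ => linearAcov P e ψ k := by
  obtain ⟨C, hC⟩ := he.integral_abs_centredAcov_sub_sampleAcov_le hψ hx k
  obtain ⟨B, hB⟩ := he.norm_acovError_le hψ k
  suffices h : TendstoInMeasure P (fun n ω => centredAcov (fun t => x t ω) n k -
      linearAcov P e ψ k) atTop fun _ => 0 by
    rw [tendstoInMeasure_iff_norm] at h ⊢
    simpa using h
  have hsplit : ∀ n, 0 < n → (fun ω => centredAcov (fun t => x t ω) n k - linearAcov P e ψ k) =ᵐ[P]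
      fun ω => (centredAcov (fun t => x t ω) n k - sampleAcov (fun t => x t ω) n k) +
        (√(n : ℝ))⁻¹ * he.acovError ψ n k ω := fun n hn => by
    have hs : (0 : ℝ) < √(n : ℝ) := Real.sqrt_pos.2 (by exact_mod_cast hn)
    filter_upwards [he.coeFn_acovError hψ hx n k] with ω hω
    rw [hω, inv_mul_cancel_left₀ hs.ne']
    ring
  have hi2 : ∀ n : ℕ, Integrable (fun ω => (√(n : ℝ))⁻¹ * he.acovError ψ n k ω) P := fun n =>
    ((Lp.memLp (he.acovError ψ n k)).integrable one_le_two).const_mul _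
  have hint : ∀ n : ℕ, 0 < n → Integrable (fun ω => (centredAcov (fun t => x t ω) n k -
      sampleAcov (fun t => x t ω) n k) + (√(n : ℝ))⁻¹ * he.acovError ψ n k ω) P := fun n hn =>
    (hC n hn).1.add (hi2 n)
  refine tendstoInMeasure_of_integral_abs_le (c := fun n : ℕ => C / n + B / √(n : ℝ)) ?_ ?_ ?_
  · filter_upwards [eventually_gt_atTop 0] with n hn
    exact (hint n hn).congr (hsplit n hn).symm
  · filter_upwards [eventually_gt_atTop 0] with n hn
    have habs : (fun ω => |centredAcov (fun t => x t ω) n k - linearAcov P e ψ k|) =ᵐ[P]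
        fun ω => |(centredAcov (fun t => x t ω) n k - sampleAcov (fun t => x t ω) n k) +
          (√(n : ℝ))⁻¹ * he.acovError ψ n k ω| := by
      filter_upwards [hsplit n hn] with ω hω
      rw [hω]
    rw [integral_congr_ae habs]
    calc ∫ ω, |(centredAcov (fun t => x t ω) n k - sampleAcov (fun t => x t ω) n k) +
          (√(n : ℝ))⁻¹ * he.acovError ψ n k ω| ∂P
        ≤ ∫ ω, (|centredAcov (fun t => x t ω) n k - sampleAcov (fun t => x t ω) n k| +
          |(√(n : ℝ))⁻¹ * he.acovError ψ n k ω|) ∂P :=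
          integral_mono (hint n hn).abs ((hC n hn).1.abs.add (hi2 n).abs) fun ω => abs_add_le _ _
      _ = ∫ ω, |centredAcov (fun t => x t ω) n k - sampleAcov (fun t => x t ω) n k| ∂P +
          (√(n : ℝ))⁻¹ * ∫ ω, |he.acovError ψ n k ω| ∂P := by
          rw [integral_add (hC n hn).1.abs (hi2 n).abs]
          simp_rw [abs_mul, abs_of_nonneg (inv_nonneg.2 (Real.sqrt_nonneg (n : ℝ)))]
          rw [integral_const_mul]
      _ ≤ C / n + (√(n : ℝ))⁻¹ * B := by
          gcongr
          · exact (hC n hn).2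
          · exact (integral_abs_le_norm _).trans (hB n)
      _ = C / n + B / √(n : ℝ) := by rw [inv_mul_eq_div]
  · have h1 : Tendsto (fun n : ℕ => C / (n : ℝ)) atTop (𝓝 0) :=
      tendsto_const_div_atTop_nhds_zero_nat C
    have h2 : Tendsto (fun n : ℕ => B / √(n : ℝ)) atTop (𝓝 0) :=
      tendsto_const_nhds.div_atTop (Real.tendsto_sqrt_atTop.comp tendsto_natCast_atTop_atTop)
    simpa using h1.add h2

/-- The **delta method** for one linear combination of the sample autocorrelations. -/
lemma tendstoInDistribution_sum_acorr (he : IsNoise P e) (hψ : Summable fun i => |ψ i|)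
    (hx : ∀ t, x t =ᵐ[P] he.linearLp ψ t) (hpos : 0 < linearAcov P e ψ 0) {h : ℕ}
    (c : Fin h → ℝ) :
    TendstoInDistribution (fun (n : ℕ) ω => ∑ i : Fin h, c i * (√(n : ℝ) *
        (centredAcov (fun t => x t ω) n ((i : ℕ) + 1) / centredAcov (fun t => x t ω) n 0 -
          linearAcov P e ψ ((i : ℕ) + 1) / linearAcov P e ψ 0))) atTop id (fun _ => P)
      (gaussianReal 0 (Matrix.vecMul c (acorrJacobian (linearAcov P e ψ) h) ⬝ᵥ
        (acovMatrix (noiseCross P e) (noiseCumulant P e) ψ h).mulVec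
          (Matrix.vecMul c (acorrJacobian (linearAcov P e ψ) h))).toNNReal) := by
  set γ := linearAcov P e ψ with hγ
  set θ := Matrix.vecMul c (acorrJacobian γ h) with hθ
  set v := θ ⬝ᵥ (acovMatrix (noiseCross P e) (noiseCumulant P e) ψ h).mulVec θ with hv
  have hv0 : 0 ≤ v := by
    have := (he.posSemidef_acovMatrix hψ h).dotProduct_mulVec_nonneg θ
    rwa [star_trivial] at this
  have hcm : ∀ n k, AEMeasurable (fun ω => centredAcov (fun t => x t ω) n k) P :=
    he.aemeasurable_centredAcov hx
  -- the linear term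
  have hG : TendstoInDistribution (fun (n : ℕ) ω =>
      (∑ k : Fin (h + 1), θ k • he.acovError ψ n k : Lp ℝ 2 P) ω) atTop id (fun _ => P)
      (gaussianReal 0 v.toNNReal) := by
    refine ⟨fun n => (Lp.aestronglyMeasurable _).aemeasurable, aemeasurable_id, ?_⟩
    refine ProbabilityMeasure.tendsto_iff_tendsto_charFun.2 fun u => ?_
    have h1 := he.tendsto_charFun_sum_acovError hψ θ u
    rw [← dotProduct_acovMatrix_mulVec, ← hv] at h1
    simp only [ProbabilityMeasure.coe_mk, Measure.map_id, charFun_gaussianReal]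
    convert h1 using 2
    rw [Real.coe_toNNReal _ hv0]
    push_cast
    congr 1
    ring
  -- the effect of the sample mean
  have hU : TendstoInDistribution (fun (n : ℕ) ω => ∑ k : Fin (h + 1), θ k * (√(n : ℝ) *
      (centredAcov (fun t => x t ω) n k - γ k))) atTop id (fun _ => P)
      (gaussianReal 0 v.toNNReal) := by
    refine tendstoInDistribution_of_tendstoInMeasure_sub _ _ hG ?_ fun n => ?_
    · refine (he.tendstoInMeasure_sqrt_mul_sub hψ hx θ).congr (fun n => ?_) EventuallyEq.rfl
      have h1 : ∀ᵐ ω ∂P, ∀ k : Fin (h + 1), (θ k • he.acovError ψ n k : Lp ℝ 2 P) ω =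
          θ k * (√(n : ℝ) * (sampleAcov (fun t => x t ω) n k - γ k)) := by
        rw [ae_all_iff]
        intro k
        filter_upwards [he.coeFn_acovError hψ hx n k, Lp.coeFn_smul (θ k) (he.acovError ψ n k)]
          with ω h2 h3
        rw [h3, Pi.smul_apply, h2, smul_eq_mul]
      filter_upwards [h1, Lp.coeFn_finsetSum Finset.univ
        fun k : Fin (h + 1) => θ k • he.acovError ψ n k] with ω h2 h3
      rw [Pi.sub_apply, Pi.sub_apply, h3, Finset.sum_apply, ← Finset.sum_sub_distrib]
      refine Finset.sum_congr rfl fun k _ => ?_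
      rw [h2 k]
      ring
    · exact Finset.aemeasurable_fun_sum _ fun k _ =>
        (((hcm n k).sub_const _).const_mul _).const_mul _
  -- Slutsky: multiplication by `γ_0 / γ̂_0`
  have hN := he.tendstoInMeasure_centredAcov hψ hx 0
  have hS : TendstoInDistribution (fun (n : ℕ) ω => (∑ k : Fin (h + 1), θ k * (√(n : ℝ) *
      (centredAcov (fun t => x t ω) n k - γ k))) * (γ 0 / centredAcov (fun t => x t ω) n 0))
      atTop id (fun _ => P) (gaussianReal 0 v.toNNReal) := by
    have := hU.continuous_comp_prodMk_of_tendstoInMeasure_const (g := fun z : ℝ × ℝ => z.1 * z.2)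
      (by fun_prop) (tendstoInMeasure_const_div hpos hN) fun n => (hcm n 0).const_div _
    simp only [mul_one] at this
    exact this
  refine tendstoInDistribution_of_tendstoInMeasure_sub _ _ hS ?_ fun n => ?_
  · refine tendstoInMeasure_of_eq_zero hpos.ne' hN fun n ω hω => ?_
    have h1 : ∑ k : Fin (h + 1), θ k * (√(n : ℝ) * (centredAcov (fun t => x t ω) n k - γ k)) =
        ∑ i : Fin h, c i * ((γ 0)⁻¹ * (√(n : ℝ) * (centredAcov (fun t => x t ω) n ((i : ℕ) + 1) -
          γ ((i : ℕ) + 1)) - γ ((i : ℕ) + 1) / γ 0 *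
          (√(n : ℝ) * (centredAcov (fun t => x t ω) n 0 - γ 0)))) := by
      have h2 : ∀ i : Fin h, _ := fun i => sum_acorrJacobian_mul γ i
        fun k => √(n : ℝ) * (centredAcov (fun t => x t ω) n k - γ k)
      simp only [Fin.val_succ, Fin.val_zero] at h2
      simp_rw [← h2, hθ, Matrix.vecMul, dotProduct, Finset.sum_mul, Finset.mul_sum]
      rw [Finset.sum_comm]
      exact Finset.sum_congr rfl fun i _ => Finset.sum_congr rfl fun k _ => by ring
    rw [Pi.sub_apply, Pi.sub_apply, h1, Finset.sum_mul, ← Finset.sum_sub_distrib]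
    refine Finset.sum_eq_zero fun i _ => ?_
    have hγ0 : γ 0 ≠ 0 := hpos.ne'
    field_simp
    ring
  · exact Finset.aemeasurable_fun_sum _ fun i _ =>
      ((((hcm n _).div (hcm n 0)).sub_const _).const_mul _).const_mul _

/-- Asymptotic normality of the vector of sample autocorrelations of a linear process in a Hilbert
space. -/
theorem tendstoInDistribution_acorr (he : IsNoise P e) (hψ : Summable fun i => |ψ i|)
    (hx : ∀ t, x t =ᵐ[P] he.linearLp ψ t) (hpos : 0 < linearAcov P e ψ 0) (h : ℕ)
    {R : ℕ → Ω → EuclideanSpace ℝ (Fin h)}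
    (hR : ∀ n, R n =ᵐ[P] fun ω => WithLp.toLp 2 fun i : Fin h => √(n : ℝ) *
        (centredAcov (fun t => x t ω) n ((i : ℕ) + 1) / centredAcov (fun t => x t ω) n 0 -
          linearAcov P e ψ ((i : ℕ) + 1) / linearAcov P e ψ 0)) :
    TendstoInDistribution R atTop (id : EuclideanSpace ℝ (Fin h) → EuclideanSpace ℝ (Fin h))
      (fun _ => P) (multivariateGaussian 0 (acorrJacobian (linearAcov P e ψ) h *
        acovMatrix (noiseCross P e) (noiseCumulant P e) ψ h *
        (acorrJacobian (linearAcov P e ψ) h).transpose)) := by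
  set J := acorrJacobian (linearAcov P e ψ) h with hJ
  set A := acovMatrix (noiseCross P e) (noiseCumulant P e) ψ h with hA
  have hAp : A.PosSemidef := he.posSemidef_acovMatrix hψ h
  have hS : (J * A * J.transpose).PosSemidef := by
    have := hAp.mul_mul_conjTranspose_same J
    rwa [Matrix.conjTranspose_eq_transpose_of_trivial] at this
  have hcm : ∀ n k, AEMeasurable (fun ω => centredAcov (fun t => x t ω) n k) P :=
    he.aemeasurable_centredAcov hx
  have hRm : ∀ n, AEMeasurable (R n) P := fun n => by
    refine AEMeasurable.congr ?_ (hR n).symm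
    refine (WithLp.measurable_toLp 2 (Fin h → ℝ)).comp_aemeasurable ?_
    exact aemeasurable_pi_lambda _ fun i => (((hcm n _).div (hcm n 0)).sub_const _).const_mul _
  refine ⟨hRm, aemeasurable_id, ?_⟩
  refine ProbabilityMeasure.tendsto_iff_tendsto_charFun.2 fun c => ?_
  have h1 := he.tendstoInDistribution_sum_acorr hψ hx hpos fun i => c i
  have h2 := ProbabilityMeasure.tendsto_iff_tendsto_charFun.1 h1.tendsto 1
  simp only [ProbabilityMeasure.coe_mk, Measure.map_id] at h2 ⊢
  rw [charFun_multivariateGaussian hS]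
  rw [charFun_gaussianReal, ← hJ, ← hA] at h2
  convert h2 using 1
  · ext n
    rw [charFun_apply, charFun_apply_real, integral_map (hRm n) (by fun_prop),
      integral_map (h1.forall_aemeasurable n) (by fun_prop)]
    refine integral_congr_ae ?_
    filter_upwards [hR n] with ω hω
    rw [hω, PiLp.inner_apply]
    simp
  · have hv : (c : Fin h → ℝ) ⬝ᵥ (J * A * J.transpose).mulVec c =
        Matrix.vecMul c J ⬝ᵥ A.mulVec (Matrix.vecMul c J) := by
      rw [← Matrix.mulVec_mulVec, ← Matrix.mulVec_mulVec, Matrix.mulVec_transpose,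
        Matrix.dotProduct_mulVec]
    have hv0 : 0 ≤ Matrix.vecMul c J ⬝ᵥ A.mulVec (Matrix.vecMul c J) := by
      have := hAp.dotProduct_mulVec_nonneg (Matrix.vecMul c J)
      rwa [star_trivial] at this
    rw [hv, Real.coe_toNNReal _ hv0]
    simp

end IsNoise

end Delta

/-! ### Processes as random elements of `L²` -/

section RandomElement

lemma eLpNorm_natCast_pow {α E : Type*} [MeasurableSpace α] [NormedAddCommGroup E]
    (f : α → E) (ν : Measure α) {n : ℕ} (hn : n ≠ 0) :
    eLpNorm f n ν ^ n = ∫⁻ x, ‖f x‖ₑ ^ n ∂ν := by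
  have h := eLpNorm_nnreal_pow_eq_lintegral (f := f) (μ := ν) (p := (n : NNReal))
    (by exact_mod_cast hn)
  simpa using h

lemma eLpNorm_two_sq {α E : Type*} [MeasurableSpace α] [NormedAddCommGroup E]
    (f : α → E) (ν : Measure α) : eLpNorm f 2 ν ^ 2 = ∫⁻ x, ‖f x‖ₑ ^ 2 ∂ν :=
  eLpNorm_natCast_pow f ν two_ne_zero

lemma memLp_two_iff {α E : Type*} [MeasurableSpace α] [NormedAddCommGroup E]
    {f : α → E} {ν : Measure α} (hf : AEStronglyMeasurable f ν) :
    MemLp f 2 ν ↔ ∫⁻ x, ‖f x‖ₑ ^ 2 ∂ν < ⊤ := by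
  rw [← eLpNorm_two_sq, ENNReal.pow_lt_top_iff, MemLp]
  simp [hf]

variable {Ω : Type*} [MeasurableSpace Ω] {P : Measure Ω} [IsProbabilityMeasure P]
  {μ : Measure ℝ} [IsProbabilityMeasure μ] {X Y : Ω → ℝ → ℝ}

lemma enorm_toL2 {g : ℝ → ℝ} (hg : MemLp g 2 μ) : ‖toL2 μ g‖ₑ = eLpNorm g 2 μ := by
  rw [toL2_of_memLp hg, Lp.enorm_toLp]

/-- A process that is a square integrable random element of `L²(μ)` is square integrable on the
product space. -/
lemma memLp_uncurry (hX : Measurable (Function.uncurry X)) (hXm : ∀ᵐ ω ∂P, MemLp (X ω) 2 μ)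
    (hX2 : MemLp (fun ω => toL2 μ (X ω)) 2 P) : MemLp (Function.uncurry X) 2 (P.prod μ) := by
  rw [memLp_two_iff hX.aestronglyMeasurable,
    lintegral_prod _ (by fun_prop : Measurable fun z => ‖Function.uncurry X z‖ₑ ^ 2).aemeasurable]
  have h1 := (memLp_two_iff hX2.1).1 hX2
  refine lt_of_le_of_lt (le_of_eq (lintegral_congr_ae ?_)) h1
  filter_upwards [hXm] with ω hω
  rw [enorm_toL2 hω, eLpNorm_two_sq]
  rfl

lemma ae_memLp_section (hX2 : MemLp (Function.uncurry X) 2 (P.prod μ))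
    (hX : Measurable (Function.uncurry X)) : ∀ᵐ u ∂μ, MemLp (fun ω => X ω u) 2 P := by
  have hm : Measurable fun z => ‖Function.uncurry X z‖ₑ ^ 2 := by fun_prop
  have h1 := (memLp_two_iff hX2.1).1 hX2
  rw [lintegral_prod_symm' _ hm] at h1
  filter_upwards [ae_lt_top hm.lintegral_prod_left' h1.ne] with u hu
  exact (memLp_two_iff (by fun_prop)).2 hu

lemma integrable_uncurry_mul (hX : MemLp (Function.uncurry X) 2 (P.prod μ))
    (hY : MemLp (Function.uncurry Y) 2 (P.prod μ)) :
    Integrable (Function.uncurry fun ω u => X ω u * Y ω u) (P.prod μ) :=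
  hX.integrable_mul hY

lemma integral_inner_toL2 (hX : MemLp (Function.uncurry X) 2 (P.prod μ))
    (hY : MemLp (Function.uncurry Y) 2 (P.prod μ)) (hXm : ∀ᵐ ω ∂P, MemLp (X ω) 2 μ)
    (hYm : ∀ᵐ ω ∂P, MemLp (Y ω) 2 μ) :
    ∫ ω, (inner ℝ (toL2 μ (X ω)) (toL2 μ (Y ω)) : ℝ) ∂P = ∫ u, ∫ ω, X ω u * Y ω u ∂P ∂μ := by
  rw [← integral_integral_swap (integrable_uncurry_mul hX hY)]
  refine integral_congr_ae ?_
  filter_upwards [hXm, hYm] with ω h1 h2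
  exact inner_toL2 h1 h2

/-- The Bochner mean of a random element of `L²(μ)` is its pointwise mean. -/
lemma coeFn_integral_toL2 (hX : MemLp (Function.uncurry X) 2 (P.prod μ))
    (hXm : ∀ᵐ ω ∂P, MemLp (X ω) 2 μ) (hX1 : Integrable (fun ω => toL2 μ (X ω)) P) :
    (∫ ω, toL2 μ (X ω) ∂P : Lp ℝ 2 μ) =ᵐ[μ] fun u => ∫ ω, X ω u ∂P := by
  have hint : Integrable (Function.uncurry X) (P.prod μ) := hX.integrable one_le_two
  refine Integrable.ae_eq_of_forall_setIntegral_eq _ _ ((Lp.memLp _).integrable one_le_two)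
    hint.integral_prod_right fun s hs hμs => ?_
  rw [← L2.inner_indicatorConstLp_one (𝕜 := ℝ) hs hμs.ne, ← integral_inner hX1]
  have h1 : Integrable (Function.uncurry X) (P.prod (μ.restrict s)) := by
    have h2 : P.prod (μ.restrict s) = (P.prod μ).restrict (Set.univ ×ˢ s) := by
      rw [← Measure.prod_restrict, Measure.restrict_univ]
    rw [h2]
    exact hint.restrict
  have h3 := integral_integral_swap (f := X) h1
  rw [← h3]
  refine integral_congr_ae ?_
  filter_upwards [hXm] with ω hω
  rw [L2.inner_indicatorConstLp_one (𝕜 := ℝ) hs hμs.ne]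
  exact setIntegral_congr_ae hs ((coeFn_toL2 hω).mono fun u hu _ => hu)

end RandomElement

section FourthOrder

variable {Ω : Type*} [MeasurableSpace Ω] {P : Measure Ω} [IsProbabilityMeasure P]
  {μ : Measure ℝ} [IsProbabilityMeasure μ] {X : Ω → ℝ → ℝ}

/-- The norm of `L²(μ)` is at most that of `L⁴(μ)`, so that the fourth moment condition gives a
random element with finite fourth moment. -/
lemma memLp_four_toL2 (hX : Measurable (Function.uncurry X)) (hXm : ∀ᵐ ω ∂P, MemLp (X ω) 2 μ)
    (hXs : AEStronglyMeasurable (fun ω => toL2 μ (X ω)) P)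
    (h4 : ∫⁻ u, ∫⁻ ω, ENNReal.ofReal (X ω u ^ 4) ∂P ∂μ < ⊤) :
    MemLp (fun ω => toL2 μ (X ω)) 4 P := by
  refine ⟨hXs, ?_⟩
  have hm : Measurable (Function.uncurry fun u ω => ENNReal.ofReal (X ω u ^ 4)) :=
    ENNReal.measurable_ofReal.comp ((hX.comp measurable_swap).pow_const 4)
  rw [lintegral_lintegral_swap hm.aemeasurable] at h4
  refine ((ENNReal.pow_lt_top_iff (n := 4)).1 ?_).resolve_right four_ne_zero
  have h5 : eLpNorm (fun ω => toL2 μ (X ω)) 4 P ^ 4 = ∫⁻ ω, ‖toL2 μ (X ω)‖ₑ ^ 4 ∂P :=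
    eLpNorm_natCast_pow _ P four_ne_zero
  rw [h5]
  refine lt_of_le_of_lt (lintegral_mono_ae ?_) h4
  filter_upwards [hXm] with ω hω
  rw [enorm_toL2 hω]
  have h6 : eLpNorm (X ω) 4 μ ^ 4 = ∫⁻ u, ‖X ω u‖ₑ ^ 4 ∂μ :=
    eLpNorm_natCast_pow _ μ four_ne_zero
  have h7 : ∫⁻ u, ENNReal.ofReal (X ω u ^ 4) ∂μ = ∫⁻ u, ‖X ω u‖ₑ ^ 4 ∂μ := by
    refine lintegral_congr fun u => ?_
    rw [← enorm_pow, Real.enorm_of_nonneg (by positivity)]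
  rw [h7, ← h6]
  gcongr
  exact eLpNorm_le_eLpNorm_of_exponent_le (by norm_num) hω.1

/-- The covariance kernel `E[X(u) X(v)]` of a centred process. -/
noncomputable def momentKernel (P : Measure Ω) (X : Ω → ℝ → ℝ) (u v : ℝ) : ℝ :=
  ∫ ω, X ω u * X ω v ∂P

lemma integrable_sq_mul_sq (hX : MemLp (Function.uncurry X) 2 (P.prod μ))
    (hXm : Measurable (Function.uncurry X)) :
    Integrable (fun z : (Ω × Ω) × (ℝ × ℝ) => X z.1.1 z.2.1 ^ 2 * X z.1.2 z.2.2 ^ 2)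
      ((P.prod P).prod (μ.prod μ)) := by
  have m1 : Measurable fun z : (Ω × Ω) × (ℝ × ℝ) => X z.1.1 z.2.1 :=
    hXm.comp ((measurable_fst.comp measurable_fst).prodMk (measurable_fst.comp measurable_snd))
  have m2 : Measurable fun z : (Ω × Ω) × (ℝ × ℝ) => X z.1.2 z.2.2 :=
    hXm.comp ((measurable_snd.comp measurable_fst).prodMk (measurable_snd.comp measurable_snd))
  have ms : ∀ ω, Measurable (X ω) := fun ω => hXm.of_uncurry_left
  refine ⟨((m1.pow_const 2).mul (m2.pow_const 2)).aestronglyMeasurable, ?_⟩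
  have hA : Measurable fun ω => ∫⁻ u, ‖X ω u‖ₑ ^ 2 ∂μ :=
    (by fun_prop : Measurable fun z => ‖Function.uncurry X z‖ₑ ^ 2).lintegral_prod_right'
  have h1 : ∫⁻ ω, ∫⁻ u, ‖X ω u‖ₑ ^ 2 ∂μ ∂P < ⊤ := by
    have := (memLp_two_iff hX.1).1 hX
    rwa [lintegral_prod _
      (by fun_prop : Measurable fun z => ‖Function.uncurry X z‖ₑ ^ 2).aemeasurable] at this
  rw [HasFiniteIntegral]
  simp_rw [enorm_mul, enorm_pow]
  rw [lintegral_prod _ (by fun_prop)]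
  have h2 : ∀ w : Ω × Ω, ∫⁻ z : ℝ × ℝ, ‖X w.1 z.1‖ₑ ^ 2 * ‖X w.2 z.2‖ₑ ^ 2 ∂μ.prod μ =
      (∫⁻ u, ‖X w.1 u‖ₑ ^ 2 ∂μ) * ∫⁻ u, ‖X w.2 u‖ₑ ^ 2 ∂μ := fun w => by
    have ma := (ms w.1).enorm.pow_const 2
    have mb := (ms w.2).enorm.pow_const 2
    exact lintegral_prod_mul (f := fun u => ‖X w.1 u‖ₑ ^ 2) (g := fun u => ‖X w.2 u‖ₑ ^ 2)
      ma.aemeasurable mb.aemeasurable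
  simp_rw [h2]
  rw [lintegral_prod_mul hA.aemeasurable hA.aemeasurable]
  exact ENNReal.mul_lt_top h1 h1

/-- The product of two independent copies of `X ⊗ X` is integrable, by the inequality of
arithmetic and geometric means. -/
lemma integrable_mul_mul_mul (hX : MemLp (Function.uncurry X) 2 (P.prod μ))
    (hXm : Measurable (Function.uncurry X)) :
    Integrable (Function.uncurry fun (w : Ω × Ω) (z : ℝ × ℝ) =>
      (X w.1 z.1 * X w.1 z.2) * (X w.2 z.1 * X w.2 z.2)) ((P.prod P).prod (μ.prod μ)) := by
  have m11 : Measurable fun z : (Ω × Ω) × (ℝ × ℝ) => X z.1.1 z.2.1 :=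
    hXm.comp ((measurable_fst.comp measurable_fst).prodMk (measurable_fst.comp measurable_snd))
  have m22 : Measurable fun z : (Ω × Ω) × (ℝ × ℝ) => X z.1.2 z.2.2 :=
    hXm.comp ((measurable_snd.comp measurable_fst).prodMk (measurable_snd.comp measurable_snd))
  have m12 : Measurable fun z : (Ω × Ω) × (ℝ × ℝ) => X z.1.1 z.2.2 :=
    hXm.comp ((measurable_fst.comp measurable_fst).prodMk (measurable_snd.comp measurable_snd))
  have m21 : Measurable fun z : (Ω × Ω) × (ℝ × ℝ) => X z.1.2 z.2.1 :=
    hXm.comp ((measurable_snd.comp measurable_fst).prodMk (measurable_fst.comp measurable_snd))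
  have h1 := integrable_sq_mul_sq hX hXm
  have h2 : Integrable (fun z : (Ω × Ω) × (ℝ × ℝ) => X z.1.2 z.2.1 ^ 2 * X z.1.1 z.2.2 ^ 2)
      ((P.prod P).prod (μ.prod μ)) :=
    ((Measure.measurePreserving_swap (μ := P) (ν := P)).prod
      (MeasurePreserving.id (μ.prod μ))).integrable_comp_of_integrable h1
  refine (h1.add h2).mono' ((m11.mul m12).mul (m21.mul m22)).aestronglyMeasurable
    (ae_of_all _ fun z => ?_)
  simp only [Function.uncurry, Pi.add_apply, Real.norm_eq_abs]
  rw [abs_le]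
  constructor <;>
    nlinarith [sq_nonneg (X z.1.1 z.2.1 * X z.1.2 z.2.2 + X z.1.2 z.2.1 * X z.1.1 z.2.2),
      sq_nonneg (X z.1.1 z.2.1 * X z.1.2 z.2.2 - X z.1.2 z.2.1 * X z.1.1 z.2.2),
      sq_nonneg (X z.1.1 z.2.1 * X z.1.2 z.2.2), sq_nonneg (X z.1.2 z.2.1 * X z.1.1 z.2.2)]

lemma integrable_momentKernel_sq (hX : MemLp (Function.uncurry X) 2 (P.prod μ))
    (hXm : Measurable (Function.uncurry X)) :
    Integrable (fun z : ℝ × ℝ => momentKernel P X z.1 z.2 ^ 2) (μ.prod μ) := by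
  have h := (integrable_mul_mul_mul hX hXm).integral_prod_right
  refine h.congr (ae_of_all _ fun z => ?_)
  simp only [Function.uncurry]
  rw [integral_prod_mul (fun ω => X ω z.1 * X ω z.2) (fun ω => X ω z.1 * X ω z.2), ← sq]
  rfl

/-- The squared Hilbert–Schmidt norm of the covariance operator, written with two independent
copies. -/
lemma integral_momentKernel_sq (hX : MemLp (Function.uncurry X) 2 (P.prod μ))
    (hXm : Measurable (Function.uncurry X)) (hXs : ∀ᵐ ω ∂P, MemLp (X ω) 2 μ) :
    ∫ z : ℝ × ℝ, momentKernel P X z.1 z.2 ^ 2 ∂μ.prod μ =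
      ∫ w : Ω × Ω, (inner ℝ (toL2 μ (X w.1)) (toL2 μ (X w.2)) : ℝ) ^ 2 ∂P.prod P := by
  have h := integral_integral_swap (integrable_mul_mul_mul hX hXm)
  have h1 : ∀ z : ℝ × ℝ, ∫ w : Ω × Ω, (X w.1 z.1 * X w.1 z.2) * (X w.2 z.1 * X w.2 z.2) ∂P.prod P =
      momentKernel P X z.1 z.2 ^ 2 := fun z => by
    rw [integral_prod_mul (fun ω => X ω z.1 * X ω z.2) (fun ω => X ω z.1 * X ω z.2), ← sq]
    rfl
  simp_rw [h1] at h
  rw [← h]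
  refine integral_congr_ae ?_
  have hae1 : ∀ᵐ w ∂P.prod P, MemLp (X w.1) 2 μ :=
    Measure.quasiMeasurePreserving_fst.ae hXs
  have hae2 : ∀ᵐ w ∂P.prod P, MemLp (X w.2) 2 μ :=
    Measure.quasiMeasurePreserving_snd.ae hXs
  filter_upwards [hae1, hae2] with w hw1 hw2
  have h2 : ∀ z : ℝ × ℝ, (X w.1 z.1 * X w.1 z.2) * (X w.2 z.1 * X w.2 z.2) =
      (X w.1 z.1 * X w.2 z.1) * (X w.1 z.2 * X w.2 z.2) := fun z => by ring
  simp_rw [h2]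
  rw [integral_prod_mul (fun u => X w.1 u * X w.2 u) (fun u => X w.1 u * X w.2 u), ← sq,
    inner_toL2 hw1 hw2]

lemma integrable_uncurry_sq_mul_sq (hXm : Measurable (Function.uncurry X))
    (hXs : ∀ᵐ ω ∂P, MemLp (X ω) 2 μ) (hX4 : MemLp (fun ω => toL2 μ (X ω)) 4 P) :
    Integrable (Function.uncurry fun (ω : Ω) (z : ℝ × ℝ) => X ω z.1 ^ 2 * X ω z.2 ^ 2)
      (P.prod (μ.prod μ)) := by
  have m1 : Measurable fun z : Ω × (ℝ × ℝ) => X z.1 z.2.1 :=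
    hXm.comp (measurable_fst.prodMk (measurable_fst.comp measurable_snd))
  have m2 : Measurable fun z : Ω × (ℝ × ℝ) => X z.1 z.2.2 :=
    hXm.comp (measurable_fst.prodMk (measurable_snd.comp measurable_snd))
  have ms : ∀ ω, Measurable (X ω) := fun ω => hXm.of_uncurry_left
  refine ⟨((m1.pow_const 2).mul (m2.pow_const 2)).aestronglyMeasurable, ?_⟩
  rw [HasFiniteIntegral]
  simp only [Function.uncurry]
  simp_rw [enorm_mul, enorm_pow]
  rw [lintegral_prod _ (by fun_prop)]
  have h5 : eLpNorm (fun ω => toL2 μ (X ω)) 4 P ^ 4 = ∫⁻ ω, ‖toL2 μ (X ω)‖ₑ ^ 4 ∂P :=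
    eLpNorm_natCast_pow _ P four_ne_zero
  have h6 : ∫⁻ ω, ‖toL2 μ (X ω)‖ₑ ^ 4 ∂P < ⊤ := by
    rw [← h5]
    exact ENNReal.pow_lt_top hX4.2
  refine lt_of_le_of_lt (le_of_eq (lintegral_congr_ae ?_)) h6
  filter_upwards [hXs] with ω hω
  have ma := (ms ω).enorm.pow_const 2
  rw [lintegral_prod_mul (f := fun u => ‖X ω u‖ₑ ^ 2) (g := fun u => ‖X ω u‖ₑ ^ 2)
    ma.aemeasurable ma.aemeasurable, ← eLpNorm_two_sq, enorm_toL2 hω]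
  ring

lemma integral_integral_sq_mul_sq (hXm : Measurable (Function.uncurry X))
    (hXs : ∀ᵐ ω ∂P, MemLp (X ω) 2 μ) (hX4 : MemLp (fun ω => toL2 μ (X ω)) 4 P) :
    ∫ z : ℝ × ℝ, ∫ ω, X ω z.1 ^ 2 * X ω z.2 ^ 2 ∂P ∂μ.prod μ = ∫ ω, ‖toL2 μ (X ω)‖ ^ 4 ∂P := by
  rw [← integral_integral_swap (integrable_uncurry_sq_mul_sq hXm hXs hX4)]
  refine integral_congr_ae ?_
  filter_upwards [hXs] with ω hω
  rw [integral_prod_mul (fun u => X ω u ^ 2) (fun u => X ω u ^ 2)]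
  have h : ∫ u, X ω u ^ 2 ∂μ = ‖toL2 μ (X ω)‖ ^ 2 := by
    rw [← real_inner_self_eq_norm_sq, inner_toL2 hω hω]
    simp_rw [sq]
  rw [h]
  ring

end FourthOrder

/-! ### Moments of the innovations -/

section IndependentCopies

variable {Ω : Type*} [MeasurableSpace Ω] {H : Type*} [NormedAddCommGroup H] [InnerProductSpace ℝ H]
  [MeasurableSpace H] [BorelSpace H] [SecondCountableTopology H]
  {P : Measure Ω} [IsProbabilityMeasure P] {e : ℤ → Ω → H}

/-- The innovations at times `0` and `1` are distributed as two independent copies of the innovation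
at time `0`. -/
lemma IsNoise.noiseCross_eq_integral_prod (he : IsNoise P e) :
    noiseCross P e = ∫ w : Ω × Ω, (inner ℝ (e 0 w.1) (e 0 w.2) : ℝ) ^ 2 ∂P.prod P := by
  have h0 := he.aemeasurable 0
  have hfst : IdentDistrib (e 0) (fun w : Ω × Ω => e 0 w.1) P (P.prod P) :=
    ⟨h0, h0.comp_quasiMeasurePreserving Measure.quasiMeasurePreserving_fst, by
      rw [← Function.comp_def (e 0) Prod.fst, ← AEMeasurable.map_map_of_aemeasurable
        (by rwa [measurePreserving_fst.map_eq]) measurable_fst.aemeasurable,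
        measurePreserving_fst.map_eq]⟩
  have hsnd : IdentDistrib (e 0) (fun w : Ω × Ω => e 0 w.2) P (P.prod P) :=
    ⟨h0, h0.comp_quasiMeasurePreserving Measure.quasiMeasurePreserving_snd, by
      rw [← Function.comp_def (e 0) Prod.snd, ← AEMeasurable.map_map_of_aemeasurable
        (by rwa [measurePreserving_snd.map_eq]) measurable_snd.aemeasurable,
        measurePreserving_snd.map_eq]⟩
  have h := hfst.prodMk ((he.ident 1).trans hsnd) (he.indep.indepFun zero_ne_one)
    (indepFun_prod₀ h0 h0)
  have hm : Measurable fun z : H × H => (inner ℝ z.1 z.2 : ℝ) ^ 2 := by fun_prop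
  exact (h.comp hm).integral_eq

end IndependentCopies

instance instSecondCountableTopologyL2 (μ : Measure ℝ) [SigmaFinite μ] :
    SecondCountableTopology (Lp ℝ 2 μ) :=
  haveI : Fact ((2 : ENNReal) ≠ ⊤) := ⟨ENNReal.ofNat_ne_top⟩
  inferInstance

section Innovations

variable {Ω : Type*} [MeasurableSpace Ω] {P : Measure Ω} [IsProbabilityMeasure P]
  {f : ℝ → ℝ} {ε : ℤ → Ω → ℝ → ℝ}

lemma IsTangentProcess.ae_memLp {μ : Measure ℝ} {X : Ω → ℝ → ℝ} (hX : IsTangentProcess P μ X) :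
    ∀ᵐ ω ∂P, MemLp (X ω) 2 μ :=
  hX.mem.mono fun _ h => h.1

lemma InnovationCondition.isNoise (hf : IsDensity f) (hA2 : InnovationCondition P f ε)
    (hA4 : FourthMomentCondition P f ε) :
    IsNoise P fun t ω => toL2 (densityMeasure f) (ε t ω) := by
  have := isProbabilityMeasure_densityMeasure hf
  have hm := (hA2.tangent 0).ae_memLp
  have h4 := memLp_four_toL2 (hA2.tangent 0).measurable hm
    (hA2.identDistrib 0).aemeasurable_fst.aestronglyMeasurable (hA4 0)
  have h2 : MemLp (fun ω => toL2 (densityMeasure f) (ε 0 ω)) 2 P := h4.mono_exponent (by norm_num)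
  refine ⟨hA2.indep, hA2.identDistrib, h4, Lp.ext ?_⟩
  filter_upwards [coeFn_integral_toL2 (memLp_uncurry (hA2.tangent 0).measurable hm h2) hm
    (h2.integrable one_le_two), hA2.mean_zero 0, Lp.coeFn_zero ℝ 2 (densityMeasure f)]
    with u h5 h6 h7
  rw [h5, h6, h7, Pi.zero_apply]

lemma InnovationCondition.memLp_uncurry_zero (hf : IsDensity f) (hA2 : InnovationCondition P f ε)
    (hA4 : FourthMomentCondition P f ε) :
    MemLp (Function.uncurry (ε 0)) 2 (P.prod (densityMeasure f)) := by
  have := isProbabilityMeasure_densityMeasure hf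
  exact memLp_uncurry (hA2.tangent 0).measurable (hA2.tangent 0).ae_memLp
    ((hA2.isNoise hf hA4).memLp_two 0)

/-- Almost every pair of sections is centred and square integrable, also for the diagonal values that
enter the fourth moment kernel, although the diagonal is a null set. -/
lemma InnovationCondition.ae_innovCov_eq (hf : IsDensity f) (hA2 : InnovationCondition P f ε)
    (hA4 : FourthMomentCondition P f ε) :
    ∀ᵐ z ∂(densityMeasure f).prod (densityMeasure f),
      innovCov P ε z.1 z.2 = momentKernel P (ε 0) z.1 z.2 ∧
      innovCov P ε z.1 z.1 = momentKernel P (ε 0) z.1 z.1 ∧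
      innovCov P ε z.2 z.2 = momentKernel P (ε 0) z.2 z.2 := by
  have := isProbabilityMeasure_densityMeasure hf
  have hgood : ∀ᵐ u ∂densityMeasure f, MemLp (fun ω => ε 0 ω u) 2 P ∧ ∫ ω, ε 0 ω u ∂P = 0 :=
    (ae_memLp_section (hA2.memLp_uncurry_zero hf hA4) (hA2.tangent 0).measurable).and
      (hA2.mean_zero 0)
  have hcov : ∀ u v, (MemLp (fun ω => ε 0 ω u) 2 P ∧ ∫ ω, ε 0 ω u ∂P = 0) →
      (MemLp (fun ω => ε 0 ω v) 2 P ∧ ∫ ω, ε 0 ω v ∂P = 0) →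
      innovCov P ε u v = momentKernel P (ε 0) u v := fun u v hu hv => by
    rw [innovCov, covariance_eq_sub hu.1 hv.1, hu.2, zero_mul, sub_zero]
    rfl
  filter_upwards [Measure.quasiMeasurePreserving_fst.ae hgood,
    Measure.quasiMeasurePreserving_snd.ae hgood] with z h1 h2
  exact ⟨hcov _ _ h1 h2, hcov _ _ h1 h1, hcov _ _ h2 h2⟩

lemma InnovationCondition.integrable_innovCov_sq (hf : IsDensity f)
    (hA2 : InnovationCondition P f ε) (hA4 : FourthMomentCondition P f ε) :
    Integrable (fun z : ℝ × ℝ => innovCov P ε z.1 z.2 ^ 2)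
      ((densityMeasure f).prod (densityMeasure f)) := by
  have := isProbabilityMeasure_densityMeasure hf
  refine (integrable_momentKernel_sq (hA2.memLp_uncurry_zero hf hA4)
    (hA2.tangent 0).measurable).congr ?_
  filter_upwards [hA2.ae_innovCov_eq hf hA4] with z hz
  rw [hz.1]

lemma InnovationCondition.K1_eq (hf : IsDensity f) (hA2 : InnovationCondition P f ε)
    (hA4 : FourthMomentCondition P f ε) :
    K1 P f ε = noiseCross P fun t ω => toL2 (densityMeasure f) (ε t ω) := by
  have := isProbabilityMeasure_densityMeasure hf
  rw [(hA2.isNoise hf hA4).noiseCross_eq_integral_prod, ← integral_momentKernel_sq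
    (hA2.memLp_uncurry_zero hf hA4) (hA2.tangent 0).measurable (hA2.tangent 0).ae_memLp, K1]
  refine integral_congr_ae ?_
  filter_upwards [hA2.ae_innovCov_eq hf hA4] with z hz
  rw [hz.1]

lemma InnovationCondition.ae_fourthKernel_eq (hf : IsDensity f) (hA2 : InnovationCondition P f ε)
    (hA4 : FourthMomentCondition P f ε) :
    (fun z : ℝ × ℝ => ∫ ω, ε 0 ω z.1 ^ 2 * ε 0 ω z.2 ^ 2 ∂P -
        2 * momentKernel P (ε 0) z.1 z.2 ^ 2 -
        momentKernel P (ε 0) z.1 z.1 * momentKernel P (ε 0) z.2 z.2)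
      =ᵐ[(densityMeasure f).prod (densityMeasure f)] fun z => fourthKernel P ε z.1 z.2 := by
  filter_upwards [hA2.ae_innovCov_eq hf hA4] with z hz
  rw [fourthKernel, hz.1, hz.2.1, hz.2.2]

lemma InnovationCondition.integrable_momentKernel_self (hf : IsDensity f)
    (hA2 : InnovationCondition P f ε) (hA4 : FourthMomentCondition P f ε) :
    Integrable (fun u => momentKernel P (ε 0) u u) (densityMeasure f) := by
  have := isProbabilityMeasure_densityMeasure hf
  have h := hA2.memLp_uncurry_zero hf hA4
  exact (integrable_uncurry_mul h h).integral_prod_right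

lemma InnovationCondition.integrable_fourthKernel (hf : IsDensity f)
    (hA2 : InnovationCondition P f ε) (hA4 : FourthMomentCondition P f ε) :
    Integrable (fun z : ℝ × ℝ => fourthKernel P ε z.1 z.2)
      ((densityMeasure f).prod (densityMeasure f)) := by
  have := isProbabilityMeasure_densityMeasure hf
  have hself := hA2.integrable_momentKernel_self hf hA4
  refine Integrable.congr ?_ (hA2.ae_fourthKernel_eq hf hA4)
  refine Integrable.sub (Integrable.sub ?_ ?_) (hself.mul_prod hself)
  · exact (integrable_uncurry_sq_mul_sq (hA2.tangent 0).measurable (hA2.tangent 0).ae_memLp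
      ((hA2.isNoise hf hA4).memLp 0)).integral_prod_right
  · exact (integrable_momentKernel_sq (hA2.memLp_uncurry_zero hf hA4)
      (hA2.tangent 0).measurable).const_mul 2

lemma InnovationCondition.K2_eq (hf : IsDensity f) (hA2 : InnovationCondition P f ε)
    (hA4 : FourthMomentCondition P f ε) :
    K2 P f ε = noiseCumulant P fun t ω => toL2 (densityMeasure f) (ε t ω) := by
  have := isProbabilityMeasure_densityMeasure hf
  have he := hA2.isNoise hf hA4
  have hself := hA2.integrable_momentKernel_self hf hA4
  have hu := hA2.memLp_uncurry_zero hf hA4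
  have hm := (hA2.tangent 0).ae_memLp
  have hX := (hA2.tangent 0).measurable
  have h1 := (integrable_uncurry_sq_mul_sq hX hm (he.memLp 0)).integral_prod_right
  have h2 := integrable_momentKernel_sq hu hX
  have hvar : ∫ u, momentKernel P (ε 0) u u ∂densityMeasure f =
      noiseVar P fun t ω => toL2 (densityMeasure f) (ε t ω) := by
    rw [noiseVar]
    simp_rw [← real_inner_self_eq_norm_sq]
    rw [integral_inner_toL2 hu hu hm hm]
    rfl
  have hcross : ∫ z : ℝ × ℝ, momentKernel P (ε 0) z.1 z.2 ^ 2
      ∂(densityMeasure f).prod (densityMeasure f) =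
      noiseCross P fun t ω => toL2 (densityMeasure f) (ε t ω) := by
    rw [he.noiseCross_eq_integral_prod, integral_momentKernel_sq hu hX hm]
  simp only [Function.uncurry] at h1
  rw [K2, ← integral_congr_ae (hA2.ae_fourthKernel_eq hf hA4),
    integral_sub (f := fun z : ℝ × ℝ => ∫ ω, ε 0 ω z.1 ^ 2 * ε 0 ω z.2 ^ 2 ∂P -
      2 * momentKernel P (ε 0) z.1 z.2 ^ 2) (h1.sub (h2.const_mul 2)) (hself.mul_prod hself),
    integral_sub h1 (h2.const_mul 2), integral_const_mul, hcross,
    integral_prod_mul (fun u => momentKernel P (ε 0) u u) (fun u => momentKernel P (ε 0) u u),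
    hvar, noiseCumulant]
  have h4 := integral_integral_sq_mul_sq hX hm (he.memLp 0)
  rw [h4]
  ring

end Innovations

/-! ### The long-run covariance matrix -/

section LongRun

variable {Ω : Type*} [MeasurableSpace Ω] {P : Measure Ω} [IsProbabilityMeasure P]
  {f : ℝ → ℝ} {ε : ℤ → Ω → ℝ → ℝ} {p : ℕ} {β : Fin p → ℝ}

lemma InnovationCondition.longRunTerm_eq (hf : IsDensity f) (hA2 : InnovationCondition P f ε)
    (hA4 : FourthMomentCondition P f ε) (i j r : ℤ) :
    longRunTerm P f β ε i j r =
      bilinearAcov (noiseCross P fun t ω => toL2 (densityMeasure f) (ε t ω))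
        (noiseCumulant P fun t ω => toL2 (densityMeasure f) (ε t ω))
        (psi β) (fun l => psi β (l + i)) (psi β) (fun l => psi β (l + j)) r := by
  -- both second factors are shifted by `i` to match the cross-correlations in `bilinearAcov`
  have h2 : ∑' l : ℤ, psi β l * psi β (l + r + j - i) =
      ∑' l : ℤ, psi β (l + i) * psi β (l + r + j) := by
    rw [← (Equiv.addRight i).tsum_eq]
    refine tsum_congr fun l => ?_
    simp only [Equiv.coe_addRight]
    rw [show l + i + r + j - i = l + r + j by ring]
  have h3 : ∑' l : ℤ, psi β l * psi β (l + r - i) = ∑' l : ℤ, psi β (l + i) * psi β (l + r) := by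
    rw [← (Equiv.addRight i).tsum_eq]
    refine tsum_congr fun l => ?_
    simp only [Equiv.coe_addRight]
    rw [show l + i + r - i = l + r by ring]
  rw [longRunTerm, hA2.K1_eq hf hA4, hA2.K2_eq hf hA4, S1, S2, S3, h2, h3]
  rfl

lemma InnovationCondition.summable_longRunTerm (hf : IsDensity f)
    (hA1 : AutoregressiveCondition β) (hA2 : InnovationCondition P f ε)
    (hA4 : FourthMomentCondition P f ε) (i j : ℤ) :
    Summable fun r : ℤ => longRunTerm P f β ε i j r := by
  simp_rw [hA2.longRunTerm_eq hf hA4]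
  have hψ := summable_abs_psi hA1
  exact (summable_abs_bilinearAcov hψ (summable_abs_shift hψ i) hψ (summable_abs_shift hψ j)
    _ _).of_abs

lemma InnovationCondition.longRunCov_eq (hf : IsDensity f) (hA2 : InnovationCondition P f ε)
    (hA4 : FourthMomentCondition P f ε) (h : ℕ) :
    longRunCov P f β ε h =
      acovMatrix (noiseCross P fun t ω => toL2 (densityMeasure f) (ε t ω))
        (noiseCumulant P fun t ω => toL2 (densityMeasure f) (ε t ω)) (psi β) h := by
  ext i j
  rw [longRunCov, acovMatrix, Matrix.of_apply, Matrix.of_apply]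
  exact tsum_congr fun r => hA2.longRunTerm_eq hf hA4 _ _ r

end LongRun

/-! ### Covariances of the sample autocovariances -/

section SampleCovariance

variable {Ω : Type*} [MeasurableSpace Ω] {H : Type*} [NormedAddCommGroup H] [InnerProductSpace ℝ H]
  [MeasurableSpace H] [BorelSpace H] [CompleteSpace H] [SecondCountableTopology H]
  {P : Measure Ω} [IsProbabilityMeasure P] {e : ℤ → Ω → H} {ψ : ℤ → ℝ} {x : ℤ → Ω → H}

lemma covariance_congr_ae {X X' Y Y' : Ω → ℝ} (hX : X =ᵐ[P] X') (hY : Y =ᵐ[P] Y') :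
    cov[X, Y; P] = cov[X', Y'; P] := by
  rw [covariance, covariance, integral_congr_ae hX, integral_congr_ae hY]
  refine integral_congr_ae ?_
  filter_upwards [hX, hY] with ω h1 h2
  rw [h1, h2]

namespace IsNoise

lemma sampleAcov_ae_eq (he : IsNoise P e) (hψ : Summable fun i => |ψ i|)
    (hx : ∀ t, x t =ᵐ[P] he.linearLp ψ t) {n : ℕ} (hn : 0 < n) (k : ℕ) :
    (fun ω => sampleAcov (fun t => x t ω) n k) =ᵐ[P]
      fun ω => (√(n : ℝ))⁻¹ * he.acovError ψ n k ω + linearAcov P e ψ k := by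
  filter_upwards [he.coeFn_acovError hψ hx n k] with ω hω
  have hs : (0 : ℝ) < √(n : ℝ) := Real.sqrt_pos.2 (by exact_mod_cast hn)
  rw [hω, inv_mul_cancel_left₀ hs.ne', sub_add_cancel]

lemma memLp_sampleAcov (he : IsNoise P e) (hψ : Summable fun i => |ψ i|)
    (hx : ∀ t, x t =ᵐ[P] he.linearLp ψ t) (n k : ℕ) :
    MemLp (fun ω => sampleAcov (fun t => x t ω) n k) 2 P := by
  rcases Nat.eq_zero_or_pos n with rfl | hn
  · simp [sampleAcov]
  · exact MemLp.ae_eq (he.sampleAcov_ae_eq hψ hx hn k).symm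
      (((Lp.memLp (he.acovError ψ n k)).const_mul _).add (memLp_const (linearAcov P e ψ k)))

lemma integral_acovError (he : IsNoise P e) (hψ : Summable fun i => |ψ i|) (n k : ℕ) :
    ∫ ω, he.acovError ψ n k ω ∂P = 0 := by
  have h : he.acovError ψ n k =ᵐ[P] fun ω => (√(n : ℝ))⁻¹ * ∑ t ∈ Finset.Icc 1 n,
      bilinearAverage he.productL2 ψ (fun l => ψ (l + k)) ((t : ℕ) : ℤ) ω := by
    filter_upwards [Lp.coeFn_smul (√(n : ℝ))⁻¹ (∑ t ∈ Finset.Icc 1 n,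
      bilinearAverage he.productL2 ψ (fun l => ψ (l + k)) ((t : ℕ) : ℤ)),
      Lp.coeFn_finsetSum (Finset.Icc 1 n) fun t : ℕ =>
        bilinearAverage he.productL2 ψ (fun l => ψ (l + k)) ((t : ℕ) : ℤ)] with ω h2 h3
    rw [acovError, h2, Pi.smul_apply, h3, Finset.sum_apply, smul_eq_mul]
  rw [integral_congr_ae h, integral_const_mul,
    integral_finsetSum _ fun t _ => (Lp.memLp _).integrable one_le_two]
  simp_rw [he.integral_bilinearAverage hψ (summable_abs_shift hψ k)]
  simp

lemma covariance_sampleAcov (he : IsNoise P e) (hψ : Summable fun i => |ψ i|)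
    (hx : ∀ t, x t =ᵐ[P] he.linearLp ψ t) (n k l : ℕ) :
    (n : ℝ) * cov[fun ω => sampleAcov (fun t => x t ω) n k,
      fun ω => sampleAcov (fun t => x t ω) n l; P] =
      inner ℝ (he.acovError ψ n k) (he.acovError ψ n l) := by
  rcases Nat.eq_zero_or_pos n with rfl | hn
  · simp [acovError]
  · have hs : (0 : ℝ) < √(n : ℝ) := Real.sqrt_pos.2 (by exact_mod_cast hn)
    have hint : ∀ k, Integrable (fun ω => (√(n : ℝ))⁻¹ * he.acovError ψ n k ω) P := fun k =>
      ((Lp.memLp _).integrable one_le_two).const_mul _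
    rw [covariance_congr_ae (he.sampleAcov_ae_eq hψ hx hn k) (he.sampleAcov_ae_eq hψ hx hn l),
      covariance_add_const_left (hint k), covariance_add_const_right (hint l),
      covariance_const_mul_left, covariance_const_mul_right,
      covariance_eq_sub (Lp.memLp (he.acovError ψ n k)) (Lp.memLp (he.acovError ψ n l)), he.integral_acovError hψ, zero_mul, sub_zero,
      L2.inner_def, ← mul_assoc, ← mul_assoc]
    have hone : (n : ℝ) * (√(n : ℝ))⁻¹ * (√(n : ℝ))⁻¹ = 1 := by
      rw [mul_assoc, ← mul_inv, Real.mul_self_sqrt (Nat.cast_nonneg n)]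
      exact mul_inv_cancel₀ (by exact_mod_cast hn.ne')
    rw [hone, one_mul]
    refine integral_congr_ae (ae_of_all _ fun ω => ?_)
    simp [mul_comm]

end IsNoise

end SampleCovariance

/-! ### The stationary solution as a linear process -/

section Stationary

variable {Ω : Type*} [MeasurableSpace Ω] {H : Type*} [NormedAddCommGroup H] [InnerProductSpace ℝ H]
  [CompleteSpace H] {P : Measure Ω} [IsProbabilityMeasure P] {X : ℤ → Ω → H}

/-- Testing the autocovariance operator of lag zero against `x` shows that the variance of `⟨x, X_t⟩`
does not depend on `t`; a bound that does not require the mean to vanish. -/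
lemma IsStationary.exists_integral_inner_sq_le (hX : IsStationary P X) (x : H) :
    ∃ C : ℝ, ∀ t, ∫ ω, (inner ℝ x (X t ω) : ℝ) ^ 2 ∂P ≤ C := by
  set m := ∫ ω, X 0 ω ∂P with hm
  have hY : ∀ t, MemLp (fun ω => X t ω - m) 2 P := fun t => (hX.memLp t).sub (memLp_const m)
  have hsm : ∀ t, Integrable (fun ω => (inner ℝ (X t ω - m) x : ℝ) • (X t ω - m)) P := fun t =>
    memLp_one_iff_integrable.1 ((hY t).smul ((hY t).inner_const x))
  have hsq : ∀ t, Integrable (fun ω => (inner ℝ x (X t ω - m) : ℝ) ^ 2) P := fun t =>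
    ((hY t).const_inner x).integrable_sq
  have h : ∀ t, ∫ ω, (inner ℝ x (X t ω - m) : ℝ) ^ 2 ∂P =
      ∫ ω, (inner ℝ x (X 0 ω - m) : ℝ) ^ 2 ∂P := fun t => by
    have h1 := congrArg (fun y => (inner ℝ x y : ℝ)) (hX.autocov t 0 x)
    simp only [add_zero, ← hm] at h1
    rw [← integral_inner (hsm t), ← integral_inner (hsm 0)] at h1
    simpa only [inner_smul_right, real_inner_comm x, ← sq] using h1
  refine ⟨2 * ∫ ω, (inner ℝ x (X 0 ω - m) : ℝ) ^ 2 ∂P + 2 * inner ℝ x m ^ 2, fun t => ?_⟩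
  calc
    ∫ ω, (inner ℝ x (X t ω) : ℝ) ^ 2 ∂P
      ≤ ∫ ω, (2 * (inner ℝ x (X t ω - m) : ℝ) ^ 2 + 2 * (inner ℝ x m : ℝ) ^ 2) ∂P := by
        refine integral_mono ((hX.memLp t).const_inner x).integrable_sq
          (((hsq t).const_mul 2).add (integrable_const _)) fun ω => ?_
        simp only [inner_sub_right]
        nlinarith [sq_nonneg ((inner ℝ x (X t ω) : ℝ) - 2 * inner ℝ x m)]
    _ = _ := by
        rw [integral_add ((hsq t).const_mul 2) (integrable_const _), integral_const_mul, h t]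
        simp

end Stationary

section Solution

variable {Ω : Type*} [MeasurableSpace Ω] {P : Measure Ω} [IsProbabilityMeasure P]
  {f : ℝ → ℝ} {p : ℕ} {β : Fin p → ℝ} {ε V : ℤ → Ω → ℝ → ℝ}

lemma IsStationarySolution.ae_isRegularPath (hV : IsStationarySolution P f β ε V)
    (hA3 : MonotonicityCondition P f V) : ∀ᵐ ω ∂P, ∀ t, IsRegularPath f (V t ω) := by
  rw [ae_all_iff]
  intro t
  filter_upwards [(hV.tangent t).ae_memLp, hA3 t] with ω h1 h2
  exact ⟨(hV.tangent t).measurable.of_uncurry_left, h1, h2⟩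

lemma IsStationarySolution.toL2_ae_eq (hA2 : InnovationCondition P f ε)
    (hV : IsStationarySolution P f β ε V) (t : ℤ) :
    (fun ω => toL2 (densityMeasure f) (V t ω)) =ᵐ[P] fun ω =>
      ∑ j : Fin p, β j • toL2 (densityMeasure f) (V (t - ((j : ℕ) + 1)) ω) +
        toL2 (densityMeasure f) (ε t ω) := by
  filter_upwards [hV.equation t, ae_all_iff.2 fun s => (hV.tangent s).ae_memLp,
    (hA2.tangent t).ae_memLp] with ω h1 h2 h3
  have h4 : ∀ j ∈ Finset.univ, MemLp (fun u => β j * V (t - ((j : ℕ) + 1)) ω u) 2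
      (densityMeasure f) := fun j _ => (h2 _).const_mul _
  rw [toL2_congr h1, toL2_add (memLp_finsetSum _ h4) h3, toL2_sum _ h4]
  congr 1
  exact Finset.sum_congr rfl fun j _ => toL2_const_mul _ (h2 _)

lemma IsStationarySolution.ae_eq_linearLp (hf : IsDensity f) (hA1 : AutoregressiveCondition β)
    (hA2 : InnovationCondition P f ε) (hV : IsStationarySolution P f β ε V)
    (hA4 : FourthMomentCondition P f ε) (t : ℤ) :
    (fun ω => toL2 (densityMeasure f) (V t ω)) =ᵐ[P]
      (hA2.isNoise hf hA4).linearLp (psi β) t := by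
  have := isProbabilityMeasure_densityMeasure hf
  exact (hA2.isNoise hf hA4).ae_eq_linearLp hA1 (v := fun t ω => toL2 (densityMeasure f) (V t ω))
    hV.stationary.memLp hV.stationary.exists_integral_inner_sq_le (hV.toL2_ae_eq hA2) t

/-- The logarithmic map recovers `V_t` inside the support, so that the Wasserstein autocovariances are
the autocovariances of the linear process. -/
lemma IsStationarySolution.intAcov_eq (hf : IsDensity f)
    (hsupp : (densityMeasure f).support.OrdConnected) (hA1 : AutoregressiveCondition β)
    (hA2 : InnovationCondition P f ε) (hV : IsStationarySolution P f β ε V)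
    (hA3 : MonotonicityCondition P f V) (hA4 : FourthMomentCondition P f ε) (k : ℕ) :
    intAcov P f V k =
      linearAcov P (fun t ω => toL2 (densityMeasure f) (ε t ω)) (psi β) k := by
  have := isProbabilityMeasure_densityMeasure hf
  have he := hA2.isNoise hf hA4
  have hψ := summable_abs_psi hA1
  have hx := hV.ae_eq_linearLp hf hA1 hA2 hA4
  have hm := fun t => (hV.tangent t).ae_memLp
  have hX := fun t => (hV.tangent t).measurable
  have hu : ∀ t, MemLp (Function.uncurry (V t)) 2 (P.prod (densityMeasure f)) := fun t =>
    memLp_uncurry (hX t) (hm t) (hV.stationary.memLp t)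
  have hmean : ∀ᵐ u ∂densityMeasure f, ∫ ω, V 0 ω u ∂P = 0 := by
    have h1 := coeFn_integral_toL2 (hu 0) (hm 0) ((hV.stationary.memLp 0).integrable one_le_two)
    rw [integral_congr_ae (hx 0), he.integral_linearLp hψ 0] at h1
    filter_upwards [h1, Lp.coeFn_zero ℝ 2 (densityMeasure f)] with u h2 h3
    rw [← h2, h3, Pi.zero_apply]
  have hcov : ∀ᵐ u ∂densityMeasure f, acovKernel P f V k u u = ∫ ω, V 0 ω u * V k ω u ∂P := by
    filter_upwards [ae_mem_interior_support hsupp, ae_memLp_section (hu 0) (hX 0),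
      ae_memLp_section (hu k) (hX k), hmean] with u h1 h2 h3 h4
    have hlog : ∀ t, (fun ω => logMap f (expMap f (V t ω)) u) =ᵐ[P] fun ω => V t ω u := fun t => by
      filter_upwards [hV.ae_isRegularPath hA3] with ω hω
      exact logMap_expMap hf hsupp (hω t) h1
    rw [acovKernel, covariance_congr_ae (hlog 0) (hlog k), covariance_eq_sub h2 h3, h4, zero_mul,
      sub_zero]
    rfl
  have h5 := he.integral_inner_linearLp hψ 0 k
  rw [zero_add] at h5
  rw [intAcov, integral_congr_ae hcov, ← integral_inner_toL2 (hu 0) (hu k) (hm 0) (hm k),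
    linearAcov, ← h5]
  refine integral_congr_ae ?_
  filter_upwards [hx 0, hx k] with ω h6 h7
  rw [h6, h7]

lemma IsStationarySolution.jacobian_eq (hf : IsDensity f)
    (hsupp : (densityMeasure f).support.OrdConnected) (hA1 : AutoregressiveCondition β)
    (hA2 : InnovationCondition P f ε) (hV : IsStationarySolution P f β ε V)
    (hA3 : MonotonicityCondition P f V) (hA4 : FourthMomentCondition P f ε) (h : ℕ) :
    jacobian P f V h =
      acorrJacobian (linearAcov P (fun t ω => toL2 (densityMeasure f) (ε t ω)) (psi β)) h := by
  have hγ := hV.intAcov_eq hf hsupp hA1 hA2 hA3 hA4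
  rw [jacobian, acorrJacobian, ← hγ 0]
  simp_rw [acorr, ← hγ]
  push_cast
  rfl

end Solution

end WAR

theorem theorem5 {Ω : Type*} [MeasurableSpace Ω] (P : Measure Ω) [IsProbabilityMeasure P]
    -- the Wasserstein mean density, whose support is an interval
    (f : ℝ → ℝ) (hf : WAR.IsDensity f) (hsupp : (WAR.densityMeasure f).support.OrdConnected)
    -- the model and its assumptions
    {p : ℕ} (β : Fin p → ℝ) (ε V : ℤ → Ω → ℝ → ℝ)
    (hA1 : WAR.AutoregressiveCondition β)
    (hA2 : WAR.InnovationCondition P f ε)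
    (hV : WAR.IsStationarySolution P f β ε V)
    (hA3 : WAR.MonotonicityCondition P f V)
    (hA4 : WAR.FourthMomentCondition P f ε)
    -- the autocorrelations have a positive denominator, the Wasserstein variance
    (hpos : 0 < WAR.intAcov P f V 0)
    -- the random quantile functions, and the maximal lag
    (Q : ℤ → Ω → ℝ → ℝ) (hQ : ∀ t ω, Q t ω = WAR.quantile (WAR.expMap f (V t ω))) (h : ℕ) :
    -- the quantities in the definition of the matrix `V` are well-defined
    Summable (fun i : ℤ => |WAR.psi β i|) ∧
    Integrable (fun z : ℝ × ℝ => WAR.innovCov P ε z.1 z.2 ^ 2)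
      ((WAR.densityMeasure f).prod (WAR.densityMeasure f)) ∧
    Integrable (fun z : ℝ × ℝ => WAR.fourthKernel P ε z.1 z.2)
      ((WAR.densityMeasure f).prod (WAR.densityMeasure f)) ∧
    (∀ i j : Fin (h + 1), Summable fun r : ℤ => WAR.longRunTerm P f β ε (i : ℕ) (j : ℕ) r) ∧
    -- its entries are the long-run covariances of the integrated sample autocovariances
    (∀ (n : ℕ) (i : Fin (h + 1)), MemLp (fun ω => WAR.intSampleAcov (fun t => Q t ω)
      (WAR.quantile (WAR.densityMeasure f)) n i) 2 P) ∧
    (∀ i j : Fin (h + 1), Tendsto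
      (fun n : ℕ => (n : ℝ) *
        cov[fun ω => WAR.intSampleAcov (fun t => Q t ω)
              (WAR.quantile (WAR.densityMeasure f)) n i,
            fun ω => WAR.intSampleAcov (fun t => Q t ω)
              (WAR.quantile (WAR.densityMeasure f)) n j; P])
      atTop (𝓝 (WAR.longRunCov P f β ε h i j))) ∧
    (WAR.longRunCov P f β ε h).PosSemidef ∧
    -- asymptotic normality
    TendstoInDistribution
      (fun (n : ℕ) ω => (WithLp.toLp 2 fun i : Fin h =>
        √(n : ℝ) * (WAR.acorrHat (fun t => Q t ω) n ((i : ℕ) + 1)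
          - WAR.acorr P f V ((i : ℕ) + 1)) : EuclideanSpace ℝ (Fin h)))
      atTop (id : EuclideanSpace ℝ (Fin h) → EuclideanSpace ℝ (Fin h)) (fun _ => P)
      (multivariateGaussian 0 (WAR.jacobian P f V h * WAR.longRunCov P f β ε h
        * (WAR.jacobian P f V h).transpose)) := by
  have hμ := WAR.isProbabilityMeasure_densityMeasure hf
  have he := hA2.isNoise hf hA4
  have hψ := WAR.summable_abs_psi hA1
  have hx := hV.ae_eq_linearLp hf hA1 hA2 hA4
  have hγ := hV.intAcov_eq hf hsupp hA1 hA2 hA3 hA4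
  have hreg := hV.ae_isRegularPath hA3
  have hS : ∀ n k, (fun ω => WAR.intSampleAcov (fun t => Q t ω)
      (WAR.quantile (WAR.densityMeasure f)) n k) =ᵐ[P] fun ω =>
        WAR.sampleAcov (fun t => WAR.toL2 (WAR.densityMeasure f) (V t ω)) n k := fun n k => by
    filter_upwards [hreg] with ω hω
    simp_rw [hQ]
    exact WAR.intSampleAcov_eq hf hsupp hω n k
  have hpos' : 0 < WAR.linearAcov P (fun t ω => WAR.toL2 (WAR.densityMeasure f) (ε t ω))
      (WAR.psi β) 0 := by
    rw [← hγ 0]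
    exact hpos
  rw [hA2.longRunCov_eq hf hA4, hV.jacobian_eq hf hsupp hA1 hA2 hA3 hA4]
  refine ⟨hψ, hA2.integrable_innovCov_sq hf hA4, hA2.integrable_fourthKernel hf hA4,
    fun i j => hA2.summable_longRunTerm hf hA1 hA4 _ _,
    fun n i => (he.memLp_sampleAcov hψ hx n i).ae_eq (hS n i).symm, fun i j => ?_,
    he.posSemidef_acovMatrix hψ h, he.tendstoInDistribution_acorr hψ hx hpos' h fun n => ?_⟩
  · refine (he.tendsto_inner_acovError hψ i j).congr fun n => ?_
    rw [WAR.covariance_congr_ae (hS n i) (hS n j), he.covariance_sampleAcov hψ hx]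
  · filter_upwards [hreg] with ω hω
    congr 1
    funext i
    -- for an empty sample the factor `√n` vanishes
    rcases Nat.eq_zero_or_pos n with rfl | hn
    · simp
    · have hγ0 := hγ 0
      have hγi := hγ ((i : ℕ) + 1)
      push_cast at hγ0 hγi
      rw [WAR.acorr, hγi, hγ0, WAR.acorrHat]
      simp_rw [hQ]
      rw [WAR.integral_etaHat_mul_densityHat hf hsupp hω hn,
        WAR.integral_etaHat_mul_densityHat hf hsupp hω hn]
      rfl
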